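/- **Setting.** Let $d\in\{2,3\}$ and let $D\subset\mathbb R^d$ be a bounded domain with a conforming partition $\mathcal T^H$ into $N$ convex polytopes (coarse blocks) $K_1,\dots,K_N$ with vertices $x_1,\dots,x_{N_c}$; every block has diameter at most $H$, contains a ball of radius $\rho H$ and has at most $n_v$ vertices. Let $\{\chi_j\}$ be a Lipschitz partition of unity on $D$ ($\chi_j\ge 0$, $\sum_j\chi_j=1$), $\chi_j$ vanishing on the blocks that do not have $x_j$ as a vertex. Let the Lamé coefficients $\lambda>0$, $\mu>0$ be measurable and bounded on $D$, $\mu$ bounded away from zero. Put $V=H^1_0(D)^d$, $\epsilon(u)=\frac12(\nabla u+\nabla u^T)$, $$a_G(u,v)=\int_G 2\mu\,\epsilon(u):\epsilon(v)+\lambda(\nabla\cdot u)(\nabla\cdot v),\quad \tilde\kappa=(\lambda+2\mu)\sum_j|\nabla\chi_j|^2,\quad s_G(u,v)=\int_G\tilde\kappa\,u\cdot v,$$ $a=a_D$, $s=s_D$, $a_i=a_{K_i}$, $s_i=s_{K_i}$, $\|u\|_a^2=a(u,u)$, $\|u\|_s^2=s(u,u)$, and assume $\tilde\kappa>0$ almost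 everywhere in $D$. Let $V(K_i)$ be the closure in $H^1(K_i)$ of the restrictions of $V$ to $K_i$. For every block let $\phi^i_1,\dots,\phi^i_{J_i}\in V(K_i)$ be $s_i$-orthonormal eigenfunctions for the $J_i$ smallest eigenvalues of the problem $a_i(\phi,v)=\theta\, s_i(\phi,v)$ for all $v\in V(K_i)$ (extended by zero to $D$), and let $\Lambda>0$ be the smallest discarded eigenvalue over all blocks. A function $\psi\in V$ is $\phi^i_j$-orthogonal if $s(\psi,\phi^i_j)=1$ and $s(\psi,\phi^{i'}_{j'})=0$ for all $(i',j')\ne(i,j)$. Let $K_{i,0}=K_i$ and let $K_{i,m}$ be $K_{i,m-1}$ together with all the blocks that touch it. For $m\ge0$ let $\psi^i_{j,ms}$ (respectively $\psi^i_j$) minimize $a(\psi,\psi)$ over the $\phi^i_j$-orthogonal $\psi\in H^1_0(K_{i,m})^d$ (respectively $\psi\in V$), and let $V_{ms}$ and $V_{glo}$ be the spans of the $\psi^i_{j,ms}$ and of the $\psi^i_j$. Let $f\in L^2(D)^d$ with $\tilde\kappa^{-1/2}f\in L^2(D)^d$, and let $u$, $u_{ms}^{\rm off}$, $u_{glo}$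 be the solutions of $a(u,v)=(f,v)$ in $V$, $V_{ms}$, $V_{glo}$ respectively (the test functions $v$ running through the same space). Let $D_*$ be the least constant such that every $q\in\operatorname{span}\{\phi^i_j:1\le j\le J_i\}$, $1\le i\le N$, admits, for every $\delta>D_*$, a field $v\in H^1_0(K_i)^d$ with $s_i(v-q,\phi^i_j)=0$ for all $j\le J_i$ and $\|v\|_a^2\le \delta\|q\|_s^2$. **Theorem.** There is a constant $C>0$ that depends only on $d$, $\rho$ and $n_v$ such that $$\|u-u_{ms}^{\rm off}\|_a\le C\Lambda^{-1/2}\|\tilde\kappa^{-1/2}f\|_{L^2(D)}+C(m+1)^{d/2}E^{1/2}\|u_{glo}\|_s,$$ where $$E=S^3(1+\Lambda^{-1})^2\Big(1+\frac{\Lambda^{1/2}}{2S^{1/2}}\Big)^{1-m},\qquad S=\max\{n_v,D_*\}.$$ -/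

import Mathlib

open MeasureTheory Set
open scoped ContDiff NNReal

noncomputable section

namespace CEM

/-- Points of `ℝᵈ`, and also values of vector fields on `ℝᵈ`, with the Euclidean norm. -/
abbrev Vec (d : ℕ) : Type := EuclideanSpace ℝ (Fin d)

/-- Values of the gradient of a vector field: `A = ∇u(x)` is the derivative of `u` at `x`. -/
abbrev Grad (d : ℕ) : Type := Vec d →L[ℝ] Vec d

/-- The ambient space of `H¹` vector fields: pairs `(u, ∇u)` of square integrable fields. -/
abbrev Pair {d : ℕ} (ν : Measure (Vec d)) : Type := Lp (Vec d) 2 ν × Lp (Grad d) 2 ν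

/-- Smooth vector fields with compact support in `G`, as pairs `(w, ∇w)`. -/
def testPairs {d : ℕ} (G : Set (Vec d)) : Submodule ℝ (Pair (volume : Measure (Vec d))) where
  carrier := {p | ∃ w : Vec d → Vec d, ContDiff ℝ ∞ w ∧ HasCompactSupport w ∧ tsupport w ⊆ G ∧
    p.1 =ᵐ[volume] w ∧ p.2 =ᵐ[volume] fderiv ℝ w}
  add_mem' := by
    rintro p q ⟨w, hw, hwc, hwG, hp1, hp2⟩ ⟨z, hz, hzc, hzG, hq1, hq2⟩
    refine ⟨w + z, hw.add hz, hwc.add hzc, (tsupport_add w z).trans (union_subset hwG hzG), ?_, ?_⟩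
    · filter_upwards [Lp.coeFn_add p.1 q.1, hp1, hq1] with x h h1 h2
      rw [Prod.fst_add, h, Pi.add_apply, Pi.add_apply, h1, h2]
    · filter_upwards [Lp.coeFn_add p.2 q.2, hp2, hq2] with x h h1 h2
      rw [Prod.snd_add, h, Pi.add_apply, h1, h2,
        fderiv_add (hw.differentiable (by simp) x) (hz.differentiable (by simp) x)]
  zero_mem' := by
    refine ⟨0, contDiff_const, HasCompactSupport.zero, ?_, ?_, ?_⟩
    · simp [tsupport]
    · filter_upwards [Lp.coeFn_zero (Vec d) 2 (volume : Measure (Vec d))] with x h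
      rw [Prod.fst_zero, h]
    · filter_upwards [Lp.coeFn_zero (Grad d) 2 (volume : Measure (Vec d))] with x h
      rw [Prod.snd_zero, h]
      simp
  smul_mem' := by
    rintro c p ⟨w, hw, hwc, hwG, hp1, hp2⟩
    refine ⟨c • w, hw.const_smul c, ?_, ?_, ?_, ?_⟩
    · exact hwc.mono (Function.support_const_smul_subset c w)
    · exact (closure_mono (Function.support_const_smul_subset c w)).trans hwG
    · filter_upwards [Lp.coeFn_smul c p.1, hp1] with x h h1
      rw [Prod.smul_fst, h, Pi.smul_apply, Pi.smul_apply, h1]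
    · filter_upwards [Lp.coeFn_smul c p.2, hp2] with x h h1
      rw [Prod.smul_snd, h, Pi.smul_apply, h1,
        fderiv_const_smul (hw.differentiable (by simp) x)]

/-- `H¹₀(G)` (vector fields, extended by zero to `ℝᵈ`): the closure in `H¹` of the smooth fields
with compact support in `G`. -/
def H10 {d : ℕ} (G : Set (Vec d)) : Submodule ℝ (Pair (volume : Measure (Vec d))) :=
  (testPairs G).topologicalClosure

/-- Restriction of pairs `(u, ∇u)` to a set `K`. -/
def restrictPair {d : ℕ} (K : Set (Vec d)) :
    Pair (volume : Measure (Vec d)) →ₗ[ℝ] Pair (volume.restrict K) :=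
  LinearMap.prodMap
    (LpToLpRestrictCLM (Vec d) (Vec d) ℝ volume 2 K).toLinearMap
    (LpToLpRestrictCLM (Vec d) (Grad d) ℝ volume 2 K).toLinearMap

/-- `V(K)`: the restrictions to `K` of the fields in `V = H¹₀(D)`, closed up in `H¹(K)`. -/
def localSpace {d : ℕ} (D K : Set (Vec d)) : Submodule ℝ (Pair (volume.restrict K)) :=
  ((H10 D).map (restrictPair K)).topologicalClosure

/-- The strain `ε_{ij} = (∂u_i/∂x_j + ∂u_j/∂x_i)/2`. -/
def strain {d : ℕ} (A : Grad d) (i j : Fin d) : ℝ :=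
  (A (EuclideanSpace.single j 1) i + A (EuclideanSpace.single i 1) j) / 2

/-- The divergence `∑ ∂u_i/∂x_i`. -/
def dvg {d : ℕ} (A : Grad d) : ℝ := ∑ i, A (EuclideanSpace.single i 1) i

/-- Lamé coefficients `lam = λ > 0`, `mu = μ > 0` on `D`: measurable and bounded, with `μ` bounded
away from zero. -/
structure Lame {d : ℕ} (D : Set (Vec d)) where
  lam : Vec d → ℝ
  mu : Vec d → ℝ
  lam_meas : AEMeasurable lam (volume.restrict D)
  mu_meas : AEMeasurable mu (volume.restrict D)
  lam_pos : ∀ᵐ x ∂volume.restrict D, 0 < lam x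
  mu_lower : ∃ c : ℝ, 0 < c ∧ ∀ᵐ x ∂volume.restrict D, c ≤ mu x
  upper : ∃ b : ℝ, ∀ᵐ x ∂volume.restrict D, lam x ≤ b ∧ mu x ≤ b

/-- The elastic energy form `∫_G 2μ ε(u) : ε(v) + λ (∇·u) (∇·v)`, in terms of the gradients. -/
def Lame.energy {d : ℕ} {D : Set (Vec d)} (c : Lame D) (G : Set (Vec d))
    (gu gv : Vec d → Grad d) : ℝ :=
  ∫ x in G, (2 * c.mu x * ∑ i, ∑ j, strain (gu x) i j * strain (gv x) i j
    + c.lam x * (dvg (gu x) * dvg (gv x)))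

/-- A conforming partition of `D` into convex polytopes. `block i` is the closed `i`-th coarse
block, `vertex` enumerates the vertices of all the blocks. -/
structure CoarseGrid {d : ℕ} (D : Set (Vec d)) where
  /-- number of coarse blocks -/
  N : ℕ
  /-- number of vertices -/
  Nc : ℕ
  block : Fin N → Set (Vec d)
  vertex : Fin Nc → Vec d
  polytope : ∀ i, ∃ s : Finset (Vec d), block i = convexHull ℝ (s : Set (Vec d))
  interior_nonempty : ∀ i, (interior (block i)).Nonempty
  interior_subset : ∀ i, interior (block i) ⊆ D
  cover : ⋃ i, block i = closure D
  interior_disjoint : ∀ i k, i ≠ k → Disjoint (interior (block i)) (interior (block k))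
  /-- two closed blocks meet in a (possibly empty) common face -/
  conforming : ∀ i k, i ≠ k → IsExposed ℝ (block i) (block i ∩ block k)
  vertex_injective : Function.Injective vertex
  vertex_range : range vertex = ⋃ i, (block i).extremePoints ℝ

namespace CoarseGrid

variable {d : ℕ} {D : Set (Vec d)} (T : CoarseGrid D)

/-- The open coarse block `K_i`. -/
def K (i : Fin T.N) : Set (Vec d) := interior (T.block i)

/-- Quasi-uniformity with mesh size `H` and regularity constant `ρ`: every block has diameter at
most `H` and contains a ball of radius `ρ H`. -/
def QuasiUniform (H ρ : ℝ) : Prop :=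
  ∀ i, Metric.diam (T.block i) ≤ H ∧ ∃ y, Metric.closedBall y (ρ * H) ⊆ T.block i

/-- Every block has at most `nv` vertices of the grid. -/
def VertexBound (nv : ℕ) : Prop :=
  ∀ i, {j | T.vertex j ∈ T.block i}.ncard ≤ nv

/-- The blocks that form `K_i` extended by `m` layers: one more layer adds all the blocks that
touch the region. -/
def layer (i : Fin T.N) : ℕ → Set (Fin T.N)
  | 0 => {i}
  | m + 1 => {k | ∃ l ∈ layer i m, (T.block l ∩ T.block k).Nonempty}

/-- The (open) oversampled region `K_{i,m}`. -/
def oversampled (i : Fin T.N) (m : ℕ) : Set (Vec d) :=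
  interior (⋃ k ∈ T.layer i m, T.block k) ∩ D

end CoarseGrid

/-- A Lipschitz partition of unity on the coarse grid: `χ_j` is attached to the `j`-th vertex and
vanishes on all the blocks that do not contain that vertex. -/
structure GridPartition {d : ℕ} {D : Set (Vec d)} (T : CoarseGrid D) where
  χ : Fin T.Nc → Vec d → ℝ
  lipschitz : ∀ j, ∃ L : ℝ≥0, LipschitzWith L (χ j)
  nonneg : ∀ j, ∀ x ∈ D, 0 ≤ χ j x
  sum_eq_one : ∀ x ∈ D, ∑ j, χ j x = 1
  support : ∀ j i, T.vertex j ∉ T.block i → ∀ x ∈ T.block i, χ j x = 0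

/-- The weight `κ̃ = (λ + 2μ) ∑_j |∇χ_j|²`. -/
def weight {d : ℕ} {D : Set (Vec d)} {T : CoarseGrid D} (c : Lame D) (P : GridPartition T)
    (x : Vec d) : ℝ :=
  (c.lam x + 2 * c.mu x) * ∑ j, ‖fderiv ℝ (P.χ j) x‖ ^ 2

/-- The weighted form `∫_G κ u · v`. -/
def massForm {d : ℕ} (κ : Vec d → ℝ) (G : Set (Vec d)) (u v : Vec d → Vec d) : ℝ :=
  ∫ x in G, κ x * inner ℝ (u x) (v x)

/-- `(μ, w)` is an eigenpair of the local problem `a_i(w, v) = μ s_i(w, v)` for all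
`v ∈ V(K_i)`. -/
def IsEigenpair {d : ℕ} {D : Set (Vec d)} {T : CoarseGrid D} (c : Lame D) (P : GridPartition T)
    (i : Fin T.N) (μ : ℝ) (w : Pair (volume.restrict (T.K i))) : Prop :=
  w ∈ localSpace D (T.K i) ∧ w ≠ 0 ∧ ∀ v ∈ localSpace D (T.K i),
    c.energy (T.K i) w.2 v.2 = μ * massForm (weight c P) (T.K i) w.1 v.1

/-- The selected eigenfunctions: for every block `K_i`, `J i` eigenpairs, orthonormal for `s_i`,
that belong to the `J i` smallest eigenvalues (counted with multiplicity): no eigenfunction that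
is orthogonal to the selected ones has a smaller eigenvalue than a selected one. -/
structure AuxBasis {d : ℕ} {D : Set (Vec d)} {T : CoarseGrid D} (c : Lame D)
    (P : GridPartition T) where
  J : Fin T.N → ℕ
  eig : (i : Fin T.N) → Fin (J i) → ℝ
  φ : (i : Fin T.N) → Fin (J i) → Pair (volume.restrict (T.K i))
  eigenpair : ∀ i j, IsEigenpair c P i (eig i j) (φ i j)
  orthonormal : ∀ i j k,
    massForm (weight c P) (T.K i) (φ i j).1 (φ i k).1 = if j = k then 1 else 0
  smallest : ∀ i j (μ : ℝ) (w : Pair (volume.restrict (T.K i))), IsEigenpair c P i μ w →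
    (∀ k, massForm (weight c P) (T.K i) w.1 (φ i k).1 = 0) → eig i j ≤ μ

namespace AuxBasis

variable {d : ℕ} {D : Set (Vec d)} {T : CoarseGrid D} {c : Lame D} {P : GridPartition T}
  (A : AuxBasis c P)

/-- The discarded eigenvalues, over all the coarse blocks. -/
def discarded : Set ℝ :=
  {μ | ∃ i, ∃ w : Pair (volume.restrict (T.K i)), IsEigenpair c P i μ w ∧
    ∀ k, massForm (weight c P) (T.K i) w.1 (A.φ i k).1 = 0}

/-- `ψ` is `φ_j^i`-orthogonal. As `φ_l^k` lives on `K_k`, `s(ψ, φ_l^k)` is an integral over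
`K_k`. -/
def PhiOrthogonal (i : Fin T.N) (j : Fin (A.J i)) (ψ : Pair (volume : Measure (Vec d))) : Prop :=
  massForm (weight c P) (T.K i) ψ.1 (A.φ i j).1 = 1 ∧
  ∀ (k : Fin T.N) (l : Fin (A.J k)), (⟨k, l⟩ : Σ k, Fin (A.J k)) ≠ ⟨i, j⟩ →
    massForm (weight c P) (T.K k) ψ.1 (A.φ k l).1 = 0

/-- `ψ` minimizes the energy `a(ψ, ψ)` among the `φ_j^i`-orthogonal elements of `W`. -/
def IsConstrainedMin (W : Submodule ℝ (Pair (volume : Measure (Vec d)))) (i : Fin T.N)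
    (j : Fin (A.J i)) (ψ : Pair (volume : Measure (Vec d))) : Prop :=
  ψ ∈ W ∧ A.PhiOrthogonal i j ψ ∧
    ∀ ψ' ∈ W, A.PhiOrthogonal i j ψ' → c.energy D ψ.2 ψ.2 ≤ c.energy D ψ'.2 ψ'.2

/-- The local stability constant `D_*` of the constraints: the least `δ ≥ 0` such that every
`q = ∑ b_j φ_j^i` in a local auxiliary space is the projection of a field `v ∈ H¹₀(K_i)` with
`‖v‖_a² ≤ δ ‖q‖_s² = δ ∑ b_j²`. -/
def stabConst : ℝ :=
  sInf {δ : ℝ | 0 ≤ δ ∧ ∀ (i : Fin T.N) (b : Fin (A.J i) → ℝ), ∃ v ∈ H10 (T.K i),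
    (∀ j, massForm (weight c P) (T.K i) v.1 (A.φ i j).1 = b j) ∧
    c.energy D v.2 v.2 ≤ δ * ∑ j, b j ^ 2}

end AuxBasis

/-- `u` is the Galerkin solution in `W`: `u ∈ W` and `a(u, v) = (f, v)` for all `v ∈ W`. -/
def IsGalerkin {d : ℕ} {D : Set (Vec d)} (c : Lame D) (f : Vec d → Vec d)
    (W : Submodule ℝ (Pair (volume : Measure (Vec d))))
    (u : Pair (volume : Measure (Vec d))) : Prop :=
  u ∈ W ∧ ∀ v ∈ W, c.energy D u.2 v.2 = ∫ x in D, inner ℝ (f x) (v.1 x)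

/-- The energy norm `‖u‖_a`. -/
def normA {d : ℕ} {D : Set (Vec d)} (c : Lame D) (u : Pair (volume : Measure (Vec d))) : ℝ :=
  Real.sqrt (c.energy D u.2 u.2)

/-- The weighted norm `‖u‖_s`. -/
def normS {d : ℕ} {D : Set (Vec d)} {T : CoarseGrid D} (c : Lame D) (P : GridPartition T)
    (u : Pair (volume : Measure (Vec d))) : ℝ :=
  Real.sqrt (massForm (weight c P) D u.1 u.1)

/-- The localization constant `E`, with `Λ` the least discarded eigenvalue, `m` the number of
oversampling layers and `S` the stability constant. -/
def decayE (Λ S : ℝ) (m : ℕ) : ℝ :=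
  S ^ 3 * (1 + Λ⁻¹) ^ 2 * (1 + Real.sqrt Λ / (2 * Real.sqrt S)) ^ (1 - (m : ℝ))

end CEM

end

/-! ## Localization of constrained minimizers, for abstract block systems -/

noncomputable section

namespace CEM

section Forms

variable {X : Type*} [AddCommGroup X] [Module ℝ X]

/-! The error is split by Galerkin orthogonality. `uoff` is at least as good as the element `w` of
the localized space that has the same constraint values s(·, φ) as `uglo`, so it suffices to bound u
- `uglo` and `uglo` - w in the energy norm.

Global part. Call a field free if all its constraints vanish. The global minimizers are energy
orthogonal to all free fields, so V is the energy-orthogonal sum of the global multiscale space and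
the free fields, and the error u - `uglo` behaves like a free field. The spectral gap
(`AuxBasis.gap`) bounds Λ‖v‖_s² by ‖v‖_a² for free v, and the load is paired with the error in the
dual weighted norms (`AuxBasis.normA_sub_glo_le`).

Localization part. A minimizer ψ is tested with ψ minus a cutoff of ψ. The cutoff function is a sum
of the χ_j over the vertices of a layer; its gradient costs at most n_v κ̃
(`GridPartition.q_fderiv_cutoff_le`). The cutoff destroys the constraints on one ring of blocks, and
local lifts repair them at the cost D_*. With γ = 2(S/Λ)^(1/2), the energy outside layer n + 1 is at
most γ times the energy in the ring just passed, so each layer gains the factor 1 + 1/γ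
(`BlockSystem.energy_outside_layer_le`). Comparing ψ with its own cutoff gives the error of one
block (`BlockSystem.energy_sub_localized_le`). To add up the blocks without paying for their number,
the total error is itself cut off around each patch (`BlockSystem.energy_sum_le`); a volume
comparison of disjoint balls bounds the overlap of the patches by a multiple of (m+1)^d
(`CoarseGrid.card_layer_le`).

The gap needs compactness: Λ is a lower bound for genuine discarded eigenvalues only, so the
Rayleigh quotient on the complement of the selected modes must attain its minimum. This uses
Rellich's theorem and Korn's second inequality on convex polytopes. Korn is proved on the whole
space by integration by parts, carried to orthants by reflection, to corners of simplices by linear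
charts, and to polytopes by a finite cover of almost every point. The constants of Korn and Rellich
do not enter the final estimate. -/

/-- Cauchy–Schwarz for a positive semidefinite symmetric form. -/
theorem form_le_sqrt_mul_sqrt (B : LinearMap.BilinForm ℝ X) (hs : ∀ u v, B u v = B v u)
    (hp : ∀ v, 0 ≤ B v v) (u v : X) :
    |B u v| ≤ Real.sqrt (B u u) * Real.sqrt (B v v) := by
  rw [← Real.sqrt_mul (hp u)]
  apply Real.abs_le_sqrt
  have := LinearMap.BilinForm.apply_mul_apply_le_of_forall_zero_le B hp u v
  rw [hs v u] at this
  nlinarith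

theorem sqrt_form_add_le (B : LinearMap.BilinForm ℝ X) (hs : ∀ u v, B u v = B v u)
    (hp : ∀ v, 0 ≤ B v v) (u v : X) :
    Real.sqrt (B (u + v) (u + v)) ≤ Real.sqrt (B u u) + Real.sqrt (B v v) := by
  apply Real.sqrt_le_iff.2 ⟨by positivity, ?_⟩
  have h := (abs_le.1 (form_le_sqrt_mul_sqrt B hs hp u v)).2
  have h1 := Real.sq_sqrt (hp u)
  have h2 := Real.sq_sqrt (hp v)
  simp only [map_add, LinearMap.add_apply]
  rw [hs v u]
  nlinarith

theorem sqrt_form_sub_le (B : LinearMap.BilinForm ℝ X) (hs : ∀ u v, B u v = B v u)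
    (hp : ∀ v, 0 ≤ B v v) (u v : X) :
    Real.sqrt (B (u - v) (u - v)) ≤ Real.sqrt (B u u) + Real.sqrt (B v v) := by
  have h := sqrt_form_add_le B hs hp u (-v)
  simpa [sub_eq_add_neg] using h

/-- A form that vanishes from `v` on does not see `v`. -/
theorem form_sub_self_of_eq (B : LinearMap.BilinForm ℝ X) (hs : ∀ u v, B u v = B v u) {v w : X}
    (h : ∀ u, B w u = 0) : B (v - w) (v - w) = B v v := by
  simp [map_sub, h, hs v w]

/-- A minimizer over an affine subspace is orthogonal to its directions. -/
theorem form_eq_zero_of_min (B : LinearMap.BilinForm ℝ X) (hs : ∀ u v, B u v = B v u)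
    {u v : X} (h : ∀ t : ℝ, B u u ≤ B (u + t • v) (u + t • v)) : B u v = 0 := by
  have h1 : ∀ t : ℝ, 0 ≤ B v v * (t * t) + (2 * B u v) * t + 0 := by
    intro t
    have := h t
    simp only [map_add, LinearMap.add_apply, map_smul, LinearMap.smul_apply, smul_eq_mul,
      hs v u] at this
    linarith
  -- The quadratic in t has no constant term, so a nonpositive discriminant means (B u v)² ≤ 0.
  have := discrim_le_zero h1
  simp only [discrim] at this
  nlinarith [sq_nonneg (B u v)]

end Forms

/-- Energy forms on the blocks of a grid, together with the local constraint functionals. -/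
structure BlockSystem (X ι : Type*) [AddCommGroup X] [Module ℝ X] where
  a : ι → LinearMap.BilinForm ℝ X
  symm : ∀ k u v, a k u v = a k v u
  pos : ∀ k v, 0 ≤ a k v v
  J : ι → ℕ
  ℓ : (k : ι) → Fin (J k) → X →ₗ[ℝ] ℝ
  V : Submodule ℝ X

namespace BlockSystem

variable {X ι : Type*} [AddCommGroup X] [Module ℝ X] (Q : BlockSystem X ι)

/-- All the constraints vanish. -/
def Free (v : X) : Prop := ∀ k j, Q.ℓ k j v = 0

/-- The constraints of `v` are `b` on the block `i` and zero on the other blocks. -/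
def ConstrainedAt (i : ι) (b : Fin (Q.J i) → ℝ) (v : X) : Prop :=
  (∀ j, Q.ℓ i j v = b j) ∧ ∀ k, k ≠ i → ∀ j, Q.ℓ k j v = 0

/-- Fields can be cut off between the block sets `B` and `B'` without changing the constraints. -/
def HasCutoff (γ : ℝ) (B B' : Set ι) (W : Submodule ℝ X) : Prop :=
  ∀ v ∈ Q.V, (∀ k, k ∉ B → ∀ j, Q.ℓ k j v = 0) → ∃ w ∈ W,
    (∀ k j, Q.ℓ k j w = Q.ℓ k j v) ∧ (∀ k ∈ B, ∀ u, Q.a k w u = Q.a k v u) ∧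
    (∀ k, k ∉ B' → ∀ u, Q.a k w u = 0) ∧
    -- Of the three bounds on the ring, the first serves the summation over patches, the second the
    -- comparison of ψ with its cutoff, the third the decay. Only the third is linear in γ, and it
    -- fixes the rate.
    ∀ k ∈ B' \ B, Q.a k w w ≤ (1 + γ) ^ 2 * Q.a k v v ∧
      Q.a k (v - w) (v - w) ≤ (1 + γ) ^ 2 * Q.a k v v ∧ -γ * Q.a k v v ≤ Q.a k v (v - w)

variable {Q}

theorem ConstrainedAt.sub_free {i : ι} {b : Fin (Q.J i) → ℝ} {u v : X}
    (hu : Q.ConstrainedAt i b u) (hv : Q.ConstrainedAt i b v) : Q.Free (u - v) := by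
  intro k j
  rw [map_sub]
  by_cases hk : k = i
  · subst hk
    rw [hu.1, hv.1, sub_self]
  · rw [hu.2 k hk, hv.2 k hk, sub_self]

/-- Cutoff functions and local lifts of the constraints combine to cutoffs that respect the
constraints. Here `s k v` plays the role of the squared weighted `L²` norm on the block `k`. -/
theorem hasCutoff_of_cutoff_of_lift {S Λ : ℝ} (hΛ : 0 < Λ) (hS : 0 ≤ S) {B B' : Set ι}
    {W : Submodule ℝ X} (s : ι → X → ℝ)
    (hgap : ∀ v ∈ Q.V, ∀ k, (∀ j, Q.ℓ k j v = 0) → Λ * s k v ≤ Q.a k v v)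
    (hbessel : ∀ k v, ∑ j, Q.ℓ k j v ^ 2 ≤ s k v)
    (hlift : ∀ b : (k : ι) → Fin (Q.J k) → ℝ, ∃ v ∈ W,
      (∀ k ∈ B' \ B, (∀ j, Q.ℓ k j v = b k j) ∧ Q.a k v v ≤ S * ∑ j, b k j ^ 2) ∧
      ∀ k, k ∉ B' \ B → (∀ j, Q.ℓ k j v = 0) ∧ ∀ u, Q.a k v u = 0)
    (hcut : ∀ v ∈ Q.V, ∃ w ∈ W,
      (∀ k ∈ B, (∀ u, Q.a k w u = Q.a k v u) ∧ ∀ j, Q.ℓ k j w = Q.ℓ k j v) ∧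
      (∀ k, k ∉ B' → (∀ u, Q.a k w u = 0) ∧ ∀ j, Q.ℓ k j w = 0) ∧
      ∀ k, Real.sqrt (Q.a k w w) ≤ Real.sqrt (Q.a k v v) + Real.sqrt S * Real.sqrt (s k v) ∧
        Real.sqrt (Q.a k (v - w) (v - w)) ≤
          Real.sqrt (Q.a k v v) + Real.sqrt S * Real.sqrt (s k v) ∧
        s k w ≤ s k v ∧
        -(Real.sqrt S * (Real.sqrt (Q.a k v v) * Real.sqrt (s k v))) ≤ Q.a k v (v - w)) :
    Q.HasCutoff (2 * Real.sqrt S / Real.sqrt Λ) B B' W := by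
  intro v hv hvB
  obtain ⟨w, hw, hwB, hwB', hwk⟩ := hcut v hv
  -- On the ring the constraints of v vanish but those of the cut field w need not; r carries
  -- exactly these values and is subtracted.
  obtain ⟨r, hr, hrT, hrT'⟩ := hlift fun k j => Q.ℓ k j w
  refine ⟨w - r, W.sub_mem hw hr, ?_, ?_, ?_, ?_⟩
  · intro k j
    rw [map_sub]
    by_cases hk : k ∈ B
    · rw [(hwB k hk).2, (hrT' k fun h => h.2 hk).1, sub_zero]
    · rw [hvB k hk]
      by_cases hk' : k ∈ B'
      · rw [(hrT k ⟨hk', hk⟩).1, sub_self]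
      · rw [(hwB' k hk').2, (hrT' k fun h => hk' h.1).1, sub_zero]
  · intro k hk u
    rw [map_sub, LinearMap.sub_apply, (hwB k hk).1, (hrT' k fun h => h.2 hk).2, sub_zero]
  · intro k hk u
    rw [map_sub, LinearMap.sub_apply, (hwB' k hk).1, (hrT' k fun h => hk h.1).2, sub_zero]
  · intro k hk
    obtain ⟨h1, h2, h3, h4⟩ := hwk k
    have hav := Q.pos k v
    set A := Real.sqrt (Q.a k v v) with hA
    have hAA : A ^ 2 = Q.a k v v := Real.sq_sqrt hav
    -- The block lies outside B, so the constraints of v vanish there and the gap trades mass for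
    -- energy.
    have hs : Real.sqrt S * Real.sqrt (s k v) ≤ Real.sqrt S / Real.sqrt Λ * A := by
      have : s k v ≤ Q.a k v v / Λ := by
        rw [le_div_iff₀ hΛ, mul_comm]
        exact hgap v hv k (hvB k hk.2)
      have := Real.sqrt_le_sqrt this
      rw [Real.sqrt_div' _ hΛ.le] at this
      calc Real.sqrt S * Real.sqrt (s k v) ≤ Real.sqrt S * (A / Real.sqrt Λ) :=
            mul_le_mul_of_nonneg_left this (Real.sqrt_nonneg _)
        _ = _ := by ring
    -- By Bessel the lift is paid by s(w) ≤ s(v), hence it costs as much as the cutoff function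
    -- itself; this doubling is the 2 in γ = 2√S/√Λ.
    have hrn : Real.sqrt (Q.a k r r) ≤ Real.sqrt S / Real.sqrt Λ * A := by
      refine le_trans ?_ hs
      rw [← Real.sqrt_mul hS]
      exact Real.sqrt_le_sqrt ((hrT k hk).2.trans
        (mul_le_mul_of_nonneg_left ((hbessel k w).trans h3) hS))
    have hA0 : 0 ≤ A := Real.sqrt_nonneg _
    set g := Real.sqrt S / Real.sqrt Λ with hg
    have hg2 : 2 * Real.sqrt S / Real.sqrt Λ = 2 * g := by rw [hg]; ring
    have hg0 : 0 ≤ g := by positivity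
    rw [hg2, ← hAA, ← mul_pow]
    refine ⟨?_, ?_, ?_⟩
    · rw [← Real.sqrt_le_left (by positivity)]
      have := sqrt_form_sub_le (Q.a k) (Q.symm k) (Q.pos k) w r
      linarith
    · rw [← Real.sqrt_le_left (by positivity)]
      have := sqrt_form_add_le (Q.a k) (Q.symm k) (Q.pos k) (v - w) r
      rw [show v - (w - r) = v - w + r by abel]
      linarith
    · rw [show v - (w - r) = v - w + r by abel, map_add]
      have := (abs_le.1 (form_le_sqrt_mul_sqrt (Q.a k) (Q.symm k) (Q.pos k) v r)).1
      have h5 : A * Real.sqrt (Q.a k r r) ≤ A * (g * A) := mul_le_mul_of_nonneg_left hrn hA0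
      have h6 : A * (Real.sqrt S * Real.sqrt (s k v)) ≤ A * (g * A) :=
        mul_le_mul_of_nonneg_left hs hA0
      nlinarith

/-! ### Exponential decay and summation of the localization errors -/

variable [Fintype ι] (Q)

/-- The energy form on all the blocks. -/
def total : LinearMap.BilinForm ℝ X := ∑ k, Q.a k

theorem total_apply (u v : X) : Q.total u v = ∑ k, Q.a k u v := by
  simp [total, LinearMap.sum_apply]

theorem total_symm (u v : X) : Q.total u v = Q.total v u := by
  simp only [total_apply, Q.symm _ u v]

theorem total_pos (v : X) : 0 ≤ Q.total v v := by
  rw [total_apply]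
  exact Finset.sum_nonneg fun k _ => Q.pos k v

variable {Q}

/-- One layer of blocks takes a fixed portion of the energy. -/
theorem energy_outside_le {γ : ℝ} {B B' : Set ι} (hBB : B ⊆ B')
    {W : Submodule ℝ X} (hWV : W ≤ Q.V) (hcut : Q.HasCutoff γ B B' W) {ψ : X} (hψV : ψ ∈ Q.V)
    (hψB : ∀ k, k ∉ B → ∀ j, Q.ℓ k j ψ = 0)
    (horth : ∀ v ∈ Q.V, Q.Free v → Q.total ψ v = 0) :
    ∑ k, B'ᶜ.indicator (fun k => Q.a k ψ ψ) k ≤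
      γ * (∑ k, Bᶜ.indicator (fun k => Q.a k ψ ψ) k -
        ∑ k, B'ᶜ.indicator (fun k => Q.a k ψ ψ) k) := by
  obtain ⟨w, hw, hwl, hwB, hwB', hwT⟩ := hcut ψ hψV hψB
  -- The difference ψ - w is free because the cutoff keeps all constraints.
  have h0 : Q.total ψ (ψ - w) = 0 := by
    refine horth _ (Q.V.sub_mem hψV (hWV hw)) fun k j => ?_
    rw [map_sub, hwl, sub_self]
  rw [total_apply] at h0
  -- The identity a(ψ, ψ - w) = 0 is read block by block: nothing from B, the full energy outside
  -- B', and at least -γ times the energy on the ring.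
  rw [← sub_nonpos, ← Finset.sum_sub_distrib, Finset.mul_sum, ← Finset.sum_sub_distrib, ← h0]
  apply Finset.sum_le_sum
  intro k _
  by_cases hk : k ∈ B
  · have hk' : k ∈ B' := hBB hk
    simp [hk, hk', map_sub, Q.symm k ψ w, hwB k hk]
  · by_cases hk' : k ∈ B'
    · have := (hwT k ⟨hk', hk⟩).2.2
      simpa [hk, hk'] using this
    · simp [hk, hk', map_sub, Q.symm k ψ w, hwB' k hk']

/-- Exponential decay of the energy of a constrained minimizer away from its block. -/
theorem energy_outside_layer_le {γ : ℝ} (hγ : 0 < γ) {layer : ℕ → Set ι} (hmono : Monotone layer)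
    {W : ℕ → Submodule ℝ X} (hWV : ∀ n, W n ≤ Q.V)
    (hcut : ∀ n, Q.HasCutoff γ (layer n) (layer (n + 1)) (W (n + 1))) {ψ : X} (hψV : ψ ∈ Q.V)
    (hψB : ∀ k, k ∉ layer 0 → ∀ j, Q.ℓ k j ψ = 0)
    (horth : ∀ v ∈ Q.V, Q.Free v → Q.total ψ v = 0) (n : ℕ) :
    ∑ k, (layer n)ᶜ.indicator (fun k => Q.a k ψ ψ) k ≤
      ((1 + γ⁻¹) ^ n)⁻¹ * Q.total ψ ψ := by
  induction n with
  | zero =>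
    rw [total_apply]
    simp only [pow_zero, inv_one, one_mul]
    exact Finset.sum_le_sum fun k _ => indicator_le_self' (fun _ _ => Q.pos k ψ) k
  | succ n ih =>
    have h := energy_outside_le (hmono (Nat.le_succ n)) (hWV _) (hcut n) hψV
      (fun k hk => hψB k fun h => hk (hmono (Nat.zero_le n) h)) horth
    set F := ∑ k, (layer n)ᶜ.indicator (fun k => Q.a k ψ ψ) k
    set F' := ∑ k, (layer (n + 1))ᶜ.indicator (fun k => Q.a k ψ ψ) k
    have h1 : (1 + γ⁻¹) * F' ≤ F := by
      have : γ⁻¹ * F' ≤ F - F' := by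
        rw [inv_mul_le_iff₀ hγ]
        exact h
      linarith
    have hq : 0 < 1 + γ⁻¹ := by positivity
    rw [pow_succ, mul_inv, mul_right_comm, ← div_eq_mul_inv, le_div_iff₀ hq]
    linarith

/-- Comparison of a global constrained minimizer with a localized one. -/
theorem energy_sub_localized_le {γ S : ℝ} (hγ : 0 < γ) {layer : ℕ → Set ι}
    (hmono : Monotone layer) {i : ι} (hi : i ∈ layer 0)
    {W : ℕ → Submodule ℝ X} (hWV : ∀ n, W n ≤ Q.V)
    (hWmono : Monotone W)
    (hcut : ∀ n, Q.HasCutoff γ (layer n) (layer (n + 1)) (W (n + 1)))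
    {b : Fin (Q.J i) → ℝ}
    (hlift : ∃ v ∈ W 0, Q.ConstrainedAt i b v ∧ Q.total v v ≤ S * ∑ j, b j ^ 2)
    {m : ℕ} {ψ ψms : X} (hψV : ψ ∈ Q.V) (hψb : Q.ConstrainedAt i b ψ)
    (horth : ∀ v ∈ Q.V, Q.Free v → Q.total ψ v = 0)
    (hψW : ψms ∈ W m) (hψmsb : Q.ConstrainedAt i b ψms)
    (hmsorth : ∀ v ∈ W m, Q.Free v → Q.total ψms v = 0) :
    Q.total (ψ - ψms) (ψ - ψms) ≤
      4 * (1 + γ) ^ 2 * S * (1 + γ⁻¹) ^ (1 - (m : ℝ)) * ∑ j, b j ^ 2 := by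
  obtain ⟨v, hv, hvb, hvS⟩ := hlift
  -- The lift v is an admissible competitor, and orthogonality of u to v - u makes its energy at
  -- least that of u.
  have key : ∀ {W' : Submodule ℝ X} {u : X}, v ∈ W' → u ∈ W' → Q.ConstrainedAt i b u →
      (∀ v ∈ W', Q.Free v → Q.total u v = 0) → Q.total u u ≤ S * ∑ j, b j ^ 2 := by
    intro W' u hvW hu hub ho
    have h := ho (v - u) (W'.sub_mem hvW hu) (hvb.sub_free hub)
    have hp := Q.total_pos (v - u)
    simp only [map_sub, LinearMap.sub_apply, Q.total_symm v u] at h hp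
    linarith
  have hψS := key (hWV 0 hv) hψV hψb horth
  have hψmsS := key (hWmono (Nat.zero_le m) hv) hψW hψmsb hmsorth
  have hSb : 0 ≤ S * ∑ j, b j ^ 2 := (Q.total_pos v).trans hvS
  have hq : 0 < 1 + γ⁻¹ := by positivity
  -- For m = 0 there is no layer to cut in. The crude bound a(ψ - ψms) ≤ 4S∑b² suffices, since the
  -- exponent 1 - m is then 1 and only enlarges the right side.
  rcases m with _ | n
  · have h1 := sqrt_form_sub_le Q.total Q.total_symm Q.total_pos ψ ψms
    have h2 : Q.total (ψ - ψms) (ψ - ψms) ≤ 4 * (S * ∑ j, b j ^ 2) := by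
      have hp := Q.total_pos (ψ + ψms)
      simp only [map_sub, map_add, LinearMap.add_apply, LinearMap.sub_apply] at hp ⊢
      linarith
    have h3 : 1 ≤ (1 + γ) ^ 2 * (1 + γ⁻¹) := by
      have : 0 < γ⁻¹ := by positivity
      nlinarith
    have h4 : (1 + γ⁻¹) ^ (1 - ((0 : ℕ) : ℝ)) = 1 + γ⁻¹ := by simp
    rw [h4]
    nlinarith
  -- For m = n + 1 the last layer is spent on the cutoff, which must lie in the localized space; n =
  -- m - 1 layers remain for the decay. This is the source of the exponent 1 - m.
  · obtain ⟨w, hw, hwl, hwB, hwB', hwT⟩ := hcut n ψ hψV fun k hk j =>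
      hψb.2 k (fun h => hk (h ▸ hmono (Nat.zero_le n) hi)) j
    have hfree : Q.Free (w - ψms) := by
      intro k j
      have := hψb.sub_free hψmsb k j
      rw [map_sub] at this ⊢
      rwa [hwl]
    have h1 : Q.total (ψ - ψms) (w - ψms) = 0 := by
      rw [map_sub Q.total, LinearMap.sub_apply,
        horth _ (Q.V.sub_mem (hWV _ hw) (hWV _ hψW)) hfree,
        hmsorth _ ((W (n + 1)).sub_mem hw hψW) hfree, sub_zero]
    -- Céa's argument: ψ - ψms is orthogonal to w - ψms, so w approximates ψ no better than ψms
    -- does.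
    have h2 : Q.total (ψ - ψms) (ψ - ψms) ≤ Q.total (ψ - w) (ψ - w) := by
      have hp := Q.total_pos (w - ψms)
      have e : ψ - w = (ψ - ψms) - (w - ψms) := by abel
      rw [e]
      generalize w - ψms = p at h1 hp ⊢
      generalize ψ - ψms = r at h1 ⊢
      simp only [map_sub, LinearMap.sub_apply, Q.total_symm p r, h1]
      linarith
    have h3 : Q.total (ψ - w) (ψ - w) ≤
        (1 + γ) ^ 2 * ∑ k, (layer n)ᶜ.indicator (fun k => Q.a k ψ ψ) k := by
      rw [total_apply, Finset.mul_sum]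
      refine Finset.sum_le_sum fun k _ => ?_
      by_cases hk : k ∈ layer n
      · simp [hk, map_sub, hwB k hk, Q.symm k ψ w]
      · by_cases hk' : k ∈ layer (n + 1)
        · simpa [hk] using (hwT k ⟨hk', hk⟩).2.1
        · rw [form_sub_self_of_eq (Q.a k) (Q.symm k) (hwB' k hk')]
          simp only [mem_compl_iff, hk, not_false_eq_true, indicator_of_mem]
          exact le_mul_of_one_le_left (Q.pos k ψ) (by nlinarith)
    have h4 := energy_outside_layer_le hγ hmono hWV hcut hψV
      (fun k hk j => hψb.2 k (fun h => hk (h ▸ hi)) j) horth n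
    have h5 : (1 + γ⁻¹) ^ (1 - ((n + 1 : ℕ) : ℝ)) = ((1 + γ⁻¹) ^ n)⁻¹ := by
      rw [← Real.rpow_natCast, ← Real.rpow_neg hq.le]
      congr 1
      push_cast
      ring
    rw [h5]
    calc Q.total (ψ - ψms) (ψ - ψms)
        ≤ (1 + γ) ^ 2 * (((1 + γ⁻¹) ^ n)⁻¹ * (S * ∑ j, b j ^ 2)) := by
          refine (h2.trans h3).trans (mul_le_mul_of_nonneg_left (h4.trans ?_) (sq_nonneg _))
          exact mul_le_mul_of_nonneg_left hψS (by positivity)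
      _ ≤ 4 * ((1 + γ) ^ 2 * (((1 + γ⁻¹) ^ n)⁻¹ * (S * ∑ j, b j ^ 2))) := by
          have : 0 ≤ (1 + γ) ^ 2 * (((1 + γ⁻¹) ^ n)⁻¹ * (S * ∑ j, b j ^ 2)) := by positivity
          linarith
      _ = _ := by ring

open Classical in
/-- Almost orthogonality of localization errors: the energy of their sum is controlled by the
number of overlapping patches. -/
theorem energy_sum_le {γ M : ℝ} (hγ : 0 < γ) {B B' : ι → Set ι}
    {W W' : ι → Submodule ℝ X} (hWV : ∀ i, W i ≤ Q.V) (hWV' : ∀ i, W' i ≤ Q.V)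
    (hcut : ∀ i, Q.HasCutoff γ (B i) (B' i) (W' i))
    (hW : ∀ i, ∀ v ∈ W i, ∀ k, k ∉ B i → ∀ u, Q.a k v u = 0)
    (hM : ∀ k, ((Finset.univ.filter fun i => k ∈ B' i).card : ℝ) ≤ M)
    {ψ ψms : ι → X} (hψV : ∀ i, ψ i ∈ Q.V) (hψW : ∀ i, ψms i ∈ W i)
    (hfree : ∀ i, Q.Free (ψ i - ψms i))
    (horth : ∀ i, ∀ v ∈ Q.V, Q.Free v → Q.total (ψ i) v = 0) :
    Q.total (∑ i, (ψ i - ψms i)) (∑ i, (ψ i - ψms i)) ≤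
      (1 + γ) ^ 2 * M * ∑ i, Q.total (ψ i - ψms i) (ψ i - ψms i) := by
  set z : ι → X := fun i => ψ i - ψms i with hz
  set w := ∑ i, z i with hw
  have hwV : w ∈ Q.V := Q.V.sum_mem fun i _ => Q.V.sub_mem (hψV i) (hWV i (hψW i))
  have hwf : Q.Free w := by
    intro k j
    rw [hw, map_sum]
    exact Finset.sum_eq_zero fun i _ => hfree i k j
  -- The localization error z i sees only the part of w near its patch: w may be replaced by its
  -- cutoff w' around the patch, which costs only the energy of w on B' i.
  have key : ∀ i, Q.total (z i) w ≤ Real.sqrt (Q.total (z i) (z i)) *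
      Real.sqrt ((1 + γ) ^ 2 * ∑ k, if k ∈ B' i then Q.a k w w else 0) := by
    intro i
    obtain ⟨w', hw', hwl, hwB, hwB', hwT⟩ := hcut i w hwV fun k _ => hwf k
    have hff : Q.Free (w - w') := fun k j => by rw [map_sub, hwl, sub_self]
    -- The global field ψ i is orthogonal to the free field w - w', and ψms i lives on B i, where w
    -- and w' agree.
    have h0 : Q.total (z i) (w - w') = 0 := by
      rw [hz, map_sub Q.total, LinearMap.sub_apply,
        horth i _ (Q.V.sub_mem hwV (hWV' i hw')) hff, zero_sub, neg_eq_zero, total_apply]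
      refine Finset.sum_eq_zero fun k _ => ?_
      by_cases hk : k ∈ B i
      · rw [Q.symm, map_sub, LinearMap.sub_apply, hwB k hk, sub_self]
      · exact hW i _ (hψW i) k hk _
    rw [map_sub, sub_eq_zero] at h0
    rw [h0]
    refine (le_abs_self _).trans
      ((form_le_sqrt_mul_sqrt Q.total Q.total_symm Q.total_pos _ _).trans ?_)
    refine mul_le_mul_of_nonneg_left (Real.sqrt_le_sqrt ?_) (Real.sqrt_nonneg _)
    rw [total_apply, Finset.mul_sum]
    refine Finset.sum_le_sum fun k _ => ?_
    by_cases hk' : k ∈ B' i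
    · rw [if_pos hk']
      by_cases hk : k ∈ B i
      · rw [hwB k hk, Q.symm, hwB k hk]
        exact le_mul_of_one_le_left (Q.pos k w) (by nlinarith)
      · exact (hwT k ⟨hk', hk⟩).1
    · simp [hk', hwB' k hk']
  have h1 : Q.total w w = ∑ i, Q.total (z i) w := by
    rw [← LinearMap.sum_apply, ← map_sum]
  -- Cauchy–Schwarz over i, then double counting: each block lies in at most M of the sets B' i.
  have h2 : Q.total w w ≤ Real.sqrt (∑ i, Q.total (z i) (z i)) *
      Real.sqrt ((1 + γ) ^ 2 * (M * Q.total w w)) := by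
    rw [h1]
    refine (Finset.sum_le_sum fun i _ => key i).trans ?_
    refine (Real.sum_sqrt_mul_sqrt_le _ (fun i => Q.total_pos _) fun i => ?_).trans ?_
    · refine mul_nonneg (sq_nonneg _) (Finset.sum_nonneg fun k _ => ?_)
      split_ifs
      exacts [Q.pos k w, le_rfl]
    · refine mul_le_mul_of_nonneg_left (Real.sqrt_le_sqrt ?_) (Real.sqrt_nonneg _)
      rw [← Finset.mul_sum, ← h1, Finset.sum_comm, total_apply, Finset.mul_sum _ _ M]
      refine mul_le_mul_of_nonneg_left (Finset.sum_le_sum fun k _ => ?_) (sq_nonneg _)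
      rw [← Finset.sum_filter, Finset.sum_const, nsmul_eq_mul]
      exact mul_le_mul_of_nonneg_right (hM k) (Q.pos k w)
  have hZ : 0 ≤ ∑ i, Q.total (z i) (z i) := Finset.sum_nonneg fun i _ => Q.total_pos _
  -- One factor of the energy of w is cancelled below, so the degenerate case is treated apart.
  rcases (Q.total_pos w).eq_or_lt with h | h
  · rw [← h]
    rcases isEmpty_or_nonempty ι with he | ⟨⟨k⟩⟩
    · simp
    · have : 0 ≤ M := (Nat.cast_nonneg _).trans (hM k)
      positivity
  · have hM0 : 0 ≤ M := by
      rcases isEmpty_or_nonempty ι with he | ⟨⟨k⟩⟩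
      · rw [total_apply] at h
        simp at h
      · exact (Nat.cast_nonneg _).trans (hM k)
    rw [← Real.sqrt_mul hZ] at h2
    have h3 := (Real.le_sqrt h.le (by positivity)).1 h2
    rw [sq] at h3
    have h4 : Q.total w w * Q.total w w ≤
        ((1 + γ) ^ 2 * M * ∑ i, Q.total (z i) (z i)) * Q.total w w := by linarith
    exact le_of_mul_le_mul_right h4 h

end BlockSystem
end CEM

end

/-! ## Bounded families of forms -/

noncomputable section

namespace CEM

variable {d : ℕ}

/-- A bounded measurable family of positive semidefinite forms on `E`, over the region `G`. -/
structure BddForm (E : Type*) [NormedAddCommGroup E] [NormedSpace ℝ E] (G : Set (Vec d)) where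
  q : Vec d → E → E → ℝ
  add_left : ∀ x A A' B, q x (A + A') B = q x A B + q x A' B
  smul_left : ∀ x (t : ℝ) A B, q x (t • A) B = t * q x A B
  symm : ∀ x A B, q x A B = q x B A
  -- Asking for all smaller measures makes the notion stable under restriction to a subregion.
  meas : ∀ (ν : Measure (Vec d)), ν ≤ volume.restrict G → ∀ u v : Vec d → E,
    AEStronglyMeasurable u ν → AEStronglyMeasurable v ν →
    AEStronglyMeasurable (fun x => q x (u x) (v x)) ν
  bound : ∃ b : ℝ, 0 ≤ b ∧ ∀ᵐ x ∂volume.restrict G, ∀ A B, |q x A B| ≤ b * (‖A‖ * ‖B‖)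
  nonneg : ∀ᵐ x ∂volume.restrict G, ∀ A, 0 ≤ q x A A

namespace BddForm

variable {E : Type*} [NormedAddCommGroup E] [NormedSpace ℝ E] {G : Set (Vec d)}

/-- Restriction to a smaller region. -/
def mono (Q : BddForm E G) {G' : Set (Vec d)} (h : G' ⊆ G) : BddForm E G' where
  q := Q.q
  add_left := Q.add_left
  smul_left := Q.smul_left
  symm := Q.symm
  meas ν hν := Q.meas ν (hν.trans (Measure.restrict_mono h le_rfl))
  bound := Q.bound.imp fun _ hb => ⟨hb.1, ae_mono (Measure.restrict_mono h le_rfl) hb.2⟩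
  nonneg := ae_mono (Measure.restrict_mono h le_rfl) Q.nonneg

theorem add_right (Q : BddForm E G) (x : Vec d) (A B B' : E) :
    Q.q x A (B + B') = Q.q x A B + Q.q x A B' := by
  rw [Q.symm, Q.add_left, Q.symm x B, Q.symm x B']

theorem smul_right (Q : BddForm E G) (x : Vec d) (t : ℝ) (A B : E) :
    Q.q x A (t • B) = t * Q.q x A B := by
  rw [Q.symm, Q.smul_left, Q.symm x B]

theorem integrable (Q : BddForm E G) {u v : Vec d → E} (hu : MemLp u 2 (volume.restrict G))
    (hv : MemLp v 2 (volume.restrict G)) :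
    Integrable (fun x => Q.q x (u x) (v x)) (volume.restrict G) := by
  obtain ⟨b, -, hb⟩ := Q.bound
  have h1 : Integrable (fun x => ‖u x‖ * ‖v x‖) (volume.restrict G) :=
    hu.norm.integrable_mul hv.norm
  refine (h1.const_mul b).mono' (Q.meas _ le_rfl u v hu.1 hv.1) ?_
  filter_upwards [hb] with x hx using hx _ _

variable {ν : Measure (Vec d)}

/-- The integrated form on `L²`. -/
def form (Q : BddForm E G) (hν : volume.restrict G ≤ ν) : LinearMap.BilinForm ℝ (Lp E 2 ν) :=
  have hm : ∀ u : Lp E 2 ν, MemLp u 2 (volume.restrict G) := fun u =>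
    (Lp.memLp u).mono_measure hν
  LinearMap.mk₂ ℝ (fun u v => ∫ x in G, Q.q x (u x) (v x))
    (fun u u' v => by
      rw [← integral_add (Q.integrable (hm u) (hm v)) (Q.integrable (hm u') (hm v))]
      refine integral_congr_ae ?_
      filter_upwards [ae_mono hν (Lp.coeFn_add u u')] with x hx
      rw [hx, Pi.add_apply, Q.add_left])
    (fun t u v => by
      rw [smul_eq_mul, ← integral_const_mul]
      refine integral_congr_ae ?_
      filter_upwards [ae_mono hν (Lp.coeFn_smul t u)] with x hx
      rw [hx, Pi.smul_apply, Q.smul_left])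
    (fun u v v' => by
      rw [← integral_add (Q.integrable (hm u) (hm v)) (Q.integrable (hm u) (hm v'))]
      refine integral_congr_ae ?_
      filter_upwards [ae_mono hν (Lp.coeFn_add v v')] with x hx
      rw [hx, Pi.add_apply, Q.add_right])
    (fun t u v => by
      rw [smul_eq_mul, ← integral_const_mul]
      refine integral_congr_ae ?_
      filter_upwards [ae_mono hν (Lp.coeFn_smul t v)] with x hx
      rw [hx, Pi.smul_apply, Q.smul_right])

theorem form_apply (Q : BddForm E G) (hν : volume.restrict G ≤ ν) (u v : Lp E 2 ν) :
    Q.form hν u v = ∫ x in G, Q.q x (u x) (v x) := rfl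

theorem form_symm (Q : BddForm E G) (hν : volume.restrict G ≤ ν) (u v : Lp E 2 ν) :
    Q.form hν u v = Q.form hν v u := by
  simp only [form_apply, Q.symm]

theorem form_nonneg (Q : BddForm E G) (hν : volume.restrict G ≤ ν) (v : Lp E 2 ν) :
    0 ≤ Q.form hν v v := by
  rw [form_apply]
  refine integral_nonneg_of_ae ?_
  filter_upwards [Q.nonneg] with x hx using hx _

theorem _root_.CEM.integral_sq_norm_le {E : Type*} [NormedAddCommGroup E] {G : Set (Vec d)}
    {ν : Measure (Vec d)} (hν : volume.restrict G ≤ ν) (v : Lp E 2 ν) :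
    ∫ x in G, ‖v x‖ ^ 2 ≤ ‖v‖ ^ 2 := by
  have h := Lp.norm_def v
  have hi : Integrable (fun x => ‖v x‖ ^ 2) ν := (Lp.memLp v).integrable_norm_pow (by norm_num)
  have h2 : ‖v‖ ^ 2 = ∫ x, ‖v x‖ ^ 2 ∂ν := by
    rw [h, eLpNorm_eq_lintegral_rpow_enorm_toReal (by norm_num) (by norm_num)]
    rw [integral_eq_lintegral_of_nonneg_ae (ae_of_all _ fun x => by positivity) hi.1]
    rw [← ENNReal.toReal_pow]
    congr 1
    simp only [ENNReal.toReal_ofNat]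
    rw [← ENNReal.rpow_natCast, ← ENNReal.rpow_mul]
    norm_num
  rw [h2]
  exact integral_mono_measure hν (ae_of_all _ fun x => by positivity) hi

theorem form_self_le (Q : BddForm E G) (hν : volume.restrict G ≤ ν) :
    ∃ b : ℝ, 0 ≤ b ∧ ∀ v : Lp E 2 ν, Q.form hν v v ≤ b * ‖v‖ ^ 2 := by
  obtain ⟨b, hb0, hb⟩ := Q.bound
  refine ⟨b, hb0, fun v => ?_⟩
  have hm : MemLp v 2 (volume.restrict G) := (Lp.memLp v).mono_measure hν
  calc Q.form hν v v ≤ ∫ x in G, b * ‖v x‖ ^ 2 := by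
        rw [form_apply]
        refine integral_mono_ae (Q.integrable hm hm)
          ((hm.integrable_norm_pow (by norm_num)).const_mul _) ?_
        filter_upwards [hb] with x hx
        rw [sq]
        exact (le_abs_self _).trans (hx _ _)
    _ = b * ∫ x in G, ‖v x‖ ^ 2 := integral_const_mul _ _
    _ ≤ b * ‖v‖ ^ 2 := by
        gcongr
        exact integral_sq_norm_le hν v

end BddForm

/-! ### Elastic energy and weighted mass as bounded forms -/

/-- The strain components as continuous linear functionals of the gradient. -/
def strainL (i j : Fin d) : Grad d →L[ℝ] ℝ :=
  LinearMap.toContinuousLinearMap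
    { toFun := fun A => strain A i j
      map_add' := fun A B => by simp [strain]; ring
      map_smul' := fun t A => by simp [strain]; ring }

/-- The divergence as a continuous linear functional of the gradient. -/
def dvgL : Grad d →L[ℝ] ℝ :=
  LinearMap.toContinuousLinearMap
    { toFun := fun A => dvg A
      map_add' := fun A B => by simp [dvg, Finset.sum_add_distrib]
      map_smul' := fun t A => by simp [dvg, Finset.mul_sum] }

theorem abs_strain_le (i j : Fin d) (A : Grad d) : |strain A i j| ≤ ‖A‖ := by
  have h : ∀ i j : Fin d, |A (EuclideanSpace.single j 1) i| ≤ ‖A‖ := fun i j => by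
    refine (PiLp.norm_apply_le (A (EuclideanSpace.single j 1)) i).trans ?_
    simpa using A.le_opNorm (EuclideanSpace.single j 1)
  rw [strain, abs_div, abs_two, div_le_iff₀ two_pos]
  refine (abs_add_le _ _).trans ?_
  linarith [h i j, h j i]

theorem abs_dvg_le (A : Grad d) : |dvg A| ≤ d * ‖A‖ := by
  refine (Finset.abs_sum_le_sum_abs _ _).trans ?_
  have h : ∀ i : Fin d, |A (EuclideanSpace.single i 1) i| ≤ ‖A‖ := fun i => by
    refine (PiLp.norm_apply_le (A (EuclideanSpace.single i 1)) i).trans ?_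
    simpa using A.le_opNorm (EuclideanSpace.single i 1)
  simpa using Finset.sum_le_sum fun i (_ : i ∈ Finset.univ) => h i

theorem strain_add (A B : Grad d) (i j : Fin d) : strain (A + B) i j = strain A i j + strain B i j :=
  map_add (strainL i j) A B

theorem strain_smul (t : ℝ) (A : Grad d) (i j : Fin d) : strain (t • A) i j = t * strain A i j :=
  map_smul (strainL i j) t A

theorem dvg_add (A B : Grad d) : dvg (A + B) = dvg A + dvg B := map_add dvgL A B

theorem dvg_smul (t : ℝ) (A : Grad d) : dvg (t • A) = t * dvg A := map_smul dvgL t A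

variable {D : Set (Vec d)}

/-- The elastic energy density. -/
def Lame.bddForm (c : Lame D) : BddForm (Grad d) D where
  q x A B := 2 * c.mu x * ∑ i, ∑ j, strain A i j * strain B i j + c.lam x * (dvg A * dvg B)
  add_left x A A' B := by
    simp only [strain_add, dvg_add, add_mul, Finset.sum_add_distrib]
    ring
  smul_left x t A B := by
    simp only [strain_smul, dvg_smul, mul_assoc, ← Finset.mul_sum]
    ring
  symm x A B := by simp only [mul_comm]
  meas ν hν u v hu hv := by
    have hm : AEStronglyMeasurable c.mu ν := (c.mu_meas.aestronglyMeasurable).mono_measure hν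
    have hl : AEStronglyMeasurable c.lam ν := (c.lam_meas.aestronglyMeasurable).mono_measure hν
    have h1 : ∀ i j, AEStronglyMeasurable (fun x => strain (u x) i j * strain (v x) i j) ν :=
      fun i j => ((strainL i j).continuous.comp_aestronglyMeasurable hu).mul
        ((strainL i j).continuous.comp_aestronglyMeasurable hv)
    have h2 : AEStronglyMeasurable (fun x => dvg (u x) * dvg (v x)) ν :=
      (dvgL.continuous.comp_aestronglyMeasurable hu).mul
        (dvgL.continuous.comp_aestronglyMeasurable hv)
    exact ((hm.const_mul 2).mul (Finset.aestronglyMeasurable_fun_sum _ fun i _ =>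
      Finset.aestronglyMeasurable_fun_sum _ fun j _ => h1 i j)).add (hl.mul h2)
  bound := by
    obtain ⟨b, hb⟩ := c.upper
    obtain ⟨l, hl, hl'⟩ := c.mu_lower
    refine ⟨|2 * b * (d * d) + b * (d * d)|, abs_nonneg _, ?_⟩
    filter_upwards [hb, hl', c.lam_pos] with x h1 h2 h3 A B
    have hb : 0 ≤ b := h3.le.trans h1.1
    have hs : |∑ i, ∑ j, strain A i j * strain B i j| ≤ d * d * (‖A‖ * ‖B‖) := by
      calc |∑ i, ∑ j, strain A i j * strain B i j|
          ≤ ∑ i : Fin d, ∑ j : Fin d, ‖A‖ * ‖B‖ := by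
            refine (Finset.abs_sum_le_sum_abs _ _).trans (Finset.sum_le_sum fun i _ => ?_)
            refine (Finset.abs_sum_le_sum_abs _ _).trans (Finset.sum_le_sum fun j _ => ?_)
            rw [abs_mul]
            exact mul_le_mul (abs_strain_le i j A) (abs_strain_le i j B) (abs_nonneg _)
              (norm_nonneg _)
        _ = _ := by simp; ring
    have hd : |dvg A * dvg B| ≤ d * d * (‖A‖ * ‖B‖) := by
      rw [abs_mul]
      refine (mul_le_mul (abs_dvg_le A) (abs_dvg_le B) (abs_nonneg _) (by positivity)).trans ?_
      apply le_of_eq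
      ring
    rw [abs_of_nonneg (show 0 ≤ 2 * b * (d * d : ℝ) + b * (d * d) by positivity)]
    refine (abs_add_le _ _).trans ?_
    rw [abs_mul, abs_mul (c.lam x), abs_of_nonneg (by linarith : 0 ≤ 2 * c.mu x),
      abs_of_pos h3, add_mul, mul_assoc (2 * b), mul_assoc b]
    gcongr
    · linarith
    · exact h1.1
  nonneg := by
    obtain ⟨l, hl, hl'⟩ := c.mu_lower
    filter_upwards [hl', c.lam_pos] with x h2 h3 A
    have : 0 ≤ ∑ i, ∑ j, strain A i j * strain A i j :=
      Finset.sum_nonneg fun i _ => Finset.sum_nonneg fun j _ => mul_self_nonneg _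
    have := mul_self_nonneg (dvg A)
    have : 0 ≤ 2 * c.mu x := by linarith
    positivity

theorem Lame.energy_eq (c : Lame D) (G : Set (Vec d)) (gu gv : Vec d → Grad d) :
    c.energy G gu gv = ∫ x in G, c.bddForm.q x (gu x) (gv x) := rfl

variable {T : CoarseGrid D}

theorem norm_fderiv_le (P : GridPartition T) :
    ∃ L : ℝ≥0, ∀ j x, ‖fderiv ℝ (P.χ j) x‖ ≤ L := by
  choose L hL using P.lipschitz
  refine ⟨∑ j, L j, fun j x => (norm_fderiv_le_of_lipschitz ℝ (hL j)).trans ?_⟩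
  exact_mod_cast Finset.single_le_sum (f := L) (fun _ _ => by positivity) (Finset.mem_univ j)

theorem weight_meas (c : Lame D) (P : GridPartition T) :
    AEMeasurable (weight c P) (volume.restrict D) := by
  refine (c.lam_meas.add (c.mu_meas.const_mul 2)).mul (Measurable.aemeasurable ?_)
  exact Finset.measurable_sum _ fun j _ => ((measurable_fderiv ℝ (P.χ j)).norm).pow_const 2

theorem weight_bound (c : Lame D) (P : GridPartition T) :
    ∃ b : ℝ, ∀ᵐ x ∂volume.restrict D, 0 ≤ weight c P x ∧ weight c P x ≤ b := by
  obtain ⟨b, hb⟩ := c.upper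
  obtain ⟨l, hl, hl'⟩ := c.mu_lower
  obtain ⟨L, hL⟩ := norm_fderiv_le P
  refine ⟨(b + 2 * b) * ∑ _j : Fin T.Nc, (L : ℝ) ^ 2, ?_⟩
  filter_upwards [hb, hl', c.lam_pos] with x h1 h2 h3
  have h4 : 0 ≤ ∑ j, ‖fderiv ℝ (P.χ j) x‖ ^ 2 := by positivity
  refine ⟨mul_nonneg (by linarith) h4, mul_le_mul (by linarith) ?_ h4 (by linarith)⟩
  exact Finset.sum_le_sum fun j _ => by
    have := hL j x
    gcongr

/-- The weighted mass density. -/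
def massBddForm (c : Lame D) (P : GridPartition T) : BddForm (Vec d) D where
  q x A B := weight c P x * inner ℝ A B
  add_left x A A' B := by rw [inner_add_left, mul_add]
  smul_left x t A B := by rw [real_inner_smul_left]; ring
  symm x A B := by rw [real_inner_comm]
  meas ν hν u v hu hv := ((weight_meas c P).aestronglyMeasurable.mono_measure hν).mul (hu.inner hv)
  bound := by
    obtain ⟨b, hb⟩ := weight_bound c P
    refine ⟨|b|, abs_nonneg b, ?_⟩
    filter_upwards [hb] with x hx A B
    rw [abs_mul, abs_of_nonneg hx.1]
    exact mul_le_mul (hx.2.trans (le_abs_self b)) (abs_real_inner_le_norm A B) (abs_nonneg _)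
      (abs_nonneg _)
  nonneg := by
    obtain ⟨b, hb⟩ := weight_bound c P
    filter_upwards [hb] with x hx A
    exact mul_nonneg hx.1 real_inner_self_nonneg

theorem massForm_eq (c : Lame D) (P : GridPartition T) (G : Set (Vec d)) (u v : Vec d → Vec d) :
    massForm (weight c P) G u v = ∫ x in G, (massBddForm c P).q x (u x) (v x) := rfl

end CEM

end

/-! ## Mollification -/

noncomputable section

namespace CEM

section Mollify

open Filter Topology

variable {V E : Type*} [NormedAddCommGroup V] [InnerProductSpace ℝ V] [FiniteDimensional ℝ V]
  [MeasurableSpace V] [BorelSpace V] [NormedAddCommGroup E] [NormedSpace ℝ E]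

/-- Bump functions of shrinking support. -/
def shrinkingBump (V : Type*) [NormedAddCommGroup V] [InnerProductSpace ℝ V] (n : ℕ) :
    ContDiffBump (0 : V) where
  rIn := 1 / (2 * ((n : ℝ) + 1))
  rOut := 1 / ((n : ℝ) + 1)
  rIn_pos := by positivity
  rIn_lt_rOut := by
    have : (0 : ℝ) < n + 1 := by positivity
    rw [one_div_lt_one_div] <;> linarith

/-- Regularization by convolution. -/
def mollify (n : ℕ) (g : V → E) (x : V) : E :=
  ∫ y, (shrinkingBump V n).normed volume y • g (x - y)

theorem mollify_eq_convolution (n : ℕ) (g : V → E) :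
    mollify n g = MeasureTheory.convolution ((shrinkingBump V n).normed volume) g
      (ContinuousLinearMap.lsmul ℝ ℝ) volume := by
  ext x
  rw [convolution_def]
  rfl

theorem contDiff_mollify (n : ℕ) {g : V → E} (hg : Continuous g) : ContDiff ℝ ∞ (mollify n g) := by
  rw [mollify_eq_convolution]
  exact (shrinkingBump V n).hasCompactSupport_normed.contDiff_convolution_left _
    (shrinkingBump V n).contDiff_normed hg.locallyIntegrable

theorem integrable_mollify (n : ℕ) {g : V → E} (hg : Continuous g) (x : V) :
    Integrable (fun y => (shrinkingBump V n).normed volume y • g (x - y)) := by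
  apply Continuous.integrable_of_hasCompactSupport
  · exact (shrinkingBump V n).continuous_normed.smul (by fun_prop)
  · exact (shrinkingBump V n).hasCompactSupport_normed.smul_right

/-- A mollification averages translates of g with total weight one. -/
theorem lipschitzWith_mollify (n : ℕ) {g : V → E} {L : ℝ≥0} (hg : LipschitzWith L g) :
    LipschitzWith L (mollify n g) := by
  apply LipschitzWith.of_dist_le_mul
  intro x x'
  rw [dist_eq_norm, mollify, mollify, ← integral_sub (integrable_mollify n hg.continuous x)
    (integrable_mollify n hg.continuous x')]
  calc _ ≤ ∫ y, (shrinkingBump V n).normed volume y * (L * dist x x') := by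
        refine norm_integral_le_of_norm_le
          ((shrinkingBump V n).integrable_normed.mul_const _) (ae_of_all _ fun y => ?_)
        rw [← smul_sub, norm_smul, Real.norm_of_nonneg ((shrinkingBump V n).nonneg_normed y),
          ← dist_eq_norm]
        refine mul_le_mul_of_nonneg_left ?_ ((shrinkingBump V n).nonneg_normed y)
        simpa using hg.dist_le_mul (x - y) (x' - y)
    _ = L * dist x x' := by
        rw [integral_mul_const, (shrinkingBump V n).integral_normed, one_mul]

theorem norm_mollify_le (n : ℕ) {g : V → E} {b : ℝ} (hb : ∀ x, ‖g x‖ ≤ b)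
    (x : V) : ‖mollify n g x‖ ≤ b := by
  calc _ ≤ ∫ y, (shrinkingBump V n).normed volume y * b := by
        refine norm_integral_le_of_norm_le
          ((shrinkingBump V n).integrable_normed.mul_const _) (ae_of_all _ fun y => ?_)
        rw [norm_smul, Real.norm_of_nonneg ((shrinkingBump V n).nonneg_normed y)]
        exact mul_le_mul_of_nonneg_left (hb _) ((shrinkingBump V n).nonneg_normed y)
    _ = b := by
        rw [integral_mul_const, (shrinkingBump V n).integral_normed, one_mul]

theorem support_mollify_subset (n : ℕ) (g : V → E) :
    Function.support (mollify n g) ⊆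
      Metric.cthickening (1 / ((n : ℝ) + 1)) (Function.support g) := by
  rw [mollify_eq_convolution]
  refine (support_convolution_subset _).trans ?_
  rintro _ ⟨a, ha, b, hb, rfl⟩
  rw [ContDiffBump.support_normed_eq, mem_ball_zero_iff] at ha
  refine Metric.mem_cthickening_of_dist_le _ b _ _ hb ?_
  rw [dist_eq_norm, add_sub_cancel_right]
  exact ha.le

theorem tendsto_shrinkingBump_rOut (V : Type*) [NormedAddCommGroup V] [InnerProductSpace ℝ V] :
    Tendsto (fun n => (shrinkingBump V n).rOut) atTop (𝓝 0) :=
  tendsto_one_div_add_atTop_nhds_zero_nat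

theorem tendsto_mollify [CompleteSpace E] {g : V → E} (hg : Continuous g) (x : V) :
    Tendsto (fun n => mollify n g x) atTop (𝓝 (g x)) := by
  simp only [mollify_eq_convolution]
  exact ContDiffBump.convolution_tendsto_right_of_continuous (tendsto_shrinkingBump_rOut V) hg x

theorem aestronglyMeasurable_fderiv [FiniteDimensional ℝ E] (g : V → E) (μ : Measure V) :
    AEStronglyMeasurable (fderiv ℝ g) μ := by
  have : CompleteSpace E := FiniteDimensional.complete ℝ E
  have : ProperSpace (V →L[ℝ] E) := FiniteDimensional.proper_real _
  have : SecondCountableTopology (V →L[ℝ] E) := secondCountable_of_proper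
  exact (measurable_fderiv ℝ g).aestronglyMeasurable

/-- Rademacher's theorem gives the derivative of the integrand for almost every y, and the Lipschitz
constant of g dominates the difference quotients. -/
theorem fderiv_mollify [FiniteDimensional ℝ E] (n : ℕ) {g : V → E} {L : ℝ≥0}
    (hg : LipschitzWith L g) (x : V) :
    fderiv ℝ (mollify n g) x = mollify n (fderiv ℝ g) x := by
  have hp := Measure.measurePreserving_sub_left (volume : Measure V) x
  have hm : AEStronglyMeasurable (fun y => fderiv ℝ g (x - y)) volume :=
    (aestronglyMeasurable_fderiv g volume).comp_measurePreserving hp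
  have hd : ∀ᵐ y, DifferentiableAt ℝ g (x - y) :=
    hp.quasiMeasurePreserving.ae hg.ae_differentiableAt
  have key := hasFDerivAt_integral_of_dominated_loc_of_lip (μ := volume) (𝕜 := ℝ)
    (F := fun x' y => (shrinkingBump V n).normed volume y • g (x' - y))
    (F' := fun y => (shrinkingBump V n).normed volume y • fderiv ℝ g (x - y))
    (bound := fun y => (shrinkingBump V n).normed volume y * L) (x₀ := x) (s := univ)
    univ_mem (Eventually.of_forall fun x' => (integrable_mollify n hg.continuous x').1)
    (integrable_mollify n hg.continuous x)
    ((shrinkingBump V n).continuous_normed.aestronglyMeasurable.smul hm)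
    (ae_of_all _ fun y => ?_) ((shrinkingBump V n).integrable_normed.mul_const _) ?_
  · exact key.2.fderiv
  · apply LipschitzWith.lipschitzOnWith
    apply LipschitzWith.of_dist_le_mul
    intro a b
    have h0 := (shrinkingBump V n).nonneg_normed (μ := volume) y
    rw [dist_smul₀, Real.norm_of_nonneg h0, Real.coe_nnabs, abs_of_nonneg (by positivity),
      mul_assoc]
    refine mul_le_mul_of_nonneg_left ?_ h0
    simpa using hg.dist_le_mul (a - y) (b - y)
  · filter_upwards [hd] with y hy
    have h1 : HasFDerivAt (fun x' => g (x' - y)) (fderiv ℝ g (x - y)) x := by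
      have := hy.hasFDerivAt.comp x ((hasFDerivAt_id x).sub_const y)
      rwa [ContinuousLinearMap.comp_id] at this
    exact h1.const_smul _

/-- The gradient of a Lipschitz map is bounded, hence locally integrable, and its averages converge
at Lebesgue points. The bumps qualify because their outer radius is twice the inner one. -/
theorem ae_tendsto_fderiv_mollify [FiniteDimensional ℝ E] {g : V → E} {L : ℝ≥0}
    (hg : LipschitzWith L g) :
    ∀ᵐ x, Tendsto (fun n => fderiv ℝ (mollify n g) x) atTop (𝓝 (fderiv ℝ g x)) := by
  have hl : LocallyIntegrable (fderiv ℝ g) (volume : Measure V) := by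
    intro x
    refine ⟨Metric.ball x 1, Metric.ball_mem_nhds x one_pos, ?_⟩
    exact Measure.integrableOn_of_bounded (M := L) measure_ball_lt_top.ne
      (aestronglyMeasurable_fderiv g _)
      (ae_of_all _ fun y => norm_fderiv_le_of_lipschitz ℝ hg)
  have h := ContDiffBump.ae_convolution_tendsto_right_of_locallyIntegrable (K := 2)
    (tendsto_shrinkingBump_rOut V) (Eventually.of_forall fun n => le_of_eq ?_) hl
  · filter_upwards [h] with x hx
    refine hx.congr fun n => ?_
    rw [fderiv_mollify n hg, mollify_eq_convolution]
  · have : (0 : ℝ) < n + 1 := by positivity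
    simp only [shrinkingBump]
    field_simp

end Mollify

section LpConvergence

open Filter Topology

/-- Dominated convergence in `L²`. -/
theorem tendsto_Lp_of_dominated {α E : Type*} [MeasurableSpace α] {μ : Measure α}
    [NormedAddCommGroup E] {F : ℕ → Lp E 2 μ} {f : Lp E 2 μ} {g : α → ℝ} (hg : MemLp g 2 μ)
    (hF : ∀ n, ∀ᵐ x ∂μ, ‖F n x‖ ≤ g x)
    (hlim : ∀ᵐ x ∂μ, Tendsto (fun n => F n x) atTop (𝓝 (f x))) : Tendsto F atTop (𝓝 f) := by
  rw [Lp.tendsto_Lp_iff_tendsto_eLpNorm']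
  have h1 : ∀ n, eLpNorm (⇑(F n) - ⇑f) 2 μ = (∫⁻ x, ‖F n x - f x‖ₑ ^ (2 : ℝ) ∂μ) ^ (1 / 2 : ℝ) := by
    intro n
    rw [eLpNorm_eq_lintegral_rpow_enorm_toReal (by norm_num) (by norm_num)]
    simp
  simp only [h1]
  have h2 : Tendsto (fun n => ∫⁻ x, ‖F n x - f x‖ₑ ^ (2 : ℝ) ∂μ) atTop (𝓝 0) := by
    have hfin : ∫⁻ x, (‖g x‖ₑ + ‖f x‖ₑ) ^ (2 : ℝ) ∂μ ≠ ⊤ := by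
      have hm : MemLp (fun x => ‖g x‖ + ‖f x‖) 2 μ := hg.norm.add (Lp.memLp f).norm
      have := (lintegral_rpow_enorm_lt_top_of_eLpNorm_lt_top (by norm_num) (by norm_num) hm.2).ne
      convert this using 4 with x
      · rw [← ofReal_norm, ← ofReal_norm, ← ofReal_norm,
          ← ENNReal.ofReal_add (norm_nonneg _) (norm_nonneg _),
          Real.norm_of_nonneg (add_nonneg (norm_nonneg _) (norm_nonneg _))]
      · simp
    have := tendsto_lintegral_of_dominated_convergence' (μ := μ)
      (F := fun n x => ‖F n x - f x‖ₑ ^ (2 : ℝ)) (f := fun _ => 0)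
      (fun x => (‖g x‖ₑ + ‖f x‖ₑ) ^ (2 : ℝ))
      (fun n => (((Lp.aestronglyMeasurable (F n)).sub
        (Lp.aestronglyMeasurable f)).enorm).pow_const _) ?_ hfin ?_
    · simpa using this
    · intro n
      filter_upwards [hF n] with x hx
      refine ENNReal.rpow_le_rpow ((enorm_sub_le).trans ?_) (by norm_num)
      gcongr
      rw [enorm_le_iff_norm_le]
      exact hx.trans (le_abs_self _)
    · filter_upwards [hlim] with x hx
      have h3 : Tendsto (fun n => ‖F n x - f x‖ₑ) atTop (𝓝 0) := by
        have := (hx.sub_const (f x)).enorm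
        simpa using this
      have := (ENNReal.continuous_rpow_const (y := 2)).tendsto 0 |>.comp h3
      simpa [Function.comp_def] using this
  have := (ENNReal.continuous_rpow_const (y := 1 / 2)).tendsto 0 |>.comp h2
  simpa [Function.comp_def] using this

end LpConvergence

end CEM

end

/-! ## Products with cutoff functions -/

noncomputable section

namespace CEM

open Filter Topology

variable {d : ℕ}

/-- `q` is the product `ζ p` of a pair with a scalar function, by the product rule. -/
def IsMul {ν : Measure (Vec d)} (ζ : Vec d → ℝ) (p q : Pair ν) : Prop :=
  (∀ᵐ x ∂ν, q.1 x = ζ x • p.1 x) ∧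
    ∀ᵐ x ∂ν, q.2 x = ζ x • p.2 x + (fderiv ℝ ζ x).smulRight (p.1 x)

theorem norm_mul_grad_le {L : ℝ≥0} {ζ : Vec d → ℝ} (hζ : LipschitzWith L ζ)
    (hb : ∀ x, |ζ x| ≤ 1) (x : Vec d) (A : Grad d) (a : Vec d) :
    ‖ζ x • A + (fderiv ℝ ζ x).smulRight a‖ ≤ ‖A‖ + L * ‖a‖ := by
  refine (norm_add_le _ _).trans (add_le_add ?_ ?_)
  · rw [norm_smul]
    exact mul_le_of_le_one_left (norm_nonneg _) (hb x)
  · rw [ContinuousLinearMap.norm_smulRight_apply]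
    exact mul_le_mul_of_nonneg_right (norm_fderiv_le_of_lipschitz ℝ hζ) (norm_nonneg _)

theorem exists_isMul {L : ℝ≥0} {ζ : Vec d → ℝ} (hζ : LipschitzWith L ζ) (hb : ∀ x, |ζ x| ≤ 1)
    (p : Pair (volume : Measure (Vec d))) : ∃ q, IsMul ζ p q := by
  have h1 : MemLp (fun x => ζ x • p.1 x) 2 (volume : Measure (Vec d)) := by
    refine (Lp.memLp p.1).mono (hζ.continuous.aestronglyMeasurable.smul (Lp.aestronglyMeasurable _))
      (ae_of_all _ fun x => ?_)
    rw [norm_smul]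
    exact mul_le_of_le_one_left (norm_nonneg _) (hb x)
  have hm : AEStronglyMeasurable (fun x => (fderiv ℝ ζ x).smulRight (p.1 x))
      (volume : Measure (Vec d)) := by
    have hc : Continuous fun t : (Vec d →L[ℝ] ℝ) × Vec d => t.1.smulRight t.2 := by
      fun_prop
    exact hc.comp_aestronglyMeasurable
      ((aestronglyMeasurable_fderiv ζ _).prodMk (Lp.aestronglyMeasurable _))
  have h2 : MemLp (fun x => ζ x • p.2 x + (fderiv ℝ ζ x).smulRight (p.1 x)) 2
      (volume : Measure (Vec d)) := by
    refine (((Lp.memLp p.2).norm.add ((Lp.memLp p.1).norm.const_mul (L : ℝ)))).mono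
      ((hζ.continuous.aestronglyMeasurable.smul (Lp.aestronglyMeasurable _)).add hm)
      (ae_of_all _ fun x => ?_)
    refine (norm_mul_grad_le hζ hb x _ _).trans (le_abs_self _)
  exact ⟨(h1.toLp _, h2.toLp _), h1.coeFn_toLp, h2.coeFn_toLp⟩

/-- Dominated convergence; a common Lipschitz constant gives the majorant |∇p| + L|p|. Where the
pair itself vanishes, convergence of the multipliers is irrelevant. -/
theorem tendsto_isMul {L : ℝ≥0} {ζn : ℕ → Vec d → ℝ} {ζ : Vec d → ℝ}
    (hL : ∀ n, LipschitzWith L (ζn n)) (hb : ∀ n x, |ζn n x| ≤ 1)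
    {p q : Pair (volume : Measure (Vec d))} {qn : ℕ → Pair (volume : Measure (Vec d))}
    (hqn : ∀ n, IsMul (ζn n) p (qn n)) (hq : IsMul ζ p q)
    (hlim : ∀ᵐ x, p.1 x ≠ 0 ∨ p.2 x ≠ 0 → Tendsto (fun n => ζn n x) atTop (𝓝 (ζ x)) ∧
      Tendsto (fun n => fderiv ℝ (ζn n) x) atTop (𝓝 (fderiv ℝ ζ x))) :
    Tendsto qn atTop (𝓝 q) := by
  rw [Prod.tendsto_iff]
  constructor
  · refine tendsto_Lp_of_dominated (Lp.memLp p.1).norm (fun n => ?_) ?_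
    · filter_upwards [(hqn n).1] with x hx
      rw [hx, norm_smul]
      exact mul_le_of_le_one_left (norm_nonneg _) (hb n x)
    · filter_upwards [hlim, hq.1, ae_all_iff.2 fun n => (hqn n).1] with x h1 h2 h3
      simp only [h2, h3]
      by_cases h0 : p.1 x = 0
      · simp [h0]
      · exact (h1 (Or.inl h0)).1.smul_const _
  · refine tendsto_Lp_of_dominated
      ((Lp.memLp p.2).norm.add ((Lp.memLp p.1).norm.const_mul (L : ℝ))) (fun n => ?_) ?_
    · filter_upwards [(hqn n).2] with x hx
      rw [hx]
      exact norm_mul_grad_le (hL n) (hb n) x _ _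
    · filter_upwards [hlim, hq.2, ae_all_iff.2 fun n => (hqn n).2] with x h1 h2 h3
      simp only [h2, h3]
      by_cases h0 : p.1 x ≠ 0 ∨ p.2 x ≠ 0
      · obtain ⟨h4, h5⟩ := h1 h0
        refine (h4.smul_const _).add ?_
        have hc : Continuous fun t : Vec d →L[ℝ] ℝ => t.smulRight (p.1 x) := by fun_prop
        exact (hc.tendsto _).comp h5
      · push Not at h0
        have hz : ∀ t : ℝ, t • (0 : Grad d) = 0 := fun t => by ext v i; simp
        simp only [h0.1, h0.2, hz, ContinuousLinearMap.smulRight_zero, add_zero]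
        exact tendsto_const_nhds

/-- Multiplication by a fixed ζ is bounded on H¹, with norm at most 1 + L. -/
theorem tendsto_isMul_of_tendsto {L : ℝ≥0} {ζ : Vec d → ℝ} (hL : LipschitzWith L ζ)
    (hb : ∀ x, |ζ x| ≤ 1) {p q : Pair (volume : Measure (Vec d))}
    {pn qn : ℕ → Pair (volume : Measure (Vec d))} (hpn : Tendsto pn atTop (𝓝 p))
    (hqn : ∀ n, IsMul ζ (pn n) (qn n)) (hq : IsMul ζ p q) : Tendsto qn atTop (𝓝 q) := by
  have key : ∀ n, ‖qn n - q‖ ≤ (1 + L) * ‖pn n - p‖ := by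
    intro n
    have e1 : ‖(pn n).1 - p.1‖ ≤ ‖pn n - p‖ := norm_fst_le (pn n - p)
    have e2 : ‖(pn n).2 - p.2‖ ≤ ‖pn n - p‖ := norm_snd_le (pn n - p)
    refine max_le ?_ ?_
    · refine (Lp.norm_le_norm_of_ae_le (g := (pn n).1 - p.1) ?_).trans (e1.trans ?_)
      · rw [Prod.fst_sub]
        filter_upwards [(hqn n).1, hq.1, Lp.coeFn_sub (qn n).1 q.1, Lp.coeFn_sub (pn n).1 p.1]
          with x h1 h2 h3 h4
        rw [h3, h4, Pi.sub_apply, Pi.sub_apply, h1, h2, ← smul_sub, norm_smul]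
        exact mul_le_of_le_one_left (norm_nonneg _) (hb x)
      · exact le_mul_of_one_le_left (norm_nonneg _) (by simp)
    · have hm : MemLp (fun x => ‖((pn n).2 - p.2) x‖ + L * ‖((pn n).1 - p.1) x‖) 2
          (volume : Measure (Vec d)) :=
        (Lp.memLp _).norm.add ((Lp.memLp ((pn n).1 - p.1)).norm.const_mul (L : ℝ))
      have h5 : ‖(qn n - q).2‖ ≤ ‖hm.toLp _‖ := by
        refine Lp.norm_le_norm_of_ae_le ?_
        rw [Prod.snd_sub]
        filter_upwards [(hqn n).2, hq.2, Lp.coeFn_sub (qn n).2 q.2, Lp.coeFn_sub (pn n).2 p.2,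
          Lp.coeFn_sub (pn n).1 p.1, hm.coeFn_toLp] with x h1 h2 h3 h4 h5 h6
        rw [h6, h5, h4, h3, Pi.sub_apply, Pi.sub_apply, Pi.sub_apply, h1, h2]
        have := norm_mul_grad_le hL hb x ((pn n).2 x - p.2 x) ((pn n).1 x - p.1 x)
        refine le_trans (le_of_eq ?_) (this.trans (le_abs_self _))
        congr 1
        ext v i
        simp
        ring
      have h6 : ‖hm.toLp _‖ ≤ ‖(pn n).2 - p.2‖ + L * ‖(pn n).1 - p.1‖ := by
        have h7 : hm.toLp _ = ((Lp.memLp ((pn n).2 - p.2)).norm).toLp _ +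
            (L : ℝ) • ((Lp.memLp ((pn n).1 - p.1)).norm).toLp _ := rfl
        rw [h7]
        refine (norm_add_le _ _).trans (add_le_add ?_ ?_)
        · refine Lp.norm_le_norm_of_ae_le ?_
          filter_upwards [(Lp.memLp ((pn n).2 - p.2)).norm.coeFn_toLp] with x hx
          rw [hx, norm_norm]
        · rw [norm_smul, NNReal.norm_eq]
          refine mul_le_mul_of_nonneg_left (Lp.norm_le_norm_of_ae_le ?_) L.2
          filter_upwards [(Lp.memLp ((pn n).1 - p.1)).norm.coeFn_toLp] with x hx
          rw [hx, norm_norm]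
      have hL0 : (0 : ℝ) ≤ L := L.2
      nlinarith
  rw [tendsto_iff_norm_sub_tendsto_zero] at hpn ⊢
  refine squeeze_zero (fun n => norm_nonneg _) key ?_
  simpa using hpn.const_mul (1 + (L : ℝ))

/-! ### Cutoffs in the spaces H¹₀ -/

theorem isClosed_H10 (G : Set (Vec d)) : IsClosed (H10 G : Set (Pair (volume : Measure (Vec d)))) :=
  Submodule.isClosed_topologicalClosure _

theorem testPairs_le_H10 (G : Set (Vec d)) : testPairs G ≤ H10 G :=
  Submodule.le_topologicalClosure _

theorem testPairs_mono {G G' : Set (Vec d)} (h : G ⊆ G') : testPairs G ≤ testPairs G' := by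
  rintro p ⟨w, h1, h2, h3, h4⟩
  exact ⟨w, h1, h2, h3.trans h, h4⟩

theorem H10_mono {G G' : Set (Vec d)} (h : G ⊆ G') : H10 G ≤ H10 G' :=
  Submodule.topologicalClosure_mono (testPairs_mono h)

theorem exists_testPairs_tendsto {G : Set (Vec d)} {p : Pair (volume : Measure (Vec d))}
    (hp : p ∈ H10 G) : ∃ pn : ℕ → Pair (volume : Measure (Vec d)),
      (∀ n, pn n ∈ testPairs G) ∧ Tendsto pn atTop (𝓝 p) :=
  mem_closure_iff_seq_limit.1 hp

theorem lipschitzWith_posPart_sub {L : ℝ≥0} {ζ : Vec d → ℝ} (hL : LipschitzWith L ζ) (t : ℝ) :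
    LipschitzWith L fun x => max (ζ x - t) 0 := by
  have := (hL.sub (LipschitzWith.const t)).max_const 0
  simpa using this

theorem fderiv_smul_eq {V E : Type*} [NormedAddCommGroup V] [NormedSpace ℝ V]
    [NormedAddCommGroup E] [NormedSpace ℝ E] {ζ : V → ℝ} {w : V → E} (hζ : ContDiff ℝ ∞ ζ)
    (hw : ContDiff ℝ ∞ w) (x : V) :
    fderiv ℝ (fun y => ζ y • w y) x = ζ x • fderiv ℝ w x + (fderiv ℝ ζ x).smulRight (w x) :=
  fderiv_fun_smul (hζ.differentiable (by simp) x) (hw.differentiable (by simp) x)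

/-- A test field times a Lipschitz function whose support meets that of the field inside `G`. -/
theorem isMul_mem_H10_of_tsupport {L : ℝ≥0} {ζ : Vec d → ℝ} (hL : LipschitzWith L ζ)
    (hb : ∀ x, |ζ x| ≤ 1) {G : Set (Vec d)} (hG : IsOpen G) {w : Vec d → Vec d}
    (hw : ContDiff ℝ ∞ w) (hwc : HasCompactSupport w) (hs : tsupport ζ ∩ tsupport w ⊆ G)
    {p q : Pair (volume : Measure (Vec d))} (hp1 : p.1 =ᵐ[volume] w)
    (hp2 : p.2 =ᵐ[volume] fderiv ℝ w) (hq : IsMul ζ p q) : q ∈ H10 G := by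
  -- A compact and a closed set that are disjoint have positive distance, so mollifying ζ at a scale
  -- below δ keeps the support of the product inside G.
  have hdisj : Disjoint (tsupport w \ G) (tsupport ζ) := by
    rw [Set.disjoint_left]
    exact fun x hx hx' => hx.2 (hs ⟨hx', hx.1⟩)
  obtain ⟨δ, hδ, hdisj⟩ := hdisj.exists_cthickenings (hwc.isCompact.diff hG)
    (isClosed_tsupport ζ)
  obtain ⟨N, hN⟩ := exists_nat_one_div_lt hδ
  have hLn : ∀ n, LipschitzWith L (mollify (n + N) ζ) := fun n => lipschitzWith_mollify _ hL
  have hbn : ∀ n x, |mollify (n + N) ζ x| ≤ 1 := fun n x => by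
    have := norm_mollify_le (n + N) (g := ζ) (b := 1) (fun y => hb y) x
    rwa [Real.norm_eq_abs] at this
  choose qn hqn using fun n => exists_isMul (hLn n) (hbn n) p
  refine (isClosed_H10 G).mem_of_tendsto (tendsto_isMul hLn hbn hqn hq ?_)
    (Eventually.of_forall fun n => testPairs_le_H10 G ?_)
  · filter_upwards [ae_tendsto_fderiv_mollify hL] with x hx _
    exact ⟨(tendsto_mollify hL.continuous x).comp (tendsto_add_atTop_nat N),
      hx.comp (tendsto_add_atTop_nat N)⟩
  · have hsm : ContDiff ℝ ∞ (mollify (n + N) ζ) := contDiff_mollify _ hL.continuous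
    have hsr : (Function.support fun x => mollify (n + N) ζ x • w x) ⊆ Function.support w :=
      fun x hx h => hx (by simp [h])
    have hsl : (Function.support fun x => mollify (n + N) ζ x • w x) ⊆
        Function.support (mollify (n + N) ζ) := fun x hx h => hx (by simp [h])
    refine ⟨fun x => mollify (n + N) ζ x • w x, hsm.smul hw, hwc.mono hsr, ?_, ?_, ?_⟩
    · have h1 : tsupport (fun x => mollify (n + N) ζ x • w x) ⊆ tsupport w :=
        closure_mono hsr
      have h2 : tsupport (fun x => mollify (n + N) ζ x • w x) ⊆
          Metric.cthickening δ (tsupport ζ) := by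
        refine closure_minimal ?_ Metric.isClosed_cthickening
        refine hsl.trans ((support_mollify_subset _ _).trans ?_)
        refine (Metric.cthickening_mono ?_ _).trans
          (Metric.cthickening_subset_of_subset _ subset_closure)
        refine le_trans ?_ hN.le
        rw [one_div_le_one_div (by positivity) (by positivity)]
        push_cast
        linarith [(Nat.cast_nonneg n : (0 : ℝ) ≤ n)]
      intro x hx
      by_contra hxG
      exact Set.disjoint_left.1 hdisj
        (Metric.self_subset_cthickening _ ⟨h1 hx, hxG⟩) (h2 hx)
    · filter_upwards [(hqn n).1, hp1] with x h1 h2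
      rw [h1, h2]
    · filter_upwards [(hqn n).2, hp1, hp2] with x h1 h2 h3
      rw [h1, h2, h3]
      exact (fderiv_smul_eq hsm hw x).symm

/-- A Lipschitz cutoff function that is supported in `G` maps `H¹₀(D)` to `H¹₀(G)`. -/
theorem isMul_mem_H10 {L : ℝ≥0} {ζ : Vec d → ℝ} (hL : LipschitzWith L ζ)
    (hζ : ∀ x, ζ x ∈ Icc (0 : ℝ) 1) {D G : Set (Vec d)} (hG : IsOpen G)
    (hs : ∀ x ∈ D, ζ x ≠ 0 → x ∈ G)
    {p q : Pair (volume : Measure (Vec d))} (hp : p ∈ H10 D) (hq : IsMul ζ p q) : q ∈ H10 G := by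
  have hb : ∀ x, |ζ x| ≤ 1 := fun x => abs_le.2 ⟨by linarith [(hζ x).1], (hζ x).2⟩
  obtain ⟨pn, hpn, hlim⟩ := exists_testPairs_tendsto hp
  choose qn hqn using fun n => exists_isMul hL hb (pn n)
  refine (isClosed_H10 G).mem_of_tendsto (tendsto_isMul_of_tendsto hL hb hlim hqn hq)
    (Eventually.of_forall fun n => ?_)
  obtain ⟨w, hw, hwc, hwD, hp1, hp2⟩ := hpn n
  -- On D only the open set {ζ ≠ 0} is known to lie in G, not its closure. The truncations (ζ - t)₊
  -- have closed support in {ζ ≥ t}, and they converge to ζ with their gradients.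
  set t : ℕ → ℝ := fun k => 1 / ((k : ℝ) + 1) with ht
  have ht0 : ∀ k, 0 < t k := fun k => by positivity
  have htlim : Tendsto t atTop (𝓝 0) := tendsto_one_div_add_atTop_nhds_zero_nat
  have hLk : ∀ k, LipschitzWith L fun x => max (ζ x - t k) 0 :=
    fun k => lipschitzWith_posPart_sub hL _
  have hbk : ∀ k x, |max (ζ x - t k) 0| ≤ 1 := fun k x => by
    rw [abs_of_nonneg (le_max_right _ _)]
    exact max_le (by linarith [(hζ x).2, ht0 k]) zero_le_one
  choose r hr using fun k => exists_isMul (hLk k) (hbk k) (pn n)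
  refine (isClosed_H10 G).mem_of_tendsto (tendsto_isMul hLk hbk hr (hqn n) ?_)
    (Eventually.of_forall fun k => ?_)
  · refine ae_of_all _ fun x _ => ?_
    -- At a zero of ζ all truncations vanish nearby, and ζ has a minimum there, so its derivative
    -- vanishes too.
    rcases (hζ x).1.eq_or_lt with h0 | h0
    · have hz : ∀ k, (fun y => max (ζ y - t k) 0) =ᶠ[𝓝 x] fun _ => 0 := by
        intro k
        filter_upwards [hL.continuous.continuousAt.eventually_lt
          (continuousAt_const (y := t k)) (by rw [← h0]; exact ht0 k)] with y hy
        exact max_eq_right (by linarith)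
      have hmin : IsLocalMin ζ x := Eventually.of_forall fun y => by
        rw [← h0]
        exact (hζ y).1
      rw [hmin.fderiv_eq_zero, ← h0]
      refine ⟨tendsto_const_nhds.congr fun k => ?_,
        tendsto_const_nhds.congr fun k => ?_⟩
      · have := (hz k).eq_of_nhds
        rw [← h0] at this
        exact this.symm
      rw [(hz k).fderiv_eq, fderiv_fun_const]
      rfl
    · have hev : ∀ᶠ k in atTop, (fun y => max (ζ y - t k) 0) =ᶠ[𝓝 x] fun y => ζ y - t k := by
        filter_upwards [htlim.eventually_lt_const h0] with k hk
        filter_upwards [hL.continuous.continuousAt.eventually_const_lt hk] with y hy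
        exact max_eq_left (by linarith)
      constructor
      · have : Tendsto (fun k => ζ x - t k) atTop (𝓝 (ζ x - 0)) := htlim.const_sub _
        rw [sub_zero] at this
        refine this.congr' ?_
        filter_upwards [hev] with k hk using hk.eq_of_nhds.symm
      · refine tendsto_const_nhds.congr' ?_
        filter_upwards [hev] with k hk
        rw [hk.fderiv_eq, fderiv_sub_const]
  · refine isMul_mem_H10_of_tsupport (hLk k) (hbk k) hG hw hwc ?_ hp1 hp2 (hr k)
    rintro x ⟨hx1, hx2⟩
    refine hs x (hwD hx2) ?_
    have : tsupport (fun y => max (ζ y - t k) 0) ⊆ {y | t k ≤ ζ y} := by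
      refine closure_minimal ?_ (isClosed_le continuous_const hL.continuous)
      intro y hy
      by_contra hy'
      simp only [mem_ofPred_eq, not_le] at hy'
      exact hy (max_eq_right (by linarith))
    exact ((ht0 k).trans_le (this hx1)).ne'

end CEM

end

/-! ## Strains and integration by parts -/

noncomputable section

namespace CEM

open Filter Topology

variable {d : ℕ}

/-- Twice the symmetric part of a gradient. -/
def symGrad (A : Grad d) : Grad d := A + ContinuousLinearMap.adjoint A

theorem symGrad_add (A B : Grad d) : symGrad (A + B) = symGrad A + symGrad B := by
  simp only [symGrad, map_add]
  abel

theorem symGrad_smul (t : ℝ) (A : Grad d) : symGrad (t • A) = t • symGrad A := by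
  simp only [symGrad, map_smulₛₗ, smul_add]
  rfl

/-- Taking the symmetric part commutes with the congruence A ↦ LᵀAL. Hence fields must be
transported as Lᵀw(L·): then strains are controlled by strains alone. -/
theorem symGrad_conj (L A : Grad d) :
    symGrad ((ContinuousLinearMap.adjoint L).comp (A.comp L)) =
      (ContinuousLinearMap.adjoint L).comp ((symGrad A).comp L) := by
  simp only [symGrad, ContinuousLinearMap.adjoint_comp, ContinuousLinearMap.adjoint_adjoint,
    ContinuousLinearMap.add_comp, ContinuousLinearMap.comp_add, ContinuousLinearMap.comp_assoc]

theorem norm_symGrad_le (A : Grad d) : ‖symGrad A‖ ≤ 2 * ‖A‖ := by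
  refine (norm_add_le _ _).trans ?_
  rw [LinearIsometryEquiv.norm_map]
  linarith

theorem continuous_symGrad : Continuous (symGrad (d := d)) :=
  continuous_id.add (LinearIsometryEquiv.continuous _)

theorem symGrad_apply_single (A : Grad d) (i j : Fin d) :
    symGrad A (EuclideanSpace.single j 1) i = 2 * strain A i j := by
  have h : (ContinuousLinearMap.adjoint A (EuclideanSpace.single j 1)) i =
      A (EuclideanSpace.single i 1) j := by
    have := ContinuousLinearMap.adjoint_inner_right A (EuclideanSpace.single i (1 : ℝ))
      (EuclideanSpace.single j (1 : ℝ))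
    rw [EuclideanSpace.inner_single_left, EuclideanSpace.inner_single_right] at this
    simpa using this
  simp only [symGrad, add_apply, PiLp.add_apply, h, strain]
  ring

theorem sq_norm_le_sum_sq (A : Grad d) :
    ‖A‖ ^ 2 ≤ ∑ i, ∑ j, (A (EuclideanSpace.single j 1) i) ^ 2 := by
  set F := ∑ i, ∑ j, (A (EuclideanSpace.single j 1) i) ^ 2 with hF
  have hF0 : 0 ≤ F := Finset.sum_nonneg fun i _ => Finset.sum_nonneg fun j _ => sq_nonneg _
  rw [← Real.le_sqrt (norm_nonneg _) hF0]
  refine A.opNorm_le_bound (Real.sqrt_nonneg _) fun v => ?_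
  rw [← Real.sqrt_sq (norm_nonneg v), ← Real.sqrt_mul hF0]
  refine Real.le_sqrt_of_sq_le ?_
  rw [EuclideanSpace.norm_sq_eq, EuclideanSpace.norm_sq_eq, hF, Finset.sum_mul]
  refine Finset.sum_le_sum fun i _ => ?_
  have hv : v = ∑ j, v j • EuclideanSpace.single j (1 : ℝ) := by
    ext k
    simp [Finset.sum_apply, Pi.single_apply]
  have h1 : A v i = ∑ j, A (EuclideanSpace.single j 1) i * v j := by
    conv_lhs => rw [hv]
    simp [mul_comm]
  rw [Real.norm_eq_abs, sq_abs, h1]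
  refine (Finset.sum_mul_sq_le_sq_mul_sq _ _ _).trans (le_of_eq ?_)
  simp

theorem sq_norm_symGrad_le (A : Grad d) :
    ‖symGrad A‖ ^ 2 ≤ 4 * ∑ i, ∑ j, strain A i j ^ 2 := by
  refine (sq_norm_le_sum_sq _).trans (le_of_eq ?_)
  simp only [symGrad_apply_single, mul_pow, Finset.mul_sum]
  norm_num

theorem sq_strain_le (A : Grad d) (i j : Fin d) : strain A i j ^ 2 ≤ ‖symGrad A‖ ^ 2 := by
  have h : |2 * strain A i j| ≤ ‖symGrad A‖ := by
    rw [← symGrad_apply_single]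
    refine (PiLp.norm_apply_le (symGrad A (EuclideanSpace.single j 1)) i).trans ?_
    simpa using (symGrad A).le_opNorm (EuclideanSpace.single j 1)
  rw [← sq_abs]
  have h2 : |strain A i j| ≤ ‖symGrad A‖ := by
    rw [abs_mul, abs_two] at h
    linarith [abs_nonneg (strain A i j)]
  gcongr

/-! ### Korn's first inequality on the whole space -/

section IntegrationByParts

variable {f g : Vec d → ℝ}

theorem integrable_fderiv_mul_fderiv (hf : ContDiff ℝ ∞ f) (hg : ContDiff ℝ ∞ g)
    (hfc : HasCompactSupport f) (u v : Vec d) :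
    Integrable (fun x => fderiv ℝ f x u * fderiv ℝ g x v) := by
  apply Continuous.integrable_of_hasCompactSupport
  · exact ((hf.continuous_fderiv (by simp)).clm_apply continuous_const).mul
      ((hg.continuous_fderiv (by simp)).clm_apply continuous_const)
  · exact (hfc.fderiv_apply (𝕜 := ℝ) u).mul_right

/-- Integrating by parts once on each side leaves f against a second derivative of g, which is
symmetric. -/
theorem integral_fderiv_mul_fderiv_comm (hf : ContDiff ℝ ∞ f) (hg : ContDiff ℝ ∞ g)
    (hfc : HasCompactSupport f) (hgc : HasCompactSupport g) (u v : Vec d) :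
    ∫ x, fderiv ℝ f x u * fderiv ℝ g x v = ∫ x, fderiv ℝ f x v * fderiv ℝ g x u := by
  have hg' : ∀ v : Vec d, ContDiff ℝ ∞ fun x => fderiv ℝ g x v := fun v =>
    (hg.fderiv_right (m := ∞) (by simp)).clm_apply contDiff_const
  have hgc' : ∀ v : Vec d, HasCompactSupport fun x => fderiv ℝ g x v := fun v =>
    hgc.fderiv_apply (𝕜 := ℝ) v
  have key : ∀ u v : Vec d, ∫ x, f x * fderiv ℝ (fun y => fderiv ℝ g y v) x u =
      -∫ x, fderiv ℝ f x u * fderiv ℝ g x v := by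
    intro u v
    apply integral_mul_fderiv_eq_neg_fderiv_mul_of_integrable
    · exact integrable_fderiv_mul_fderiv hf hg hfc u v
    · apply Continuous.integrable_of_hasCompactSupport
      · exact hf.continuous.mul
          (((hg' v).continuous_fderiv (by simp)).clm_apply continuous_const)
      · exact hfc.mul_right
    · exact (hf.continuous.mul (hg' v).continuous).integrable_of_hasCompactSupport hfc.mul_right
    · exact fun x _ => hf.differentiable (by simp) x
    · exact fun x _ => (hg' v).differentiable (by simp) x
  have hsymm : ∀ x, fderiv ℝ (fun y => fderiv ℝ g y v) x u =
      fderiv ℝ (fun y => fderiv ℝ g y u) x v := by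
    intro x
    have hd : DifferentiableAt ℝ (fderiv ℝ g) x :=
      (hg.fderiv_right (m := ∞) (by simp)).differentiable (by simp) x
    have h1 : ∀ w : Vec d, fderiv ℝ (fun y => fderiv ℝ g y w) x =
        (fderiv ℝ (fderiv ℝ g) x).flip w := by
      intro w
      rw [fderiv_clm_apply hd (differentiableAt_const w)]
      ext z
      simp
    have h2 : IsSymmSndFDerivAt ℝ g x := hg.contDiffAt.isSymmSndFDerivAt (by
      simp only [minSmoothness_of_isRCLikeNormedField]
      exact WithTop.coe_le_coe.2 (le_top : (2 : ℕ∞) ≤ ⊤))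
    rw [h1, h1]
    exact h2 u v
  have h1 := key u v
  have h2 := key v u
  simp only [hsymm] at h1
  linarith

end IntegrationByParts

theorem sum_sq_strain (A : Grad d) :
    ∑ i, ∑ j, (A (EuclideanSpace.single j 1) i) ^ 2 =
      2 * ∑ i, ∑ j, strain A i j ^ 2 - ∑ i, ∑ j,
        A (EuclideanSpace.single j 1) i * A (EuclideanSpace.single i 1) j := by
  have h1 : ∀ i j : Fin d, strain A i j ^ 2 = (1 / 4 : ℝ) * (A (EuclideanSpace.single j 1) i) ^ 2 +
      (1 / 4 : ℝ) * (A (EuclideanSpace.single i 1) j) ^ 2 + (1 / 2 : ℝ) *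
        (A (EuclideanSpace.single j 1) i * A (EuclideanSpace.single i 1) j) := by
    intro i j
    rw [strain]
    ring
  simp only [h1, Finset.sum_add_distrib, ← Finset.mul_sum]
  rw [Finset.sum_comm (f := fun i j : Fin d => (A (EuclideanSpace.single i 1) j) ^ 2)]
  ring

theorem integral_sum_sum {α : Type*} [MeasurableSpace α] {μ : Measure α}
    {F : Fin d → Fin d → α → ℝ} (hF : ∀ i j, Integrable (F i j) μ) :
    ∫ x, ∑ i, ∑ j, F i j x ∂μ = ∑ i, ∑ j, ∫ x, F i j x ∂μ := by
  rw [integral_finsetSum _ fun i _ => integrable_finsetSum _ fun j _ => hF i j]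
  exact Finset.sum_congr rfl fun i _ => integral_finsetSum _ fun j _ => hF i j

/-- Korn's first inequality for test fields. -/
theorem integral_sum_sq_fderiv_le {w : Vec d → Vec d} (hw : ContDiff ℝ ∞ w)
    (hwc : HasCompactSupport w) :
    ∫ x, ∑ i, ∑ j, (fderiv ℝ w x (EuclideanSpace.single j 1) i) ^ 2 ≤
      ∫ x, 2 * ∑ i, ∑ j, strain (fderiv ℝ w x) i j ^ 2 := by
  have hc : Continuous (fderiv ℝ w) := hw.continuous_fderiv (by simp)
  have hcomp : ∀ i, ContDiff ℝ ∞ fun x => w x i := fun i => contDiff_euclidean.1 hw i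
  have hcc : ∀ i, HasCompactSupport fun x => w x i := fun i =>
    hwc.comp_left (g := fun v : Vec d => v i) rfl
  have hfd : ∀ i x v, fderiv ℝ (fun y => w y i) x v = fderiv ℝ w x v i := by
    intro i x v
    have h := ((EuclideanSpace.proj (𝕜 := ℝ) i).hasFDerivAt.comp x
      (hw.differentiable (by simp) x).hasFDerivAt).fderiv
    exact congrArg (fun B : Vec d →L[ℝ] ℝ => B v) h
  have hint : ∀ i j k l : Fin d, Integrable fun x =>
      fderiv ℝ w x (EuclideanSpace.single i 1) j * fderiv ℝ w x (EuclideanSpace.single k 1) l := by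
    intro i j k l
    simp only [← hfd]
    exact integrable_fderiv_mul_fderiv (hcomp j) (hcomp l) (hcc j) _ _
  -- Exchanging the two derivatives turns the mixed term ∂_j w_i ∂_i w_j into ∂_i w_i ∂_j w_j, whose
  -- sum is the square of the divergence.
  have h0 : 0 ≤ ∫ x, ∑ i, ∑ j, fderiv ℝ w x (EuclideanSpace.single j 1) i *
      fderiv ℝ w x (EuclideanSpace.single i 1) j := by
    have h1 : ∫ x, ∑ i, ∑ j, fderiv ℝ w x (EuclideanSpace.single j 1) i *
        fderiv ℝ w x (EuclideanSpace.single i 1) j =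
        ∫ x, ∑ i, ∑ j, fderiv ℝ w x (EuclideanSpace.single i 1) i *
        fderiv ℝ w x (EuclideanSpace.single j 1) j := by
      rw [integral_sum_sum fun i j => hint j i i j, integral_sum_sum fun i j => hint i i j j]
      refine Finset.sum_congr rfl fun i _ => Finset.sum_congr rfl fun j _ => ?_
      simp only [← hfd]
      exact integral_fderiv_mul_fderiv_comm (hcomp i) (hcomp j) (hcc i) (hcc j) _ _
    rw [h1]
    refine integral_nonneg fun x => ?_
    simp only [← Finset.mul_sum, ← Finset.sum_mul]
    exact mul_self_nonneg _
  have hs : Integrable fun x => ∑ i, ∑ j, fderiv ℝ w x (EuclideanSpace.single j 1) i *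
      fderiv ℝ w x (EuclideanSpace.single i 1) j :=
    integrable_finsetSum _ fun i _ => integrable_finsetSum _ fun j _ => hint _ _ _ _
  have hs2 : Integrable fun x => ∑ i, ∑ j, (fderiv ℝ w x (EuclideanSpace.single j 1) i) ^ 2 := by
    simp only [sq]
    exact integrable_finsetSum _ fun i _ => integrable_finsetSum _ fun j _ => hint _ _ _ _
  have hs3 : (fun x => 2 * ∑ i, ∑ j, strain (fderiv ℝ w x) i j ^ 2) = fun x =>
      (∑ i, ∑ j, (fderiv ℝ w x (EuclideanSpace.single j 1) i) ^ 2) +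
        ∑ i, ∑ j, fderiv ℝ w x (EuclideanSpace.single j 1) i *
          fderiv ℝ w x (EuclideanSpace.single i 1) j := by
    ext x
    rw [sum_sq_strain]
    ring
  rw [hs3, integral_add hs2 hs]
  linarith

end CEM

end

/-! ## Extension by reflection -/

noncomputable section

namespace CEM

open Filter Topology
open scoped ENNReal

variable {d : ℕ}

theorem ennreal_add_sq_le (a b : ℝ≥0∞) : (a + b) ^ 2 ≤ 2 * (a ^ 2 + b ^ 2) := by
  have := ENNReal.rpow_add_le_mul_rpow_add_rpow a b (p := 2) (by norm_num)
  norm_num at this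
  exact_mod_cast this

theorem enorm_grad_zero : ‖(0 : Grad d)‖ₑ = 0 := by
  rw [← ofReal_norm, show ‖(0 : Grad d)‖ = 0 by simp, ENNReal.ofReal_zero]

theorem symGrad_zero : symGrad (0 : Grad d) = 0 := by
  have h : ‖symGrad (0 : Grad d)‖ ≤ 0 := by simpa using norm_symGrad_le (0 : Grad d)
  exact norm_le_zero_iff.1 h

/-- Continuous functions of the gradient of a test field are integrable. -/
theorem integrable_comp_fderiv {w : Vec d → Vec d} (hw : ContDiff ℝ ∞ w)
    (hwc : HasCompactSupport w) {φ : Grad d → ℝ} (hφ : Continuous φ) (h0 : φ 0 = 0) :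
    Integrable fun x => φ (fderiv ℝ w x) := by
  have hc : Continuous (fderiv ℝ w) := hw.continuous_fderiv (by simp)
  exact (hφ.comp hc).integrable_of_hasCompactSupport ((hwc.fderiv ℝ).comp_left h0)

/-- In operator norms Korn's factor 2 is multiplied by d², as each of the d² strain entries is at
most the norm of the symmetric part. -/
theorem lintegral_sq_enorm_fderiv_le_of_contDiff {w : Vec d → Vec d} (hw : ContDiff ℝ ∞ w)
    (hwc : HasCompactSupport w) :
    ∫⁻ x, ‖fderiv ℝ w x‖ₑ ^ 2 ≤ (2 * d * d : ℕ) * ∫⁻ x, ‖symGrad (fderiv ℝ w x)‖ₑ ^ 2 := by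
  have e : ∀ A : Grad d, ‖A‖ₑ ^ 2 = ENNReal.ofReal (‖A‖ ^ 2) := fun A => by
    rw [ENNReal.ofReal_pow (norm_nonneg _), ofReal_norm]
  have hcomp : ∀ i j : Fin d, Continuous fun A : Grad d => A (EuclideanSpace.single j 1) i :=
    fun i j => (EuclideanSpace.proj (𝕜 := ℝ) i).continuous.comp
      (ContinuousLinearMap.apply ℝ (Vec d) (EuclideanSpace.single j (1 : ℝ))).continuous
  have hi1 : Integrable fun x => ‖fderiv ℝ w x‖ ^ 2 :=
    integrable_comp_fderiv hw hwc (φ := fun A => ‖A‖ ^ 2) (continuous_norm.pow 2) (by simp)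
  have hi2 : Integrable fun x => ‖symGrad (fderiv ℝ w x)‖ ^ 2 :=
    integrable_comp_fderiv hw hwc (φ := fun A => ‖symGrad A‖ ^ 2)
      (continuous_symGrad.norm.pow 2) (by simp [symGrad_zero])
  have hi3 : Integrable fun x => ∑ i, ∑ j, (fderiv ℝ w x (EuclideanSpace.single j 1) i) ^ 2 :=
    integrable_comp_fderiv hw hwc
      (φ := fun A => ∑ i, ∑ j, (A (EuclideanSpace.single j 1) i) ^ 2)
      (continuous_finsetSum _ fun i _ => continuous_finsetSum _ fun j _ => (hcomp i j).pow 2)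
      (by simp)
  have hi4 : Integrable fun x => 2 * ∑ i, ∑ j, strain (fderiv ℝ w x) i j ^ 2 :=
    integrable_comp_fderiv hw hwc (φ := fun A => 2 * ∑ i, ∑ j, strain A i j ^ 2)
      (continuous_const.mul (continuous_finsetSum _ fun i _ => continuous_finsetSum _
        fun j _ => (strainL i j).continuous.pow 2)) (by simp [strain])
  simp only [e]
  rw [← ofReal_integral_eq_lintegral_ofReal hi1 (ae_of_all _ fun x => by positivity),
    ← ofReal_integral_eq_lintegral_ofReal hi2 (ae_of_all _ fun x => by positivity),
    ← ENNReal.ofReal_natCast, ← ENNReal.ofReal_mul (by positivity)]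
  apply ENNReal.ofReal_le_ofReal
  calc ∫ x, ‖fderiv ℝ w x‖ ^ 2
      ≤ ∫ x, ∑ i, ∑ j, (fderiv ℝ w x (EuclideanSpace.single j 1) i) ^ 2 :=
        integral_mono hi1 hi3 fun x => sq_norm_le_sum_sq _
    _ ≤ ∫ x, 2 * ∑ i, ∑ j, strain (fderiv ℝ w x) i j ^ 2 := integral_sum_sq_fderiv_le hw hwc
    _ ≤ ∫ x, ((2 * d * d : ℕ) : ℝ) * ‖symGrad (fderiv ℝ w x)‖ ^ 2 := by
        refine integral_mono hi4 (hi2.const_mul _) fun x => ?_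
        have : ∑ i, ∑ j, strain (fderiv ℝ w x) i j ^ 2 ≤
            ∑ _i : Fin d, ∑ _j : Fin d, ‖symGrad (fderiv ℝ w x)‖ ^ 2 :=
          Finset.sum_le_sum fun i _ => Finset.sum_le_sum fun j _ => sq_strain_le _ i j
        simp only [Finset.sum_const, Finset.card_univ, Fintype.card_fin, nsmul_eq_mul] at this
        push_cast
        linarith
    _ = _ := integral_const_mul _ _

/-- Reflected extensions are only Lipschitz, so Korn is needed for them. Along mollifications the
strains converge by domination, and Fatou's lemma handles the full gradient. -/
theorem lintegral_sq_enorm_fderiv_le {w : Vec d → Vec d} {L : ℝ≥0} (hw : LipschitzWith L w)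
    (hwc : HasCompactSupport w) :
    ∫⁻ x, ‖fderiv ℝ w x‖ₑ ^ 2 ≤ (2 * d * d : ℕ) * ∫⁻ x, ‖symGrad (fderiv ℝ w x)‖ₑ ^ 2 := by
  set K := Metric.cthickening 1 (tsupport w) with hK
  have hKc : IsCompact K := hwc.isCompact.cthickening
  have hsupp : ∀ n, tsupport (mollify n w) ⊆ K := by
    intro n
    refine closure_minimal ((support_mollify_subset n w).trans ?_) Metric.isClosed_cthickening
    refine (Metric.cthickening_mono ?_ _).trans (Metric.cthickening_subset_of_subset _ subset_closure)
    rw [div_le_one (by positivity)]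
    linarith [(Nat.cast_nonneg n : (0 : ℝ) ≤ n)]
  have hsm : ∀ n, ContDiff ℝ ∞ (mollify n w) := fun n => contDiff_mollify n hw.continuous
  have hcs : ∀ n, HasCompactSupport (mollify n w) := fun n =>
    hKc.of_isClosed_subset (isClosed_tsupport _) (hsupp n)
  have hlim := ae_tendsto_fderiv_mollify hw
  have hmeas : ∀ n, Measurable fun x => ‖fderiv ℝ (mollify n w) x‖ₑ ^ 2 := fun n =>
    (((hsm n).continuous_fderiv (by simp)).enorm.measurable).pow_const 2
  have hsmeas : ∀ n, Measurable fun x => ‖symGrad (fderiv ℝ (mollify n w) x)‖ₑ ^ 2 := fun n =>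
    ((continuous_symGrad.comp ((hsm n).continuous_fderiv (by simp))).enorm.measurable).pow_const 2
  have hbound : ∀ n x, ‖symGrad (fderiv ℝ (mollify n w) x)‖ₑ ^ 2 ≤
      K.indicator (fun _ => ((2 * L : ℝ≥0) : ℝ≥0∞) ^ 2) x := by
    intro n x
    by_cases hx : x ∈ K
    · rw [indicator_of_mem hx]
      gcongr
      rw [enorm_le_coe]
      rw [← NNReal.coe_le_coe, coe_nnnorm]
      refine (norm_symGrad_le _).trans ?_
      push_cast
      exact mul_le_mul_of_nonneg_left
        (norm_fderiv_le_of_lipschitz ℝ (lipschitzWith_mollify n hw)) zero_le_two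
    · have h0 : fderiv ℝ (mollify n w) x = 0 := by
        by_contra h
        exact hx (hsupp n (support_fderiv_subset ℝ h))
      rw [h0, symGrad_zero, enorm_grad_zero]
      simp
  have h1 : Tendsto (fun n => ∫⁻ x, ‖symGrad (fderiv ℝ (mollify n w) x)‖ₑ ^ 2) atTop
      (𝓝 (∫⁻ x, ‖symGrad (fderiv ℝ w x)‖ₑ ^ 2)) := by
    refine tendsto_lintegral_of_dominated_convergence _ hsmeas
      (fun n => ae_of_all _ (hbound n)) ?_ ?_
    · rw [lintegral_indicator hKc.measurableSet, lintegral_const]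
      exact ENNReal.mul_ne_top (ENNReal.pow_ne_top ENNReal.coe_ne_top) (by simpa using hKc.measure_lt_top.ne)
    · filter_upwards [hlim] with x hx
      exact ((ENNReal.continuous_pow 2).tendsto _).comp
        (((continuous_symGrad.tendsto _).comp hx).enorm)
  have h2 : ∫⁻ x, ‖fderiv ℝ w x‖ₑ ^ 2 ≤
      liminf (fun n => ∫⁻ x, ‖fderiv ℝ (mollify n w) x‖ₑ ^ 2) atTop := by
    refine le_trans (lintegral_mono_ae ?_) (lintegral_liminf_le hmeas)
    filter_upwards [hlim] with x hx
    exact (((ENNReal.continuous_pow 2).tendsto _).comp hx.enorm).liminf_eq.ge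
  refine h2.trans ?_
  refine le_trans (liminf_le_liminf (Eventually.of_forall fun n =>
    lintegral_sq_enorm_fderiv_le_of_contDiff (hsm n) (hcs n))) ?_
  exact (ENNReal.Tendsto.const_mul h1 (Or.inr (ENNReal.natCast_ne_top _))).liminf_eq.le

/-- Change of variables in lower integrals under linear isomorphisms. -/
theorem exists_lintegral_comp_affine {V : Type*} [NormedAddCommGroup V] [InnerProductSpace ℝ V]
    [FiniteDimensional ℝ V] [MeasurableSpace V] [BorelSpace V] (L : V ≃L[ℝ] V) (y : V) :
    ∃ c : ℝ≥0∞, c ≠ 0 ∧ c ≠ ⊤ ∧ ∀ (S : Set V) (f : V → ℝ≥0∞),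
      ∫⁻ x in (fun x => y + L x) ⁻¹' S, f (y + L x) = c * ∫⁻ x in S, f x := by
  have hdet : LinearMap.det (L : V →ₗ[ℝ] V) ≠ 0 := (LinearEquiv.isUnit_det' L.toLinearEquiv).ne_zero
  set c := ENNReal.ofReal |(LinearMap.det (L : V →ₗ[ℝ] V))⁻¹| with hc
  set e : V ≃ᵐ V := (L.toHomeomorph.trans (Homeomorph.addLeft y)).toMeasurableEquiv with he
  have hmap : Measure.map e volume = c • (volume : Measure V) := by
    have h1 : Measure.map (L : V → V) volume = c • (volume : Measure V) :=
      Measure.map_linearMap_addHaar_eq_smul_addHaar volume hdet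
    have h2 : (e : V → V) = (fun x => y + x) ∘ L := rfl
    rw [h2, ← Measure.map_map (measurable_const_add y) L.continuous.measurable, h1,
      Measure.map_smul, (measurePreserving_add_left volume y).map_eq]
  refine ⟨c, ?_, ENNReal.ofReal_ne_top, fun S f => ?_⟩
  · rw [hc, Ne, ENNReal.ofReal_eq_zero, not_le]
    positivity
  · have h3 : (volume.restrict (e ⁻¹' S)).map e = (volume.map e).restrict S :=
      (e.restrict_map volume S).symm
    calc ∫⁻ x in (fun x => y + L x) ⁻¹' S, f (y + L x)
        = ∫⁻ x in e ⁻¹' S, f (e x) := rfl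
      _ = ∫⁻ x, f x ∂((volume.restrict (e ⁻¹' S)).map e) := (lintegral_map_equiv f e).symm
      _ = c * ∫⁻ x in S, f x := by
          rw [h3, hmap, Measure.restrict_smul, lintegral_smul_measure, smul_eq_mul]

/-! ### The reflection operator -/

/-- The points with positive coordinates in `A`. -/
def orthant (A : Finset (Fin d)) : Set (Vec d) := {x | ∀ i ∈ A, 0 < x i}

theorem isOpen_orthant (A : Finset (Fin d)) : IsOpen (orthant A) := by
  have : orthant A = ⋂ i ∈ A, {x : Vec d | 0 < x i} := by
    ext x
    simp [orthant]
  rw [this]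
  exact isOpen_biInter_finset fun i _ =>
    isOpen_lt continuous_const (EuclideanSpace.proj (𝕜 := ℝ) i).continuous

/-- The linear map that multiplies the coordinate `k` by `t`. -/
def scaleCoord (k : Fin d) (t : ℝ) : Grad d :=
  ContinuousLinearMap.id ℝ (Vec d) +
    (t - 1) • (EuclideanSpace.proj (𝕜 := ℝ) k).smulRight (EuclideanSpace.single k (1 : ℝ))

theorem scaleCoord_apply (k : Fin d) (t : ℝ) (x : Vec d) :
    scaleCoord k t x = x + ((t - 1) * x k) • EuclideanSpace.single k (1 : ℝ) := by
  simp [scaleCoord, mul_smul]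

theorem scaleCoord_apply_apply (k : Fin d) (t : ℝ) (x : Vec d) (i : Fin d) :
    scaleCoord k t x i = if i = k then t * x k else x i := by
  rw [scaleCoord_apply]
  by_cases h : i = k
  · subst h
    simp
    ring
  · simp [h]

/-- Symmetry of the scaling makes each term of `extendCoord` a transported field of the form
Lᵀw(L·). -/
theorem adjoint_scaleCoord (k : Fin d) (t : ℝ) :
    ContinuousLinearMap.adjoint (scaleCoord k t) = scaleCoord k t := by
  symm
  rw [ContinuousLinearMap.eq_adjoint_iff]
  intro x y
  rw [scaleCoord_apply, scaleCoord_apply, inner_add_left, inner_add_right, real_inner_smul_left,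
    real_inner_smul_right, EuclideanSpace.inner_single_left, EuclideanSpace.inner_single_right]
  simp
  ring

/-- Scaling of a coordinate by a nonzero factor, as an isomorphism. -/
def scaleCoordEquiv (k : Fin d) {t : ℝ} (ht : t ≠ 0) : Vec d ≃L[ℝ] Vec d :=
  ContinuousLinearEquiv.equivOfInverse (scaleCoord k t) (scaleCoord k t⁻¹)
    (fun x => by
      ext i
      simp only [scaleCoord_apply_apply]
      split_ifs with h
      · simp [ht, h]
      · rfl)
    (fun x => by
      ext i
      simp only [scaleCoord_apply_apply]
      split_ifs with h
      · simp [ht, h]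
      · rfl)

/-- The reflection of the negative half space with stretching factor `s`; the identity on the
positive half space. -/
def foldCoord (k : Fin d) (s : ℝ) (x : Vec d) : Vec d :=
  x + (max (x k) (-s * x k) - x k) • EuclideanSpace.single k (1 : ℝ)

theorem foldCoord_of_nonneg {k : Fin d} {s : ℝ} (hs : 0 ≤ s) {x : Vec d} (hx : 0 ≤ x k) :
    foldCoord k s x = x := by
  rw [foldCoord, max_eq_left (by nlinarith), sub_self, zero_smul, add_zero]

theorem foldCoord_of_nonpos {k : Fin d} {s : ℝ} (hs : 0 ≤ s) {x : Vec d} (hx : x k ≤ 0) :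
    foldCoord k s x = scaleCoord k (-s) x := by
  rw [foldCoord, max_eq_right (by nlinarith), scaleCoord_apply]
  congr 2
  ring

theorem exists_lipschitzWith_foldCoord (k : Fin d) (s : ℝ) :
    ∃ L, LipschitzWith L (foldCoord k s) := by
  have h1 : LipschitzWith _ fun x : Vec d => x k := (EuclideanSpace.proj (𝕜 := ℝ) k).lipschitz
  have h2 : LipschitzWith _ fun x : Vec d => -s * x k :=
    ((-s) • EuclideanSpace.proj (𝕜 := ℝ) k).lipschitz
  have h3 := (h1.max h2).sub h1
  have h4 := ((1 : ℝ →L[ℝ] ℝ).smulRight (EuclideanSpace.single k (1 : ℝ))).lipschitz.comp h3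
  exact ⟨_, LipschitzWith.id.add h4⟩

/-- Extension of a field from `{x k > 0}` across the hyperplane, such that the strain of the
extension is controlled by the strain of the field. -/
def extendCoord (k : Fin d) (w : Vec d → Vec d) (x : Vec d) : Vec d :=
  -- The weights solve 3 - 2 = 1 for the tangential components and 3·(-1) - 2·(-2) = 1 for the
  -- normal one. So the field is unchanged for x k ≥ 0 and the two sides match on the hyperplane. A
  -- single reflection could not satisfy both equations.
  (3 : ℝ) • scaleCoord k (-1) (w (foldCoord k 1 x)) -
    (2 : ℝ) • scaleCoord k (-2) (w (foldCoord k 2 x))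

theorem extendCoord_of_nonneg {k : Fin d} (w : Vec d → Vec d) {x : Vec d} (hx : 0 ≤ x k) :
    extendCoord k w x = w x := by
  rw [extendCoord, foldCoord_of_nonneg (by norm_num) hx, foldCoord_of_nonneg (by norm_num) hx]
  ext i
  simp only [PiLp.sub_apply, PiLp.smul_apply, scaleCoord_apply_apply, smul_eq_mul]
  split_ifs with h
  · subst h
    ring
  · ring

theorem extendCoord_of_nonpos {k : Fin d} (w : Vec d → Vec d) {x : Vec d} (hx : x k ≤ 0) :
    extendCoord k w x = (3 : ℝ) • scaleCoord k (-1) (w (scaleCoord k (-1) x)) -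
      (2 : ℝ) • scaleCoord k (-2) (w (scaleCoord k (-2) x)) := by
  rw [extendCoord, foldCoord_of_nonpos (by norm_num) hx, foldCoord_of_nonpos (by norm_num) hx]

theorem exists_lipschitzWith_extendCoord (k : Fin d) {w : Vec d → Vec d} {L : ℝ≥0}
    (hw : LipschitzWith L w) : ∃ L', LipschitzWith L' (extendCoord k w) := by
  obtain ⟨L1, h1⟩ := exists_lipschitzWith_foldCoord k 1
  obtain ⟨L2, h2⟩ := exists_lipschitzWith_foldCoord k 2
  exact ⟨_, (((3 : ℝ) • scaleCoord k (-1)).lipschitz.comp (hw.comp h1)).sub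
    (((2 : ℝ) • scaleCoord k (-2)).lipschitz.comp (hw.comp h2))⟩

theorem hasCompactSupport_extendCoord (k : Fin d) {w : Vec d → Vec d}
    (hw : HasCompactSupport w) : HasCompactSupport (extendCoord k w) := by
  set K := tsupport w with hK
  have hKc : IsCompact K := hw.isCompact
  have hc : IsCompact (K ∪ (scaleCoord k (-1)⁻¹ '' K ∪ scaleCoord k (-2)⁻¹ '' K)) :=
    hKc.union ((hKc.image (scaleCoord k _).continuous).union
      (hKc.image (scaleCoord k _).continuous))
  refine HasCompactSupport.of_support_subset_isCompact hc fun x hx => ?_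
  rcases le_total 0 (x k) with h | h
  · rw [Function.mem_support, extendCoord_of_nonneg w h] at hx
    exact Or.inl (subset_tsupport w hx)
  · right
    rw [Function.mem_support, extendCoord_of_nonpos w h] at hx
    have hinv : ∀ t : ℝ, t ≠ 0 → scaleCoord k t⁻¹ (scaleCoord k t x) = x := fun t ht =>
      (scaleCoordEquiv k ht).symm_apply_apply x
    by_cases h1 : w (scaleCoord k (-1) x) = 0
    · by_cases h2 : w (scaleCoord k (-2) x) = 0
      · simp [h1, h2] at hx
      · exact Or.inr ⟨_, subset_tsupport w h2, hinv _ (by norm_num)⟩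
    · exact Or.inl ⟨_, subset_tsupport w h1, hinv _ (by norm_num)⟩

end CEM

end

/-! ## Korn's inequality on orthants -/

noncomputable section

namespace CEM

open Filter Topology
open scoped ENNReal

variable {d : ℕ}

theorem enorm_symGrad_conj_le (L A : Grad d) :
    ‖symGrad ((ContinuousLinearMap.adjoint L).comp (A.comp L))‖ₑ ≤
      ‖L‖ₑ ^ 2 * ‖symGrad A‖ₑ := by
  have h : ‖symGrad ((ContinuousLinearMap.adjoint L).comp (A.comp L))‖ ≤ ‖L‖ ^ 2 * ‖symGrad A‖ := by
    rw [symGrad_conj]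
    refine (ContinuousLinearMap.opNorm_comp_le _ _).trans ?_
    rw [LinearIsometryEquiv.norm_map]
    calc ‖L‖ * ‖(symGrad A).comp L‖ ≤ ‖L‖ * (‖symGrad A‖ * ‖L‖) :=
          mul_le_mul_of_nonneg_left (ContinuousLinearMap.opNorm_comp_le _ _) (norm_nonneg _)
      _ = _ := by ring
  rw [← ofReal_norm, ← ofReal_norm, ← ofReal_norm, ← ENNReal.ofReal_pow (norm_nonneg _),
    ← ENNReal.ofReal_mul (by positivity)]
  exact ENNReal.ofReal_le_ofReal h

theorem enorm_symGrad_comb_le (A B : Grad d) (s t : ℝ) :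
    ‖symGrad (s • A - t • B)‖ₑ ≤ ‖s‖ₑ * ‖symGrad A‖ₑ + ‖t‖ₑ * ‖symGrad B‖ₑ := by
  have h : ‖symGrad (s • A - t • B)‖ ≤ ‖s‖ * ‖symGrad A‖ + ‖t‖ * ‖symGrad B‖ := by
    have e : s • A - t • B = s • A + (-t) • B := by
      ext v i
      simp
      ring
    rw [e, symGrad_add, symGrad_smul, symGrad_smul]
    refine (norm_add_le _ _).trans ?_
    rw [norm_smul, norm_smul, norm_neg]
  rw [← ofReal_norm, ← ofReal_norm, ← ofReal_norm, ← ofReal_norm, ← ofReal_norm,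
    ← ENNReal.ofReal_mul (norm_nonneg _), ← ENNReal.ofReal_mul (norm_nonneg _),
    ← ENNReal.ofReal_add (by positivity) (by positivity)]
  exact ENNReal.ofReal_le_ofReal h

/-- Korn's first inequality on the region `O`, for Lipschitz fields with bounded support. -/
def HasKorn (O : Set (Vec d)) : Prop :=
  ∃ C : ℝ≥0∞, C ≠ ⊤ ∧ ∀ (w : Vec d → Vec d) (L : ℝ≥0), LipschitzWith L w → HasCompactSupport w →
    ∫⁻ x in O, ‖fderiv ℝ w x‖ₑ ^ 2 ≤ C * ∫⁻ x in O, ‖symGrad (fderiv ℝ w x)‖ₑ ^ 2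

theorem hasFDerivAt_scaleCoord_comp {k : Fin d} {t : ℝ} {w : Vec d → Vec d} {x : Vec d}
    (hw : DifferentiableAt ℝ w (scaleCoord k t x)) :
    HasFDerivAt (fun y => scaleCoord k t (w (scaleCoord k t y)))
      ((ContinuousLinearMap.adjoint (scaleCoord k t)).comp
        ((fderiv ℝ w (scaleCoord k t x)).comp (scaleCoord k t))) x := by
  rw [adjoint_scaleCoord]
  exact (scaleCoord k t).hasFDerivAt.comp x
    (hw.hasFDerivAt.comp x (scaleCoord k t).hasFDerivAt)

/-- Beyond the hyperplane the extension combines two transported fields, so its strain involves the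
strain of w at the two reflected points and no other part of the gradient. -/
theorem enorm_symGrad_fderiv_extendCoord_le {k : Fin d} {w : Vec d → Vec d} {x : Vec d}
    (hx : x k < 0) (h1 : DifferentiableAt ℝ w (scaleCoord k (-1) x))
    (h2 : DifferentiableAt ℝ w (scaleCoord k (-2) x)) :
    ‖symGrad (fderiv ℝ (extendCoord k w) x)‖ₑ ≤
      3 * ‖scaleCoord k (-1)‖ₑ ^ 2 * ‖symGrad (fderiv ℝ w (scaleCoord k (-1) x))‖ₑ +
      2 * ‖scaleCoord k (-2)‖ₑ ^ 2 * ‖symGrad (fderiv ℝ w (scaleCoord k (-2) x))‖ₑ := by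
  have hev : extendCoord k w =ᶠ[𝓝 x] fun x =>
      (3 : ℝ) • scaleCoord k (-1) (w (scaleCoord k (-1) x)) -
      (2 : ℝ) • scaleCoord k (-2) (w (scaleCoord k (-2) x)) := by
    have : {y : Vec d | y k < 0} ∈ 𝓝 x :=
      (isOpen_lt (EuclideanSpace.proj (𝕜 := ℝ) k).continuous continuous_const).mem_nhds hx
    filter_upwards [this] with y hy
    exact extendCoord_of_nonpos w (le_of_lt hy)
  have hD : HasFDerivAt (fun x => (3 : ℝ) • scaleCoord k (-1) (w (scaleCoord k (-1) x)) -
      (2 : ℝ) • scaleCoord k (-2) (w (scaleCoord k (-2) x))) _ x :=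
    ((hasFDerivAt_scaleCoord_comp h1).const_smul (3 : ℝ)).sub
      ((hasFDerivAt_scaleCoord_comp h2).const_smul (2 : ℝ))
  rw [hev.fderiv_eq, hD.fderiv]
  refine (enorm_symGrad_comb_le _ _ _ _).trans ?_
  have e3 : ‖(3 : ℝ)‖ₑ = 3 := by rw [Real.enorm_eq_ofReal (by norm_num)]; norm_num
  have e2 : ‖(2 : ℝ)‖ₑ = 2 := by rw [Real.enorm_eq_ofReal (by norm_num)]; norm_num
  rw [e3, e2, mul_assoc 3, mul_assoc 2]
  gcongr
  · exact enorm_symGrad_conj_le _ _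
  · exact enorm_symGrad_conj_le _ _

/-- Invertible linear maps preserve null sets; this makes w differentiable at the reflected points
of almost every x. -/
theorem ae_comp_scaleCoord {k : Fin d} {t : ℝ} (ht : t ≠ 0) {p : Vec d → Prop}
    (hp : ∀ᵐ x, p x) : ∀ᵐ x, p (scaleCoord k t x) := by
  obtain ⟨c, hc0, hc, h⟩ := exists_lintegral_comp_affine (scaleCoordEquiv k ht) 0
  rw [ae_iff] at hp ⊢
  have h1 := h {x | ¬ p x} 1
  simp only [Pi.one_apply, lintegral_one, Measure.restrict_apply_univ, hp, mul_zero] at h1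
  convert h1 using 2
  ext x
  simp [scaleCoordEquiv]

theorem volume_coord_eq_zero (k : Fin d) : volume {x : Vec d | x k = 0} = 0 := by
  have h := Measure.addHaar_submodule (volume : Measure (Vec d))
    (LinearMap.ker (EuclideanSpace.proj (𝕜 := ℝ) k : Vec d →L[ℝ] ℝ).toLinearMap) ?_
  · exact h
  · intro h
    have : EuclideanSpace.single k (1 : ℝ) ∈
        LinearMap.ker (EuclideanSpace.proj (𝕜 := ℝ) k : Vec d →L[ℝ] ℝ).toLinearMap := by
      rw [h]
      trivial
    simp at this

/-- Korn on the larger orthant is applied to the extension of w across the face x k = 0. The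
extension keeps the gradient on the smaller orthant, and its strain on the other half is brought
back by a change of variables. -/
theorem hasKorn_insert {A : Finset (Fin d)} (h : HasKorn (orthant A)) {k : Fin d} (hk : k ∉ A) :
    HasKorn (orthant (insert k A)) := by
  classical
  obtain ⟨C, hC, hA⟩ := h
  have n1 : (-1 : ℝ) ≠ 0 := by norm_num
  have n2 : (-2 : ℝ) ≠ 0 := by norm_num
  obtain ⟨c1, -, hc1, hcv1⟩ := exists_lintegral_comp_affine (scaleCoordEquiv k n1) 0
  obtain ⟨c2, -, hc2, hcv2⟩ := exists_lintegral_comp_affine (scaleCoordEquiv k n2) 0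
  set O := orthant (insert k A) with hO
  set O' : Set (Vec d) := {x | x ∈ orthant A ∧ x k < 0} with hO'
  have hOA : O ⊆ orthant A := fun x hx i hi => hx i (Finset.mem_insert_of_mem hi)
  have hOk : ∀ x ∈ O, 0 < x k := fun x hx => hx k (Finset.mem_insert_self k A)
  -- Both reflections, with any stretching factor, map the mirror region O' onto O because O is a
  -- cone.
  have hpre : ∀ s : ℝ, 0 < s → ∀ x, x ∈ O' ↔ scaleCoord k (-s) x ∈ O := by
    intro s hs x
    have hne : ∀ i ∈ A, i ≠ k := fun i hi h => hk (h ▸ hi)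
    constructor
    · rintro ⟨h1, h2⟩ i hi
      rw [scaleCoord_apply_apply]
      split_ifs with hik
      · nlinarith
      · exact h1 i ((Finset.mem_insert.1 hi).resolve_left hik)
    · intro hx
      refine ⟨fun i hi => ?_, ?_⟩
      · have := hx i (Finset.mem_insert_of_mem hi)
        rwa [scaleCoord_apply_apply, if_neg (hne i hi)] at this
      · have := hOk _ hx
        rw [scaleCoord_apply_apply, if_pos rfl] at this
        nlinarith
  set a1 : ℝ≥0∞ := 3 * ‖scaleCoord k (-1)‖ₑ ^ 2 with ha1
  set a2 : ℝ≥0∞ := 2 * ‖scaleCoord k (-2)‖ₑ ^ 2 with ha2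
  have ha1' : a1 ≠ ⊤ := ENNReal.mul_ne_top (by norm_num) (ENNReal.pow_ne_top enorm_ne_top)
  have ha2' : a2 ≠ ⊤ := ENNReal.mul_ne_top (by norm_num) (ENNReal.pow_ne_top enorm_ne_top)
  refine ⟨C * (1 + 2 * (a1 ^ 2 * c1 + a2 ^ 2 * c2)), ?_, fun w L hw hwc => ?_⟩
  · refine ENNReal.mul_ne_top hC (ENNReal.add_ne_top.2 ⟨by norm_num, ENNReal.mul_ne_top (by norm_num)
      (ENNReal.add_ne_top.2 ⟨ENNReal.mul_ne_top (ENNReal.pow_ne_top ha1') hc1,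
        ENNReal.mul_ne_top (ENNReal.pow_ne_top ha2') hc2⟩)⟩)
  obtain ⟨L', hL'⟩ := exists_lipschitzWith_extendCoord k hw
  have hE := hA (extendCoord k w) L' hL' (hasCompactSupport_extendCoord k hwc)
  have hfd : ∀ x ∈ O, fderiv ℝ (extendCoord k w) x = fderiv ℝ w x := by
    intro x hx
    apply Filter.EventuallyEq.fderiv_eq
    filter_upwards [(isOpen_orthant (insert k A)).mem_nhds hx] with y hy
    exact extendCoord_of_nonneg w (hOk y hy).le
  have hOm : MeasurableSet O := (isOpen_orthant _).measurableSet
  have hO'm : MeasurableSet O' := ((isOpen_orthant A).inter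
    (isOpen_lt (EuclideanSpace.proj (𝕜 := ℝ) k).continuous continuous_const)).measurableSet
  have hlhs : ∫⁻ x in O, ‖fderiv ℝ w x‖ₑ ^ 2 ≤
      ∫⁻ x in orthant A, ‖fderiv ℝ (extendCoord k w) x‖ₑ ^ 2 := by
    refine le_trans (le_of_eq ?_) (lintegral_mono_set hOA)
    exact setLIntegral_congr_fun hOm fun x hx => by simp only [hfd x hx]
  refine hlhs.trans (hE.trans ?_)
  rw [mul_assoc]
  gcongr
  set g : Vec d → ℝ≥0∞ := fun x => ‖symGrad (fderiv ℝ w x)‖ₑ ^ 2 with hg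
  have hcover : orthant A ⊆ (O ∪ O') ∪ {x | x k = 0} := by
    intro x hx
    rcases lt_trichotomy (x k) 0 with h | h | h
    · exact Or.inl (Or.inr ⟨hx, h⟩)
    · exact Or.inr h
    · refine Or.inl (Or.inl fun i hi => ?_)
      rcases Finset.mem_insert.1 hi with rfl | hi
      · exact h
      · exact hx i hi
  have hO1 : ∫⁻ x in O, ‖symGrad (fderiv ℝ (extendCoord k w) x)‖ₑ ^ 2 = ∫⁻ x in O, g x :=
    setLIntegral_congr_fun hOm fun x hx => by simp only [hfd x hx, hg]
  have hcv : ∀ s : ℝ, 0 < s → ∀ (hs : -s ≠ 0) (c : ℝ≥0∞), (∀ (S : Set (Vec d)) (f : Vec d → ℝ≥0∞),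
      ∫⁻ x in (fun x => 0 + scaleCoordEquiv k hs x) ⁻¹' S, f (0 + scaleCoordEquiv k hs x) =
        c * ∫⁻ x in S, f x) → ∫⁻ x in O', g (scaleCoord k (-s) x) = c * ∫⁻ x in O, g x := by
    intro s hs hs' c hc
    rw [← hc O g]
    have e : ∀ x, 0 + scaleCoordEquiv k hs' x = scaleCoord k (-s) x := fun x => zero_add _
    simp only [e]
    congr 2
    ext x
    exact hpre s hs x
  have hO2 : ∫⁻ x in O', ‖symGrad (fderiv ℝ (extendCoord k w) x)‖ₑ ^ 2 ≤
      2 * (a1 ^ 2 * c1 + a2 ^ 2 * c2) * ∫⁻ x in O, g x := by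
    have hmeas : ∀ s : ℝ, Measurable fun x => g (scaleCoord k s x) := by
      intro s
      have hm : Measurable g :=
        ((continuous_symGrad.measurable.comp (measurable_fderiv ℝ w)).enorm).pow_const 2
      exact hm.comp (scaleCoord k s).continuous.measurable
    calc ∫⁻ x in O', ‖symGrad (fderiv ℝ (extendCoord k w) x)‖ₑ ^ 2
        ≤ ∫⁻ x in O', 2 * (a1 ^ 2 * g (scaleCoord k (-1) x) +
            a2 ^ 2 * g (scaleCoord k (-2) x)) := by
          refine lintegral_mono_ae ?_
          filter_upwards [ae_restrict_mem hO'm,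
            ae_restrict_of_ae (ae_comp_scaleCoord (k := k) n1 hw.ae_differentiableAt),
            ae_restrict_of_ae (ae_comp_scaleCoord (k := k) n2 hw.ae_differentiableAt)]
            with x hx h1 h2
          refine (pow_le_pow_left₀ zero_le
            (enorm_symGrad_fderiv_extendCoord_le hx.2 h1 h2) 2).trans ?_
          refine (ennreal_add_sq_le _ _).trans (le_of_eq ?_)
          rw [mul_pow a1, mul_pow a2]
      _ = 2 * (a1 ^ 2 * (c1 * ∫⁻ x in O, g x) + a2 ^ 2 * (c2 * ∫⁻ x in O, g x)) := by
          have hm : Measurable fun x => a1 ^ 2 * g (scaleCoord k (-1) x) +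
              a2 ^ 2 * g (scaleCoord k (-2) x) :=
            ((hmeas _).const_mul _).add ((hmeas _).const_mul _)
          rw [lintegral_const_mul _ hm,
            lintegral_add_left ((hmeas _).const_mul _), lintegral_const_mul _ (hmeas _),
            lintegral_const_mul _ (hmeas _), hcv 1 one_pos n1 c1 hcv1, hcv 2 two_pos n2 c2 hcv2]
      _ = _ := by ring
  calc ∫⁻ x in orthant A, ‖symGrad (fderiv ℝ (extendCoord k w) x)‖ₑ ^ 2
      ≤ ∫⁻ x in (O ∪ O') ∪ {x | x k = 0}, ‖symGrad (fderiv ℝ (extendCoord k w) x)‖ₑ ^ 2 :=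
        lintegral_mono_set hcover
    _ ≤ ((∫⁻ x in O, ‖symGrad (fderiv ℝ (extendCoord k w) x)‖ₑ ^ 2) +
          ∫⁻ x in O', ‖symGrad (fderiv ℝ (extendCoord k w) x)‖ₑ ^ 2) +
          ∫⁻ x in {x : Vec d | x k = 0}, ‖symGrad (fderiv ℝ (extendCoord k w) x)‖ₑ ^ 2 :=
        (lintegral_union_le _ _ _).trans (add_le_add (lintegral_union_le _ _ _) le_rfl)
    _ ≤ (∫⁻ x in O, g x) + 2 * (a1 ^ 2 * c1 + a2 ^ 2 * c2) * ∫⁻ x in O, g x := by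
        rw [setLIntegral_measure_zero _ _ (volume_coord_eq_zero k), add_zero, hO1]
        gcongr
    _ = _ := by ring

/-- Induction on the number of half-space conditions, starting from the whole space. -/
theorem hasKorn_orthant (A : Finset (Fin d)) : HasKorn (orthant A) := by
  classical
  induction A using Finset.induction_on with
  | empty =>
    refine ⟨(2 * d * d : ℕ), ENNReal.natCast_ne_top _, fun w L hw hwc => ?_⟩
    have : orthant (∅ : Finset (Fin d)) = univ := by
      ext x
      simp [orthant]
    rw [this, Measure.restrict_univ]
    exact lintegral_sq_enorm_fderiv_le hw hwc
  | insert k A hk ih => exact hasKorn_insert ih hk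

end CEM

end

/-! ## Korn's inequality near the vertices of simplices -/

noncomputable section

namespace CEM

open Filter Topology
open scoped ENNReal

variable {d : ℕ}

theorem enorm_sq_eq_ofReal {E : Type*} [SeminormedAddCommGroup E] (a : E) :
    ‖a‖ₑ ^ 2 = ENNReal.ofReal (‖a‖ ^ 2) := by
  rw [← ofReal_norm, ENNReal.ofReal_pow (norm_nonneg _)]

theorem enorm_sq_le_of_norm_le {E F G : Type*} [SeminormedAddCommGroup E]
    [SeminormedAddCommGroup F] [SeminormedAddCommGroup G] {a : E} {b : F} {c : G} {α β : ℝ}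
    (h : ‖a‖ ≤ α * ‖b‖ + β * ‖c‖) :
    ‖a‖ₑ ^ 2 ≤ ENNReal.ofReal (α ^ 2 + β ^ 2) * (‖b‖ₑ ^ 2 + ‖c‖ₑ ^ 2) := by
  rw [enorm_sq_eq_ofReal, enorm_sq_eq_ofReal, enorm_sq_eq_ofReal,
    ← ENNReal.ofReal_add (by positivity) (by positivity), ← ENNReal.ofReal_mul (by positivity)]
  refine ENNReal.ofReal_le_ofReal ((pow_le_pow_left₀ (norm_nonneg _) h 2).trans ?_)
  nlinarith [sq_nonneg (α * ‖c‖ - β * ‖b‖)]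

theorem norm_symGrad_conj_le (L A : Grad d) :
    ‖symGrad ((ContinuousLinearMap.adjoint L).comp (A.comp L))‖ ≤ ‖L‖ ^ 2 * ‖symGrad A‖ := by
  rw [symGrad_conj]
  refine (ContinuousLinearMap.opNorm_comp_le _ _).trans ?_
  rw [LinearIsometryEquiv.norm_map]
  calc ‖L‖ * ‖(symGrad A).comp L‖ ≤ ‖L‖ * (‖symGrad A‖ * ‖L‖) :=
        mul_le_mul_of_nonneg_left (ContinuousLinearMap.opNorm_comp_le _ _) (norm_nonneg _)
    _ = _ := by ring

theorem norm_adjoint_comp_comp_le (L A : Grad d) :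
    ‖(ContinuousLinearMap.adjoint L).comp (A.comp L)‖ ≤ ‖L‖ ^ 2 * ‖A‖ := by
  refine (ContinuousLinearMap.opNorm_comp_le _ _).trans ?_
  rw [LinearIsometryEquiv.norm_map]
  calc ‖L‖ * ‖A.comp L‖ ≤ ‖L‖ * (‖A‖ * ‖L‖) :=
        mul_le_mul_of_nonneg_left (ContinuousLinearMap.opNorm_comp_le _ _) (norm_nonneg _)
    _ = _ := by ring

/-- Korn's second inequality near a corner of the region `K`. -/
theorem exists_korn_corner (L : Vec d ≃L[ℝ] Vec d) (y : Vec d) {r R : ℝ} (hr : 0 < r)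
    (hrR : r < R) {K : Set (Vec d)}
    (hKm : MeasurableSet K) (hK : ∀ s ∈ orthant (Finset.univ : Finset (Fin d)), ‖s‖ ≤ R → y + L s ∈ K) :
    ∃ C : ℝ≥0∞, C ≠ ⊤ ∧ ∀ w : Vec d → Vec d, ContDiff ℝ ∞ w → HasCompactSupport w →
      ∫⁻ x in (fun s => y + L s) '' (orthant Finset.univ ∩ Metric.ball 0 r),
        ‖fderiv ℝ w x‖ₑ ^ 2 ≤
      C * ∫⁻ x in K, (‖symGrad (fderiv ℝ w x)‖ₑ ^ 2 + ‖w x‖ₑ ^ 2) := by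
  set O := orthant (Finset.univ : Finset (Fin d)) with hO
  have hOm : MeasurableSet O := (isOpen_orthant _).measurableSet
  obtain ⟨c, hc0, hc, hcv⟩ := exists_lintegral_comp_affine L y
  obtain ⟨C, hC, hkorn⟩ := hasKorn_orthant (d := d) Finset.univ
  let ζ : ContDiffBump (0 : Vec d) := ⟨r, R, hr, hrR⟩
  have hζ : ContDiff ℝ ∞ ζ := ζ.contDiff
  obtain ⟨b, hb⟩ := hζ.lipschitzWith_of_hasCompactSupport ζ.hasCompactSupport (by simp)
  set L₁ : Grad d := (L : Vec d →L[ℝ] Vec d) with hL₁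
  set L₂ : Grad d := (L.symm : Vec d →L[ℝ] Vec d) with hL₂
  have hL12 : L₁.comp L₂ = ContinuousLinearMap.id ℝ _ := by
    ext v i
    simp [hL₁, hL₂]
  have hL21 : (ContinuousLinearMap.adjoint L₂).comp (ContinuousLinearMap.adjoint L₁) =
      ContinuousLinearMap.id ℝ _ := by
    rw [← ContinuousLinearMap.adjoint_comp, hL12]
    exact ContinuousLinearMap.adjoint_id
  set α := ‖L₁‖ ^ 2
  set β := 2 * b * ‖L₁‖
  refine ⟨c⁻¹ * (ENNReal.ofReal ((‖L₂‖ ^ 2) ^ 2 + 0 ^ 2) * (C * (ENNReal.ofReal (α ^ 2 + β ^ 2) * c))),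
    ?_, fun w hw hwc => ?_⟩
  · exact ENNReal.mul_ne_top (ENNReal.inv_ne_top.2 hc0) (ENNReal.mul_ne_top ENNReal.ofReal_ne_top
      (ENNReal.mul_ne_top hC (ENNReal.mul_ne_top ENNReal.ofReal_ne_top hc)))
  -- The field is pulled back to the orthant in the form that respects strains, then multiplied by a
  -- bump. The derivative of the bump produces the zeroth-order term of Korn's second inequality.
  set v : Vec d → Vec d := fun s => ContinuousLinearMap.adjoint L₁ (w (y + L s)) with hv
  have hvc : ContDiff ℝ ∞ v := (ContinuousLinearMap.adjoint L₁).contDiff.comp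
    (hw.comp (contDiff_const.add L.contDiff))
  have hvd : ∀ s, fderiv ℝ v s =
      (ContinuousLinearMap.adjoint L₁).comp ((fderiv ℝ w (y + L s)).comp L₁) := by
    intro s
    have h1 : HasFDerivAt (fun s => y + L s) L₁ s := L₁.hasFDerivAt.const_add y
    have h2 : HasFDerivAt w (fderiv ℝ w (y + L s)) (y + L s) :=
      (hw.differentiable (by simp) _).hasFDerivAt
    exact ((ContinuousLinearMap.adjoint L₁).hasFDerivAt.comp s (h2.comp s h1)).fderiv
  set z : Vec d → Vec d := fun s => ζ s • v s with hz
  have hzc : ContDiff ℝ ∞ z := hζ.smul hvc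
  have hzs : HasCompactSupport z := ζ.hasCompactSupport.smul_right
  have hzd : ∀ s, fderiv ℝ z s = ζ s • fderiv ℝ v s + (fderiv ℝ ζ s).smulRight (v s) := fun s =>
    fderiv_fun_smul (hζ.differentiable (by simp) s) (hvc.differentiable (by simp) s)
  obtain ⟨b', hb'⟩ := hzc.lipschitzWith_of_hasCompactSupport hzs (by simp)
  have key := hkorn z b' hb' hzs
  have hup : ∫⁻ s in O, ‖symGrad (fderiv ℝ z s)‖ₑ ^ 2 ≤ ENNReal.ofReal (α ^ 2 + β ^ 2) * c *
      ∫⁻ x in K, (‖symGrad (fderiv ℝ w x)‖ₑ ^ 2 + ‖w x‖ₑ ^ 2) := by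
    rw [mul_assoc, ← hcv K, ← lintegral_const_mul' _ _ ENNReal.ofReal_ne_top]
    -- Inside the orthant, points not mapped into K have norm larger than R, hence lie off the
    -- support of the bump.
    have hsub : ∀ s ∈ O, s ∉ (fun s => y + L s) ⁻¹' K → fderiv ℝ z s = 0 := by
      intro s hs hsK
      have : s ∉ tsupport z := by
        intro hsz
        refine hsK (hK s hs ?_)
        have h1 : s ∈ tsupport ζ := by
          refine closure_mono (fun t ht => ?_) hsz
          intro h0
          exact ht (by simp [hz, h0])
        rw [ζ.tsupport_eq] at h1
        simpa [ζ] using h1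
      exact image_eq_zero_of_notMem_tsupport
        (fun h => this (tsupport_fderiv_subset ℝ h))
    have hpm : MeasurableSet ((fun s => y + L s) ⁻¹' K) :=
      (continuous_const.add L.continuous).measurable hKm
    rw [← lintegral_indicator hOm, ← lintegral_indicator hpm]
    refine lintegral_mono fun s => ?_
    by_cases hs : s ∈ O
    · rw [indicator_of_mem hs]
      by_cases hsK : s ∈ (fun s => y + L s) ⁻¹' K
      · rw [indicator_of_mem hsK]
        refine enorm_sq_le_of_norm_le ?_
        rw [hzd s, symGrad_add, symGrad_smul]
        refine (norm_add_le _ _).trans ?_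
        have h1 : ‖ζ s • symGrad (fderiv ℝ v s)‖ ≤ α * ‖symGrad (fderiv ℝ w (y + L s))‖ := by
          rw [norm_smul, Real.norm_of_nonneg ζ.nonneg, hvd s]
          refine (mul_le_of_le_one_left (norm_nonneg _) ζ.le_one).trans ?_
          exact norm_symGrad_conj_le _ _
        have h2 : ‖symGrad ((fderiv ℝ ζ s).smulRight (v s))‖ ≤ β * ‖w (y + L s)‖ := by
          refine (norm_symGrad_le _).trans ?_
          rw [ContinuousLinearMap.norm_smulRight_apply]
          have h3 : ‖v s‖ ≤ ‖L₁‖ * ‖w (y + L s)‖ := by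
            refine ((ContinuousLinearMap.adjoint L₁).le_opNorm _).trans ?_
            rw [LinearIsometryEquiv.norm_map]
          have h4 : ‖fderiv ℝ ζ s‖ ≤ b := norm_fderiv_le_of_lipschitz ℝ hb
          calc 2 * (‖fderiv ℝ ζ s‖ * ‖v s‖) ≤ 2 * (b * (‖L₁‖ * ‖w (y + L s)‖)) := by gcongr
            _ = _ := by ring
        exact add_le_add h1 h2
      · rw [hsub s hs hsK, symGrad_zero, enorm_grad_zero]
        simp
    · rw [indicator_of_notMem hs]
      exact zero_le
  calc ∫⁻ x in (fun s => y + L s) '' (O ∩ Metric.ball 0 r), ‖fderiv ℝ w x‖ₑ ^ 2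
      = c⁻¹ * ∫⁻ s in O ∩ Metric.ball 0 r, ‖fderiv ℝ w (y + L s)‖ₑ ^ 2 := by
        have hinj : Function.Injective fun s => y + L s := fun s t h => L.injective (add_left_cancel h)
        have := hcv ((fun s => y + L s) '' (O ∩ Metric.ball 0 r)) fun x => ‖fderiv ℝ w x‖ₑ ^ 2
        rw [preimage_image_eq _ hinj] at this
        rw [this, ← mul_assoc, ENNReal.inv_mul_cancel hc0 hc, one_mul]
    _ ≤ c⁻¹ * ∫⁻ s in O ∩ Metric.ball 0 r, ENNReal.ofReal ((‖L₂‖ ^ 2) ^ 2 + 0 ^ 2) *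
          ‖fderiv ℝ z s‖ₑ ^ 2 := by
        refine mul_le_mul' le_rfl ?_
        refine setLIntegral_mono' (hOm.inter Metric.isOpen_ball.measurableSet) fun s hs => ?_
        -- The bump equals 1 on the ball of radius r, so there the pull-back can be undone.
        have h1 : fderiv ℝ z s = fderiv ℝ v s := by
          apply Filter.EventuallyEq.fderiv_eq
          filter_upwards [Metric.isOpen_ball.mem_nhds hs.2] with t ht
          rw [hz]
          simp only
          rw [ζ.one_of_mem_closedBall (Metric.ball_subset_closedBall ht), one_smul]
        have h2 : fderiv ℝ w (y + L s) =
            (ContinuousLinearMap.adjoint L₂).comp ((fderiv ℝ v s).comp L₂) := by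
          rw [hvd s, ← ContinuousLinearMap.comp_assoc, ← ContinuousLinearMap.comp_assoc, hL21,
            ContinuousLinearMap.id_comp, ContinuousLinearMap.comp_assoc, hL12,
            ContinuousLinearMap.comp_id]
        have := enorm_sq_le_of_norm_le (a := fderiv ℝ w (y + L s)) (b := fderiv ℝ z s) (c := (0 : ℝ))
          (α := ‖L₂‖ ^ 2) (β := 0) (by
            rw [h1, h2, zero_mul, add_zero]
            exact norm_adjoint_comp_comp_le _ _)
        simpa using this
    _ ≤ c⁻¹ * (ENNReal.ofReal ((‖L₂‖ ^ 2) ^ 2 + 0 ^ 2) * ∫⁻ s in O, ‖fderiv ℝ z s‖ₑ ^ 2) := by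
        rw [lintegral_const_mul' _ _ ENNReal.ofReal_ne_top]
        gcongr
        exact inter_subset_left
    _ ≤ c⁻¹ * (ENNReal.ofReal ((‖L₂‖ ^ 2) ^ 2 + 0 ^ 2) * (C *
          (ENNReal.ofReal (α ^ 2 + β ^ 2) * c *
            ∫⁻ x in K, (‖symGrad (fderiv ℝ w x)‖ₑ ^ 2 + ‖w x‖ₑ ^ 2)))) := by
        gcongr
        exact key.trans (by gcongr)
    _ = _ := by ring

end CEM

end

/-! ## Korn's inequality on polytopes -/

noncomputable section

namespace CEM

open Filter Topology
open scoped ENNReal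

variable {d : ℕ}

/-- The linear parametrization of a simplex from its first vertex. -/
theorem exists_simplex_chart {v : Fin (d + 1) → Vec d} (hv : AffineIndependent ℝ v) :
    ∃ L : Vec d ≃L[ℝ] Vec d, ∀ s : Vec d, L s = ∑ i, s i • (v i.succ - v 0) := by
  have h1 := (affineIndependent_iff_linearIndependent_vsub ℝ v 0).1 hv
  let g : Fin d → {x : Fin (d + 1) // x ≠ 0} := fun i => ⟨i.succ, Fin.succ_ne_zero i⟩
  have hg : Function.Injective g := fun i j h => Fin.succ_injective _ (congrArg Subtype.val h)
  have h2 : LinearIndependent ℝ fun i : Fin d => v i.succ - v 0 := h1.comp g hg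
  let b := Module.Basis.mk h2 (h2.span_eq_top_of_card_eq_finrank' (by simp)).ge
  refine ⟨((WithLp.linearEquiv 2 ℝ (Fin d → ℝ)).trans b.equivFun.symm).toContinuousLinearEquiv,
    fun s => ?_⟩
  simp [b, Module.Basis.equivFun_symm_apply]

/-- Carathéodory's theorem writes x as a positive combination of affinely independent points of s.
Fewer than d + 1 of them would put x in one of finitely many proper affine subspaces, a null set. -/
theorem ae_mem_simplex (s : Finset (Vec d)) : ∀ᵐ x : Vec d, x ∈ convexHull ℝ (s : Set (Vec d)) →
    ∃ (v : Fin (d + 1) → s) (t : Fin (d + 1) → ℝ), AffineIndependent ℝ (fun i => (v i : Vec d)) ∧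
      (∀ i, 0 < t i) ∧ (∀ i, t i ≤ t 0) ∧ ∑ i, t i = 1 ∧ ∑ i, t i • (v i : Vec d) = x := by
  classical
  have hnull : ∀ᵐ x : Vec d, ∀ T ∈ s.powerset, affineSpan ℝ (T : Set (Vec d)) ≠ ⊤ →
      x ∉ affineSpan ℝ (T : Set (Vec d)) := by
    refine (ae_ball_iff s.powerset.countable_toSet).2 fun T _ => ?_
    by_cases hT : affineSpan ℝ (T : Set (Vec d)) = ⊤
    · exact Eventually.of_forall fun x h => absurd hT h
    · have := measure_eq_zero_iff_ae_notMem.1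
        (Measure.addHaar_affineSubspace (volume : Measure (Vec d)) _ hT)
      filter_upwards [this] with x hx _ using hx
  filter_upwards [hnull] with x hx hxs
  obtain ⟨ι, _, z, w, hz, hzi, hw, hw1, hwx⟩ := eq_pos_convex_span_of_mem_convexHull hxs
  have hzx : x ∈ affineSpan ℝ (range z) := by
    rw [← hwx, ← Finset.affineCombination_eq_linear_combination _ _ _ hw1]
    exact affineCombination_mem_affineSpan hw1 z
  have htop : affineSpan ℝ (range z) = ⊤ := by
    by_contra h
    have hc : ((Finset.univ.image z : Finset (Vec d)) : Set (Vec d)) = range z := by simp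
    refine hx (Finset.univ.image z) ?_ ?_ ?_
    · rw [Finset.mem_powerset]
      intro y hy
      have : y ∈ range z := by rw [← hc]; exact_mod_cast hy
      exact_mod_cast hz this
    · rw [hc]
      exact h
    · rw [hc]
      exact hzx
  have hcard : Fintype.card ι = d + 1 := by
    have := hzi.affineSpan_eq_top_iff_card_eq_finrank_add_one.1 htop
    simpa using this
  let e₀ : Fin (d + 1) ≃ ι := (Fintype.equivFinOfCardEq hcard).symm
  -- The vertex of largest weight is moved to index 0; its weight is then at least 1/(d+1), which
  -- leaves room for a corner seen from that vertex.
  obtain ⟨k, -, hk⟩ := Finset.exists_max_image Finset.univ (fun i => w (e₀ i)) ⟨0, Finset.mem_univ _⟩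
  let e : Fin (d + 1) ≃ ι := (Equiv.swap 0 k).trans e₀
  refine ⟨fun i => ⟨z (e i), by exact_mod_cast hz (mem_range_self _)⟩, fun i => w (e i),
    hzi.comp_embedding e.toEmbedding, fun i => hw _, fun i => ?_, ?_, ?_⟩
  · have : e 0 = e₀ k := by simp [e]
    simp only [this]
    exact hk _ (Finset.mem_univ _)
  · rw [e.sum_comp w, hw1]
  · rw [e.sum_comp (fun i => w i • z i), hwx]

/-- **Korn's second inequality** on a convex polytope, for smooth fields. -/
theorem exists_korn_convexHull (s : Finset (Vec d)) :
    ∃ C : ℝ≥0∞, C ≠ ⊤ ∧ ∀ w : Vec d → Vec d, ContDiff ℝ ∞ w → HasCompactSupport w →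
      ∫⁻ x in convexHull ℝ (s : Set (Vec d)), ‖fderiv ℝ w x‖ₑ ^ 2 ≤
      C * ∫⁻ x in convexHull ℝ (s : Set (Vec d)),
        (‖symGrad (fderiv ℝ w x)‖ₑ ^ 2 + ‖w x‖ₑ ^ 2) := by
  classical
  set K := convexHull ℝ (s : Set (Vec d)) with hK
  have hKm : MeasurableSet K := (s.finite_toSet.isCompact_convexHull ℝ).isClosed.measurableSet
  -- The scales are tuned to three facts. Base points leave weight 1/D for vertex 0; the corner of
  -- radius R stays in the simplex since dR ≤ 1/D; and a cell of side h fits in the ball of radius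
  -- R/2 since dh < R/2.
  set D : ℝ := (d : ℝ) + 1 with hD
  have hD1 : 1 ≤ D := by simp [hD]
  have hD0 : 0 < D := by linarith
  set h : ℝ := 1 / (2 * D ^ 3) with hh
  have hpos : 0 < h := by positivity
  set R : ℝ := 1 / D ^ 2 with hR
  have hRpos : 0 < R := by positivity
  have hDR : (d : ℝ) * R ≤ 1 / D := by
    rw [hR, mul_one_div, div_le_div_iff₀ (by positivity) hD0]
    nlinarith
  have hDh : (d : ℝ) * h < R / 2 := by
    rw [hR, hh, mul_one_div, div_div, div_lt_div_iff₀ (by positivity) (by positivity)]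
    have : 0 < D ^ 2 := by positivity
    nlinarith
  -- A patch is given by an ordered simplex and a grid cell in its barycentric coordinates; there
  -- are 1/h = 2(d+1)³ cells along each axis. Indices that are not `good` get the empty patch.
  let I := (Fin (d + 1) → s) × (Fin d → Fin (2 * (d + 1) ^ 3 + 1))
  let good : I → Prop := fun p => AffineIndependent ℝ (fun i => (p.1 i : Vec d)) ∧
    ∑ i, ((p.2 i : ℕ) : ℝ) * h ≤ 1 - 1 / D
  have hloc : ∀ p : I, ∃ (S : Set (Vec d)) (C : ℝ≥0∞), C ≠ ⊤ ∧
      (good p → ∀ σ : Vec d, (∀ i, 0 < σ i ∧ σ i ≤ h) →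
        (p.1 0 : Vec d) + ∑ i : Fin d, (((p.2 i : ℕ) : ℝ) * h + σ i) •
          ((p.1 i.succ : Vec d) - p.1 0) ∈ S) ∧
      ∀ w : Vec d → Vec d, ContDiff ℝ ∞ w → HasCompactSupport w →
        ∫⁻ x in S, ‖fderiv ℝ w x‖ₑ ^ 2 ≤
          C * ∫⁻ x in K, (‖symGrad (fderiv ℝ w x)‖ₑ ^ 2 + ‖w x‖ₑ ^ 2) := by
    intro p
    by_cases hp : good p
    swap
    · exact ⟨∅, 0, by simp, fun h => absurd h hp, fun w _ _ => by simp⟩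
    obtain ⟨L, hL⟩ := exists_simplex_chart hp.1
    set y : Vec d := (p.1 0 : Vec d) + ∑ i : Fin d, (((p.2 i : ℕ) : ℝ) * h) •
          ((p.1 i.succ : Vec d) - p.1 0) with hy
    have hyL : ∀ σ : Vec d, y + L σ = (p.1 0 : Vec d) + ∑ i : Fin d, (((p.2 i : ℕ) : ℝ) * h + σ i) •
          ((p.1 i.succ : Vec d) - p.1 0) := by
      intro σ
      rw [hy, hL, add_assoc, ← Finset.sum_add_distrib]
      simp only [add_smul]
    have hcorner : ∀ σ ∈ orthant (Finset.univ : Finset (Fin d)), ‖σ‖ ≤ R → y + L σ ∈ K := by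
      intro σ hσ hσR
      rw [hyL]
      set τ : Fin d → ℝ := fun i => ((p.2 i : ℕ) : ℝ) * h + σ i with hτ
      have hτ0 : ∀ i, 0 ≤ τ i := fun i => by
        have := hσ i (Finset.mem_univ i)
        positivity
      have hσi : ∀ i, σ i ≤ R := fun i => (le_abs_self _).trans ((PiLp.norm_apply_le σ i).trans hσR)
      have hτ1 : ∑ i, τ i ≤ 1 := by
        rw [hτ, Finset.sum_add_distrib]
        have : ∑ i, σ i ≤ (d : ℝ) * R := by
          refine (Finset.sum_le_sum fun i _ => hσi i).trans ?_
          simp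
        linarith [hp.2]
      -- Vertex 0 takes the remaining barycentric weight 1 - ∑τ.
      have hsum : ∑ i : Fin (d + 1), (Fin.cons (1 - ∑ i, τ i) τ : Fin (d + 1) → ℝ) i •
          (p.1 i : Vec d) = (p.1 0 : Vec d) + ∑ i : Fin d, τ i •
            ((p.1 i.succ : Vec d) - p.1 0) := by
        rw [Fin.sum_univ_succ]
        simp only [Fin.cons_zero, Fin.cons_succ, smul_sub, Finset.sum_sub_distrib,
          ← Finset.sum_smul, sub_smul, one_smul]
        abel
      rw [← hsum]
      refine (convex_convexHull ℝ _).sum_mem (fun i _ => ?_) ?_ fun i _ =>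
        subset_convexHull ℝ _ (p.1 i).2
      · refine Fin.cases ?_ (fun i => ?_) i
        · simpa using hτ1
        · simpa using hτ0 i
      · rw [Fin.sum_univ_succ]
        simp
    obtain ⟨C, hC, hkorn⟩ := exists_korn_corner L y (half_pos hRpos) (half_lt_self hRpos) hKm hcorner
    refine ⟨_, C, hC, fun _ σ hσ => ?_, hkorn⟩
    rw [← hyL]
    refine mem_image_of_mem _ ⟨fun i _ => (hσ i).1, ?_⟩
    rw [mem_ball_zero_iff]
    refine lt_of_le_of_lt ?_ hDh
    have e : σ = ∑ i, σ i • EuclideanSpace.single i (1 : ℝ) := by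
      ext j
      simp [Finset.sum_apply, Pi.single_apply]
    rw [e]
    refine (norm_sum_le _ _).trans ?_
    refine (Finset.sum_le_sum (g := fun _ => h) fun i _ => ?_).trans (by simp)
    rw [norm_smul, Real.norm_of_nonneg (hσ i).1.le]
    simpa using (hσ i).2
  choose S C hC hS hkorn using hloc
  refine ⟨∑ p, C p, ENNReal.sum_ne_top.2 fun p _ => hC p, fun w hw hwc => ?_⟩
  have hcov : ∀ᵐ x ∂volume.restrict K, x ∈ ⋃ p, S p := by
    rw [ae_restrict_iff' hKm]
    filter_upwards [ae_mem_simplex s] with x hx hxK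
    obtain ⟨v, t, hvi, ht, htm, ht1, htx⟩ := hx hxK
    have htle : ∀ i, t i ≤ 1 := fun i => by
      rw [← ht1]
      exact Finset.single_le_sum (fun j _ => (ht j).le) (Finset.mem_univ i)
    have hceil : ∀ i, 0 < ⌈t i / h⌉₊ := fun i => Nat.ceil_pos.2 (div_pos (ht i) hpos)
    -- Ceiling minus one instead of the floor: the offset from the cell corner must be strictly
    -- positive, as the orthant is open.
    let n : Fin d → Fin (2 * (d + 1) ^ 3 + 1) := fun i => ⟨⌈t i.succ / h⌉₊ - 1, by
      have : ⌈t i.succ / h⌉₊ ≤ 2 * (d + 1) ^ 3 := by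
        refine Nat.ceil_le.2 ?_
        rw [hh, div_div_eq_mul_div, div_one]
        push_cast
        have := htle i.succ
        have h2 : 0 < 2 * D ^ 3 := by positivity
        calc t i.succ * (2 * D ^ 3) ≤ 1 * (2 * D ^ 3) := by gcongr
          _ = _ := by rw [one_mul]
      omega⟩
    have hn : ∀ i, (((n i : ℕ) : ℝ) * h < t i.succ ∧ t i.succ ≤ ((n i : ℕ) : ℝ) * h + h) := by
      intro i
      have e1 : ((n i : ℕ) : ℝ) = (⌈t i.succ / h⌉₊ : ℝ) - 1 := by
        have : (n i : ℕ) = ⌈t i.succ / h⌉₊ - 1 := rfl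
        rw [this, Nat.cast_sub (hceil i.succ)]
        simp
      have e2 := Nat.ceil_lt_add_one (div_pos (ht i.succ) hpos).le
      have e3 := Nat.le_ceil (t i.succ / h)
      rw [e1]
      constructor
      · have : (⌈t i.succ / h⌉₊ : ℝ) - 1 < t i.succ / h := by linarith
        exact (lt_div_iff₀ hpos).1 this
      · have := (div_le_iff₀ hpos).1 e3
        linarith
    have ht0 : 1 / D ≤ t 0 := by
      rw [div_le_iff₀ hD0, ← ht1]
      refine (Finset.sum_le_sum fun i _ => htm i).trans ?_
      simp [hD, mul_comm]
    have hsum : t 0 + ∑ i : Fin d, t i.succ = 1 := by rw [← Fin.sum_univ_succ, ht1]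
    refine mem_iUnion.2 ⟨(v, n), ?_⟩
    have hgood : good (v, n) := by
      refine ⟨hvi, ?_⟩
      have := Finset.sum_le_sum fun i (_ : i ∈ Finset.univ) => (hn i).1.le
      simp only
      linarith
    have := hS (v, n) hgood (WithLp.toLp 2 fun i => t i.succ - ((n i : ℕ) : ℝ) * h) fun i => by
      simp only
      constructor <;> linarith [(hn i).1, (hn i).2]
    convert this using 1
    rw [← htx, Fin.sum_univ_succ]
    simp only [add_sub_cancel, smul_sub, Finset.sum_sub_distrib, ← Finset.sum_smul]
    have : t 0 = 1 - ∑ i : Fin d, t i.succ := by linarith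
    rw [this, sub_smul, one_smul]
    abel
  calc ∫⁻ x in K, ‖fderiv ℝ w x‖ₑ ^ 2
      ≤ ∫⁻ x in ⋃ p, S p, ‖fderiv ℝ w x‖ₑ ^ 2 := by
        refine lintegral_mono' ?_ le_rfl
        rw [← Measure.restrict_eq_self_of_ae_mem hcov]
        exact Measure.restrict_mono subset_rfl Measure.restrict_le_self
    _ ≤ ∑ p, ∫⁻ x in S p, ‖fderiv ℝ w x‖ₑ ^ 2 := by
        refine (lintegral_iUnion_le _ _).trans ?_
        rw [tsum_fintype]
    _ ≤ ∑ p, C p * ∫⁻ x in K, (‖symGrad (fderiv ℝ w x)‖ₑ ^ 2 + ‖w x‖ₑ ^ 2) :=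
        Finset.sum_le_sum fun p _ => hkorn p w hw hwc
    _ = _ := by rw [Finset.sum_mul]

end CEM

end

/-! ## Korn's inequality on the local spaces -/

noncomputable section

namespace CEM

open Filter Topology
open scoped ENNReal

variable {d : ℕ}

theorem enorm_sq_Lp {α E : Type*} [MeasurableSpace α] {ν : Measure α} [NormedAddCommGroup E]
    (v : Lp E 2 ν) : ‖v‖ₑ ^ 2 = ∫⁻ x, ‖v x‖ₑ ^ 2 ∂ν := by
  rw [Lp.enorm_def, eLpNorm_eq_lintegral_rpow_enorm_toReal (by norm_num) (by norm_num),
    ← ENNReal.rpow_natCast, ← ENNReal.rpow_mul]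
  simp

namespace BddForm

variable {E : Type*} [NormedAddCommGroup E] [NormedSpace ℝ E] {G : Set (Vec d)}
  {ν : Measure (Vec d)}

theorem exists_abs_form_le (Q : BddForm E G) (hν : volume.restrict G ≤ ν) :
    ∃ b : ℝ, 0 ≤ b ∧ ∀ u v, |Q.form hν u v| ≤ b * ‖u‖ * ‖v‖ := by
  obtain ⟨b, hb, h⟩ := Q.form_self_le hν
  refine ⟨b, hb, fun u v => ?_⟩
  refine (form_le_sqrt_mul_sqrt _ (Q.form_symm hν) (Q.form_nonneg hν) u v).trans ?_
  have hs : ∀ u, Real.sqrt (Q.form hν u u) ≤ Real.sqrt b * ‖u‖ := fun u => by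
    rw [← Real.sqrt_sq (norm_nonneg u), ← Real.sqrt_mul hb]
    exact Real.sqrt_le_sqrt (h u)
  calc _ ≤ (Real.sqrt b * ‖u‖) * (Real.sqrt b * ‖v‖) := by gcongr <;> exact hs _
    _ = (Real.sqrt b * Real.sqrt b) * ‖u‖ * ‖v‖ := by ring
    _ = _ := by rw [Real.mul_self_sqrt hb]

theorem continuous_form (Q : BddForm E G) (hν : volume.restrict G ≤ ν) :
    Continuous fun p : Lp E 2 ν × Lp E 2 ν => Q.form hν p.1 p.2 := by
  obtain ⟨b, hb, h⟩ := Q.exists_abs_form_le hν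
  let F := LinearMap.mkContinuous₂ (Q.form hν) b h
  exact F.continuous₂

theorem continuous_form_self (Q : BddForm E G) (hν : volume.restrict G ≤ ν) :
    Continuous fun v : Lp E 2 ν => Q.form hν v v :=
  (Q.continuous_form hν).comp (continuous_id.prodMk continuous_id)

end BddForm

theorem continuous_restrictPair (K : Set (Vec d)) : Continuous (restrictPair K) :=
  ((LpToLpRestrictCLM (Vec d) (Vec d) ℝ volume 2 K).continuous.comp continuous_fst).prodMk
    ((LpToLpRestrictCLM (Vec d) (Grad d) ℝ volume 2 K).continuous.comp continuous_snd)

theorem restrictPair_fst (K : Set (Vec d)) (p : Pair (volume : Measure (Vec d))) :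
    (restrictPair K p).1 =ᵐ[volume.restrict K] p.1 :=
  LpToLpRestrictCLM_coeFn ℝ K p.1

theorem restrictPair_snd (K : Set (Vec d)) (p : Pair (volume : Measure (Vec d))) :
    (restrictPair K p).2 =ᵐ[volume.restrict K] p.2 :=
  LpToLpRestrictCLM_coeFn ℝ K p.2

theorem restrictPair_mem_localSpace {D K : Set (Vec d)} {p : Pair (volume : Measure (Vec d))}
    (hp : p ∈ H10 D) : restrictPair K p ∈ localSpace D K :=
  Submodule.le_topologicalClosure _ (Submodule.mem_map_of_mem hp)

/-- A closed condition holds on the local space if it holds for test fields. -/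
theorem localSpace_subset {D K : Set (Vec d)} {S : Set (Pair (volume.restrict K))}
    (hS : IsClosed S)
    (h : ∀ w : Vec d → Vec d, ContDiff ℝ ∞ w → HasCompactSupport w →
      ∀ p : Pair (volume.restrict K), p.1 =ᵐ[volume.restrict K] w →
        p.2 =ᵐ[volume.restrict K] fderiv ℝ w → p ∈ S) :
    (localSpace D K : Set (Pair (volume.restrict K))) ⊆ S := by
  refine closure_minimal ?_ hS
  rintro _ ⟨p, hp, rfl⟩
  have h2 : (H10 D : Set (Pair (volume : Measure (Vec d)))) ⊆ restrictPair K ⁻¹' S := by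
    refine closure_minimal ?_ (hS.preimage (continuous_restrictPair K))
    rintro p ⟨w, hw, hwc, -, h1, h2⟩
    exact h w hw hwc _ ((restrictPair_fst K p).trans (ae_restrict_of_ae h1))
      ((restrictPair_snd K p).trans (ae_restrict_of_ae h2))
  exact h2 hp

variable {D : Set (Vec d)}

/-- The λ term is nonnegative and is dropped; the lower bound of μ gives the rest. -/
theorem Lame.sq_norm_symGrad_le (c : Lame D) : ∃ C : ℝ, 0 ≤ C ∧ ∀ᵐ x ∂volume.restrict D,
    ∀ A : Grad d, ‖symGrad A‖ ^ 2 ≤ C * c.bddForm.q x A A := by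
  obtain ⟨c₀, hc₀, hmu⟩ := c.mu_lower
  refine ⟨2 / c₀, by positivity, ?_⟩
  filter_upwards [hmu, c.lam_pos] with x h1 h2 A
  refine (CEM.sq_norm_symGrad_le A).trans ?_
  have h3 : 0 ≤ c.lam x * (dvg A * dvg A) := mul_nonneg h2.le (mul_self_nonneg _)
  have h4 : 0 ≤ ∑ i, ∑ j, strain A i j ^ 2 :=
    Finset.sum_nonneg fun i _ => Finset.sum_nonneg fun j _ => sq_nonneg _
  have h5 : c.bddForm.q x A A = 2 * c.mu x * ∑ i, ∑ j, strain A i j ^ 2 +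
      c.lam x * (dvg A * dvg A) := by
    simp only [Lame.bddForm, pow_two]
  rw [h5, div_mul_eq_mul_div, le_div_iff₀ hc₀]
  nlinarith

namespace CoarseGrid

variable (T : CoarseGrid D)

theorem convex_block (i : Fin T.N) : Convex ℝ (T.block i) := by
  obtain ⟨s, hs⟩ := T.polytope i
  rw [hs]
  exact convex_convexHull ℝ _

theorem isCompact_block (i : Fin T.N) : IsCompact (T.block i) := by
  obtain ⟨s, hs⟩ := T.polytope i
  rw [hs]
  exact s.finite_toSet.isCompact_convexHull ℝ

theorem K_ae_eq_block (i : Fin T.N) : T.K i =ᵐ[volume] T.block i :=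
  interior_ae_eq_of_null_frontier ((T.convex_block i).addHaar_frontier volume)

theorem isOpen_K (i : Fin T.N) : IsOpen (T.K i) := isOpen_interior

theorem K_subset (i : Fin T.N) : T.K i ⊆ D := T.interior_subset i

theorem isBounded_K (i : Fin T.N) : Bornology.IsBounded (T.K i) :=
  (T.isCompact_block i).isBounded.subset _root_.interior_subset

theorem convex_K (i : Fin T.N) : Convex ℝ (T.K i) := (T.convex_block i).interior

end CoarseGrid

/-- **Korn's second inequality** on the local spaces. -/
theorem exists_korn_localSpace (c : Lame D) (T : CoarseGrid D) (i : Fin T.N) :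
    ∃ C : ℝ, 0 ≤ C ∧ ∀ v ∈ localSpace D (T.K i),
      ‖v.2‖ ^ 2 ≤ C * (‖v.1‖ ^ 2 + (c.bddForm.mono (T.K_subset i)).form le_rfl v.2 v.2) := by
  obtain ⟨s, hs⟩ := T.polytope i
  obtain ⟨C, hC, hkorn⟩ := exists_korn_convexHull s
  obtain ⟨C', hC', hsym⟩ := c.sq_norm_symGrad_le
  refine ⟨C.toReal * (C' + 1), by positivity, fun v hv => ?_⟩
  set B := (c.bddForm.mono (T.K_subset i)).form le_rfl with hB
  -- Both sides are continuous in the H¹ norm, so it is enough to treat smooth fields.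
  have hcl : IsClosed {v : Pair (volume.restrict (T.K i)) |
      ‖v.2‖ ^ 2 ≤ C.toReal * (C' + 1) * (‖v.1‖ ^ 2 + B v.2 v.2)} := by
    refine isClosed_le (by fun_prop) ?_
    exact continuous_const.mul ((by fun_prop : Continuous fun v :
      Pair (volume.restrict (T.K i)) => ‖v.1‖ ^ 2).add
      ((BddForm.continuous_form_self _ _).comp continuous_snd))
  refine localSpace_subset hcl (fun w hw hwc p h1 h2 => ?_) hv
  have hr : volume.restrict (T.K i) = volume.restrict (convexHull ℝ (s : Set (Vec d))) := by
    rw [Measure.restrict_congr_set (T.K_ae_eq_block i), hs]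
  have hB0 : 0 ≤ B p.2 p.2 := BddForm.form_nonneg _ _ _
  have hk := hkorn w hw hwc
  rw [← hr] at hk
  have e1 : ∫⁻ x in T.K i, ‖fderiv ℝ w x‖ₑ ^ 2 = ‖p.2‖ₑ ^ 2 := by
    rw [enorm_sq_Lp]
    exact lintegral_congr_ae (h2.mono fun x hx => by simp only [hx])
  have e2 : ∫⁻ x in T.K i, ‖w x‖ₑ ^ 2 = ‖p.1‖ₑ ^ 2 := by
    rw [enorm_sq_Lp]
    exact lintegral_congr_ae (h1.mono fun x hx => by simp only [hx])
  have e3 : ∫⁻ x in T.K i, ‖symGrad (fderiv ℝ w x)‖ₑ ^ 2 ≤ ENNReal.ofReal (C' * B p.2 p.2) := by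
    have hint : Integrable (fun x => c.bddForm.q x (p.2 x) (p.2 x)) (volume.restrict (T.K i)) :=
      (c.bddForm.mono (T.K_subset i)).integrable (Lp.memLp _) (Lp.memLp _)
    have h0 : 0 ≤ᵐ[volume.restrict (T.K i)] fun x => c.bddForm.q x (p.2 x) (p.2 x) := by
      filter_upwards [(c.bddForm.mono (T.K_subset i)).nonneg] with x hx using hx _
    have : ENNReal.ofReal (B p.2 p.2) =
        ∫⁻ x in T.K i, ENNReal.ofReal (c.bddForm.q x (p.2 x) (p.2 x)) := by
      rw [hB, BddForm.form_apply]
      exact ofReal_integral_eq_lintegral_ofReal hint h0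
    rw [ENNReal.ofReal_mul hC', this, ← lintegral_const_mul' _ _ ENNReal.ofReal_ne_top]
    refine lintegral_mono_ae ?_
    filter_upwards [h2, ae_mono (Measure.restrict_mono (T.K_subset i) le_rfl) hsym] with x hx hx'
    rw [← hx, enorm_sq_eq_ofReal, ← ENNReal.ofReal_mul hC']
    exact ENNReal.ofReal_le_ofReal (hx' _)
  rw [lintegral_add_right _ (hw.continuous.measurable.enorm.pow_const 2), e1, e2] at hk
  have hk2 := hk.trans (mul_le_mul' le_rfl (add_le_add e3 le_rfl))
  rw [enorm_sq_eq_ofReal, enorm_sq_eq_ofReal, ← ENNReal.ofReal_add (by positivity) (by positivity),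
    ← ENNReal.ofReal_toReal hC, ← ENNReal.ofReal_mul ENNReal.toReal_nonneg,
    ENNReal.ofReal_le_ofReal_iff (by positivity)] at hk2
  refine hk2.trans ?_
  rw [mul_assoc]
  refine mul_le_mul_of_nonneg_left ?_ ENNReal.toReal_nonneg
  nlinarith [sq_nonneg ‖p.1‖]

end CEM

end

/-! ## The Poincaré inequality on convex sets -/

noncomputable section

namespace CEM

open Filter Topology
open scoped ENNReal

variable {d : ℕ}

/-- The fundamental theorem of calculus along the segment, and Jensen's inequality on the unit
interval. -/
theorem enorm_sub_sq_le_lintegral {V E : Type*} [NormedAddCommGroup V] [InnerProductSpace ℝ V]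
    [NormedAddCommGroup E] [InnerProductSpace ℝ E] [FiniteDimensional ℝ E] {w : V → E}
    (hw : ContDiff ℝ ∞ w) (x y : V) :
    ‖w y - w x‖ₑ ^ 2 ≤ ‖y - x‖ₑ ^ 2 * ∫⁻ s in Icc (0 : ℝ) 1, ‖fderiv ℝ w (x + s • (y - x))‖ₑ ^ 2 := by
  have hc : Continuous fun s : ℝ => fderiv ℝ w (x + s • (y - x)) :=
    (hw.continuous_fderiv (by simp)).comp (by fun_prop)
  have hd : ∀ s ∈ uIcc (0 : ℝ) 1, HasDerivAt (fun s : ℝ => w (x + s • (y - x)))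
      (fderiv ℝ w (x + s • (y - x)) (y - x)) s := by
    intro s _
    have h1 : HasDerivAt (fun s : ℝ => x + s • (y - x)) (y - x) s := by
      simpa using ((hasDerivAt_id s).smul_const (y - x)).const_add x
    exact ((hw.differentiable (by simp) _).hasFDerivAt).comp_hasDerivAt s h1
  have hi := intervalIntegral.integral_eq_sub_of_hasDerivAt hd
    ((hc.clm_apply continuous_const).intervalIntegrable _ _)
  rw [intervalIntegral.integral_of_le zero_le_one, ← integral_Icc_eq_integral_Ioc] at hi
  simp only [one_smul, add_sub_cancel, zero_smul, add_zero] at hi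
  rw [← hi]
  set μ : Measure ℝ := volume.restrict (Icc (0 : ℝ) 1) with hμ
  have hprob : IsProbabilityMeasure μ := ⟨by simp [hμ]⟩
  set G : ℝ → E := fun s => fderiv ℝ w (x + s • (y - x)) (y - x) with hG
  have hGm : AEStronglyMeasurable G μ := (hc.clm_apply continuous_const).aestronglyMeasurable
  have h1 : ‖∫ s, G s ∂μ‖ₑ ≤ eLpNorm G 2 μ := by
    refine (enorm_integral_le_lintegral_enorm _).trans ?_
    rw [← eLpNorm_one_eq_lintegral_enorm]
    exact eLpNorm_le_eLpNorm_of_exponent_le (by norm_num) hGm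
  have h2 : eLpNorm G 2 μ ^ 2 = ∫⁻ s, ‖G s‖ₑ ^ 2 ∂μ := by
    rw [eLpNorm_eq_lintegral_rpow_enorm_toReal (by norm_num) (by norm_num),
      ← ENNReal.rpow_natCast, ← ENNReal.rpow_mul]
    simp
  calc ‖∫ s, G s ∂μ‖ₑ ^ 2 ≤ eLpNorm G 2 μ ^ 2 := pow_le_pow_left₀ zero_le h1 2
    _ = ∫⁻ s, ‖G s‖ₑ ^ 2 ∂μ := h2
    _ ≤ ∫⁻ s, ‖y - x‖ₑ ^ 2 * ‖fderiv ℝ w (x + s • (y - x))‖ₑ ^ 2 ∂μ := by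
        refine lintegral_mono fun s => ?_
        rw [← mul_pow, mul_comm]
        exact pow_le_pow_left₀ zero_le (ContinuousLinearMap.le_opENorm _ _) 2
    _ = _ := lintegral_const_mul' _ _ (ENNReal.pow_ne_top enorm_ne_top)

section Poincare

variable {V E : Type*} [NormedAddCommGroup V] [InnerProductSpace ℝ V] [FiniteDimensional ℝ V]
  [MeasurableSpace V] [BorelSpace V]
  [NormedAddCommGroup E] [InnerProductSpace ℝ E] [FiniteDimensional ℝ E]

/-- A contraction towards a point of Q maps Q into itself, and for θ ≥ 1/2 the inverse Jacobian is
at most 2 to the dimension. -/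
theorem setLIntegral_comp_contraction_le {Q : Set V} (hQ : Convex ℝ Q) {y : V} (hy : y ∈ Q) {θ : ℝ}
    (hθ : θ ∈ Icc (1 / 2 : ℝ) 1) {g : V → ℝ≥0∞} (hg : Measurable g) (hQm : MeasurableSet Q) :
    ∫⁻ x in Q, g (θ • x + (1 - θ) • y) ≤ 2 ^ Module.finrank ℝ V * ∫⁻ x in Q, g x := by
  have h0 : 0 < θ := lt_of_lt_of_le (by norm_num) hθ.1
  set F : V → V := fun x => θ • x + (1 - θ) • y with hF
  have hFm : Measurable F := by fun_prop
  have hmap : Measure.map F volume =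
      ENNReal.ofReal |(θ ^ Module.finrank ℝ V)⁻¹| • (volume : Measure V) := by
    have h2 : F = (fun x => x + (1 - θ) • y) ∘ (θ • ·) := rfl
    rw [h2, ← Measure.map_map (measurable_add_const _) (measurable_const_smul θ),
      Measure.map_addHaar_smul volume h0.ne', Measure.map_smul,
      (measurePreserving_add_right volume _).map_eq]
  have hc : ENNReal.ofReal |(θ ^ Module.finrank ℝ V)⁻¹| ≤ 2 ^ Module.finrank ℝ V := by
    rw [abs_of_pos (by positivity)]
    refine ENNReal.ofReal_le_of_le_toReal ?_
    rw [ENNReal.toReal_pow, ENNReal.toReal_ofNat, ← inv_pow]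
    refine pow_le_pow_left₀ (by positivity) ?_ _
    rw [inv_le_comm₀ h0 two_pos]
    linarith [hθ.1]
  calc ∫⁻ x in Q, g (F x) ≤ ∫⁻ x in F ⁻¹' Q, g (F x) := by
        refine lintegral_mono_set fun x hx => ?_
        exact hQ hx hy h0.le (by linarith [hθ.2]) (by ring)
    _ = ∫⁻ x in Q, g x ∂(Measure.map F volume) := (setLIntegral_map hQm hg hFm).symm
    _ = ENNReal.ofReal |(θ ^ Module.finrank ℝ V)⁻¹| * ∫⁻ x in Q, g x := by
        rw [hmap, Measure.restrict_smul, lintegral_smul_measure, smul_eq_mul]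
    _ ≤ _ := by gcongr

/-- Going only halfway from x to y keeps the contraction ratio 1 - s/2 above 1/2, so no singular
Jacobian appears. The half length accounts for the 4. -/
theorem lintegral_sub_midpoint_le {Q : Set V} (hQ : Convex ℝ Q) (hQm : MeasurableSet Q) {r : ℝ≥0∞}
    (hr : ∀ x ∈ Q, ∀ y ∈ Q, ‖y - x‖ₑ ≤ r) {w : V → E} (hw : ContDiff ℝ ∞ w) {y : V} (hy : y ∈ Q) :
    4 * ∫⁻ x in Q, ‖w ((1 / 2 : ℝ) • (x + y)) - w x‖ₑ ^ 2 ≤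
      r ^ 2 * (2 ^ Module.finrank ℝ V * ∫⁻ x in Q, ‖fderiv ℝ w x‖ₑ ^ 2) := by
  have hc : Continuous (fderiv ℝ w) := hw.continuous_fderiv (by simp)
  have h4 : (4 : ℝ≥0∞) * ‖(1 / 2 : ℝ)‖ₑ ^ 2 = 1 := by
    rw [enorm_sq_eq_ofReal, show (4 : ℝ≥0∞) = ENNReal.ofReal 4 by simp,
      ← ENNReal.ofReal_mul (by norm_num), ENNReal.ofReal_eq_one]
    norm_num
  have hE : FiniteDimensional ℝ (V →L[ℝ] E) := inferInstance
  have : BorelSpace ℝ := inferInstance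
  have hmeas : Continuous fun p : V × ℝ =>
      ‖fderiv ℝ w ((1 - p.2 / 2) • p.1 + (1 - (1 - p.2 / 2)) • y)‖ₑ ^ 2 := by
    have h1 : Continuous fun p : V × ℝ => (1 - p.2 / 2) • p.1 + (1 - (1 - p.2 / 2)) • y := by
      fun_prop
    exact (ENNReal.continuous_pow 2).comp (continuous_enorm.comp (hc.comp h1))
  calc 4 * ∫⁻ x in Q, ‖w ((1 / 2 : ℝ) • (x + y)) - w x‖ₑ ^ 2
      ≤ 4 * ∫⁻ x in Q, ‖(1 / 2 : ℝ)‖ₑ ^ 2 * r ^ 2 * ∫⁻ s in Icc (0 : ℝ) 1,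
          ‖fderiv ℝ w ((1 - s / 2) • x + (1 - (1 - s / 2)) • y)‖ₑ ^ 2 := by
        refine mul_le_mul' le_rfl (setLIntegral_mono' hQm fun x hx => ?_)
        refine (enorm_sub_sq_le_lintegral hw _ _).trans ?_
        have e : (1 / 2 : ℝ) • (x + y) - x = (1 / 2 : ℝ) • (y - x) := by
          module
        have e2 : ∀ s : ℝ, x + s • ((1 / 2 : ℝ) • (x + y) - x) =
            (1 - s / 2) • x + (1 - (1 - s / 2)) • y := fun s => by module
        simp only [e2]
        refine mul_le_mul' ?_ le_rfl
        rw [e, enorm_smul, mul_pow]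
        gcongr
        exact hr x hx y hy
    _ = r ^ 2 * ∫⁻ x in Q, ∫⁻ s in Icc (0 : ℝ) 1,
          ‖fderiv ℝ w ((1 - s / 2) • x + (1 - (1 - s / 2)) • y)‖ₑ ^ 2 := by
        rw [lintegral_const_mul, ← mul_assoc, ← mul_assoc, h4, one_mul]
        exact hmeas.measurable.lintegral_prod_right'
    _ = r ^ 2 * ∫⁻ s in Icc (0 : ℝ) 1, ∫⁻ x in Q,
          ‖fderiv ℝ w ((1 - s / 2) • x + (1 - (1 - s / 2)) • y)‖ₑ ^ 2 := by
        rw [lintegral_lintegral_swap hmeas.measurable.aemeasurable]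
    _ ≤ r ^ 2 * ∫⁻ _s in Icc (0 : ℝ) 1, 2 ^ Module.finrank ℝ V * ∫⁻ x in Q, ‖fderiv ℝ w x‖ₑ ^ 2 := by
        refine mul_le_mul' le_rfl (setLIntegral_mono' measurableSet_Icc fun s hs => ?_)
        refine setLIntegral_comp_contraction_le (g := fun x => ‖fderiv ℝ w x‖ₑ ^ 2) hQ hy
          ⟨by linarith [hs.2], by linarith [hs.1]⟩ ?_ hQm
        exact ((ENNReal.continuous_pow 2).comp (continuous_enorm.comp hc)).measurable
    _ = _ := by simp

/-- Both x and y are joined to their midpoint, and the two halves contribute equally by symmetry. -/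
theorem lintegral_lintegral_sub_le {Q : Set V} (hQ : Convex ℝ Q) (hQm : MeasurableSet Q) {r : ℝ≥0∞}
    (hr : ∀ x ∈ Q, ∀ y ∈ Q, ‖y - x‖ₑ ≤ r) {w : V → E} (hw : ContDiff ℝ ∞ w) :
    ∫⁻ y in Q, ∫⁻ x in Q, ‖w x - w y‖ₑ ^ 2 ≤
      volume Q * (r ^ 2 * (2 ^ Module.finrank ℝ V * ∫⁻ x in Q, ‖fderiv ℝ w x‖ₑ ^ 2)) := by
  set G := r ^ 2 * (2 ^ Module.finrank ℝ V * ∫⁻ x in Q, ‖fderiv ℝ w x‖ₑ ^ 2) with hG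
  set m : V → V → ℝ≥0∞ := fun x y => ‖w ((1 / 2 : ℝ) • (x + y)) - w x‖ₑ ^ 2 with hm
  have hmc : Continuous fun p : V × V => m p.1 p.2 := by
    have := hw.continuous
    exact (ENNReal.continuous_pow 2).comp (continuous_enorm.comp (by fun_prop))
  have h2 : ∫⁻ y in Q, ∫⁻ x in Q, m x y ≤ ∫⁻ y in Q, G / 4 := by
    refine setLIntegral_mono' hQm fun y hy => ?_
    rw [ENNReal.le_div_iff_mul_le (by norm_num) (by norm_num), mul_comm]
    exact lintegral_sub_midpoint_le hQ hQm hr hw hy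
  calc ∫⁻ y in Q, ∫⁻ x in Q, ‖w x - w y‖ₑ ^ 2
      ≤ ∫⁻ y in Q, ∫⁻ x in Q, (2 * m x y + 2 * m y x) := by
        refine lintegral_mono fun y => lintegral_mono fun x => ?_
        have e : w x - w y = (w ((1 / 2 : ℝ) • (y + x)) - w y) -
            (w ((1 / 2 : ℝ) • (x + y)) - w x) := by
          rw [add_comm y x]
          abel
        rw [e]
        have h3 := pow_le_pow_left₀ (zero_le) (enorm_sub_le (a := w ((1 / 2 : ℝ) • (y + x)) - w y)
          (b := w ((1 / 2 : ℝ) • (x + y)) - w x)) 2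
        refine h3.trans ((ennreal_add_sq_le _ _).trans (le_of_eq ?_))
        simp only [hm]
        ring
    _ = 2 * (∫⁻ y in Q, ∫⁻ x in Q, m x y) + 2 * ∫⁻ y in Q, ∫⁻ x in Q, m y x := by
        have hx : ∀ y, Measurable fun x => 2 * m x y := fun y =>
          ((hmc.comp (continuous_id.prodMk continuous_const)).measurable).const_mul _
        have hy : ∀ y, Measurable fun x => 2 * m y x := fun y =>
          ((hmc.comp (continuous_const.prodMk continuous_id)).measurable).const_mul _
        have hA : Measurable fun y => ∫⁻ x in Q, m x y :=
          Measurable.lintegral_prod_left' (f := fun p : V × V => m p.1 p.2) hmc.measurable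
        have hB : Measurable fun y => ∫⁻ x in Q, m y x :=
          Measurable.lintegral_prod_right' (f := fun p : V × V => m p.1 p.2) hmc.measurable
        simp only [lintegral_add_left (hx _), lintegral_const_mul' _ _ ENNReal.ofNat_ne_top]
        rw [lintegral_add_left (hA.const_mul _), lintegral_const_mul' _ _ ENNReal.ofNat_ne_top,
          lintegral_const_mul' _ _ ENNReal.ofNat_ne_top]
    _ = 4 * ∫⁻ y in Q, ∫⁻ x in Q, m x y := by
        rw [lintegral_lintegral_swap (f := fun y x => m y x) hmc.measurable.aemeasurable]
        ring
    _ ≤ 4 * ∫⁻ y in Q, G / 4 := by gcongr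
    _ = _ := by
        rw [setLIntegral_const, mul_comm (G / 4), mul_left_comm,
          ENNReal.mul_div_cancel (by norm_num) (by norm_num)]

/-- **Poincaré's inequality** on a convex region. -/
theorem poincare_convex {Q : Set V} (hQ : Convex ℝ Q) (hQm : MeasurableSet Q)
    (hQf : volume Q ≠ ⊤) {r : ℝ} (hr0 : 0 ≤ r) (hr : ∀ x ∈ Q, ∀ y ∈ Q, ‖y - x‖ ≤ r) {w : V → E}
    (hw : ContDiff ℝ ∞ w) (hwc : HasCompactSupport w) :
    volume.real Q * ∫ x in Q, ‖w x‖ ^ 2 ≤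
      volume.real Q * (r ^ 2 * (2 ^ Module.finrank ℝ V * ∫ x in Q, ‖fderiv ℝ w x‖ ^ 2)) +
        ‖∫ x in Q, w x‖ ^ 2 := by
  set m := volume.real Q
  set I := ∫ x in Q, w x with hI
  set S := ∫ x in Q, ‖w x‖ ^ 2 with hS
  have hfin : IsFiniteMeasure (volume.restrict Q) := ⟨by simpa using hQf.lt_top⟩
  have hwi : Integrable w (volume.restrict Q) :=
    (hw.continuous.integrable_of_hasCompactSupport hwc).restrict
  have hwi2 : Integrable (fun x => ‖w x‖ ^ 2) (volume.restrict Q) := by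
    refine (Continuous.integrable_of_hasCompactSupport (by fun_prop) ?_).restrict
    exact hwc.comp_left (g := fun y => ‖y‖ ^ 2) (by simp)
  have hgi : Integrable (fun x => ‖fderiv ℝ w x‖ ^ 2) (volume.restrict Q) := by
    refine (Continuous.integrable_of_hasCompactSupport ?_ ?_).restrict
    · exact (hw.continuous_fderiv (by simp)).norm.pow 2
    · exact (hwc.fderiv ℝ).comp_left (g := fun y => ‖y‖ ^ 2) (by simp)
  have hE : CompleteSpace E := FiniteDimensional.complete ℝ E
  have hD : ∀ y, ∫ x in Q, ‖w x - w y‖ ^ 2 = S - 2 * inner ℝ (w y) I + m * ‖w y‖ ^ 2 := by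
    intro y
    have e : ∀ x, ‖w x - w y‖ ^ 2 = ‖w x‖ ^ 2 - 2 * inner ℝ (w y) (w x) + ‖w y‖ ^ 2 := fun x => by
      rw [norm_sub_sq_real, real_inner_comm]
    simp only [e]
    have hin : Integrable (fun x => 2 * inner ℝ (w y) (w x)) (volume.restrict Q) :=
      (hwi.const_inner (w y)).const_mul 2
    have hs : Integrable (fun x => ‖w x‖ ^ 2 - 2 * inner ℝ (w y) (w x)) (volume.restrict Q) :=
      hwi2.sub hin
    rw [integral_add hs (integrable_const _), integral_sub hwi2 hin,
      integral_const_mul, integral_inner hwi, integral_const, smul_eq_mul]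
    simp [m, hS, hI]
  -- The variance identity. Since all is kept multiplied by the volume, sets of measure zero need no
  -- exception here.
  have hDi : ∫ y in Q, ∫ x in Q, ‖w x - w y‖ ^ 2 = 2 * (m * S) - 2 * ‖I‖ ^ 2 := by
    simp only [hD]
    have hin : Integrable (fun y => 2 * inner ℝ (w y) I) (volume.restrict Q) :=
      (hwi.inner_const I).const_mul 2
    have h3 : ∫ y in Q, inner ℝ (w y) I = ‖I‖ ^ 2 := by
      simp only [real_inner_comm I]
      rw [integral_inner hwi, real_inner_self_eq_norm_sq]
    have hs : Integrable (fun y => S - 2 * inner ℝ (w y) I) (volume.restrict Q) :=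
      (integrable_const S).sub hin
    rw [integral_add hs (hwi2.const_mul m),
      integral_sub (integrable_const S) hin, integral_const_mul, integral_const_mul, h3,
      integral_const, smul_eq_mul, ← hS]
    simp only [measureReal_restrict_apply_univ]
    ring
  have key := lintegral_lintegral_sub_le (r := ENNReal.ofReal r) hQ hQm (fun x hx y hy => by
    rw [← ofReal_norm]
    exact ENNReal.ofReal_le_ofReal (hr x hx y hy)) hw
  have hDint : Integrable (fun y => ∫ x in Q, ‖w x - w y‖ ^ 2) (volume.restrict Q) := by
    simp only [hD]
    exact ((integrable_const S).sub ((hwi.inner_const I).const_mul 2)).add (hwi2.const_mul m)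
  have e1 : ∫⁻ y in Q, ∫⁻ x in Q, ‖w x - w y‖ₑ ^ 2 =
      ENNReal.ofReal (∫ y in Q, ∫ x in Q, ‖w x - w y‖ ^ 2) := by
    rw [ofReal_integral_eq_lintegral_ofReal hDint
      (ae_of_all _ fun y => integral_nonneg fun x => by positivity)]
    refine lintegral_congr fun y => ?_
    rw [ofReal_integral_eq_lintegral_ofReal ?_ (ae_of_all _ fun x => by positivity)]
    · simp only [enorm_sq_eq_ofReal]
    · have e : ∀ x, ‖w x - w y‖ ^ 2 = ‖w x‖ ^ 2 - 2 * inner ℝ (w y) (w x) + ‖w y‖ ^ 2 := fun x => by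
        rw [norm_sub_sq_real, real_inner_comm]
      simp only [e]
      exact (hwi2.sub ((hwi.const_inner (w y)).const_mul 2)).add (integrable_const _)
  have e2 : ∫⁻ x in Q, ‖fderiv ℝ w x‖ₑ ^ 2 = ENNReal.ofReal (∫ x in Q, ‖fderiv ℝ w x‖ ^ 2) := by
    rw [ofReal_integral_eq_lintegral_ofReal hgi (ae_of_all _ fun x => by positivity)]
    simp only [enorm_sq_eq_ofReal]
  have hg0 : 0 ≤ ∫ x in Q, ‖fderiv ℝ w x‖ ^ 2 := integral_nonneg fun x => by positivity
  rw [e1, e2, ← ENNReal.ofReal_pow hr0, show volume Q = ENNReal.ofReal m from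
    (ENNReal.ofReal_toReal hQf).symm, show (2 : ℝ≥0∞) ^ Module.finrank ℝ V =
    ENNReal.ofReal (2 ^ Module.finrank ℝ V) by rw [ENNReal.ofReal_pow (by norm_num)]; simp,
    ← ENNReal.ofReal_mul (by positivity), ← ENNReal.ofReal_mul (by positivity),
    ← ENNReal.ofReal_mul measureReal_nonneg,
    ENNReal.ofReal_le_ofReal_iff (by positivity), hDi] at key
  have h0 : 0 ≤ m * (r ^ 2 * (2 ^ Module.finrank ℝ V * ∫ x in Q, ‖fderiv ℝ w x‖ ^ 2)) := by
    positivity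
  linarith

end Poincare

end CEM

end

/-! ## Rellich compactness on polytopes -/

noncomputable section

namespace CEM

open Filter Topology
open scoped ENNReal

variable {d : ℕ}

/-- The half-open cube of side `h` with index `z`. -/
def gridCube (h : ℝ) (z : Fin d → ℤ) : Set (Vec d) := {x | ∀ i, ⌊x i / h⌋ = z i}

theorem gridCube_eq {h : ℝ} (hh : 0 < h) (z : Fin d → ℤ) :
    gridCube h z = ⋂ i, {x : Vec d | x i ∈ Ico (z i * h) (z i * h + h)} := by
  ext x
  simp only [gridCube, mem_ofPred_eq, mem_iInter, mem_Ico]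
  refine forall_congr' fun i => ?_
  rw [Int.floor_eq_iff, le_div_iff₀ hh, div_lt_iff₀ hh, add_mul, one_mul]

theorem measurableSet_gridCube {h : ℝ} (hh : 0 < h) (z : Fin d → ℤ) :
    MeasurableSet (gridCube h z) := by
  rw [gridCube_eq hh]
  refine MeasurableSet.iInter fun i => ?_
  exact (EuclideanSpace.proj (𝕜 := ℝ) i).continuous.measurable measurableSet_Ico

theorem convex_gridCube {h : ℝ} (hh : 0 < h) (z : Fin d → ℤ) : Convex ℝ (gridCube h z) := by
  rw [gridCube_eq hh]
  refine convex_iInter fun i => ?_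
  exact (convex_Ico _ _).linear_preimage (EuclideanSpace.proj (𝕜 := ℝ) i).toLinearMap

theorem norm_le_sum_abs (x : Vec d) : ‖x‖ ≤ ∑ i, |x i| := by
  have e : x = ∑ i, x i • EuclideanSpace.single i (1 : ℝ) := by
    ext j
    simp [Finset.sum_apply, Pi.single_apply]
  conv_lhs => rw [e]
  refine (norm_sum_le _ _).trans (Finset.sum_le_sum fun i _ => ?_)
  rw [norm_smul]
  simp

theorem norm_sub_le_of_mem_gridCube {h : ℝ} (hh : 0 < h) {z : Fin d → ℤ} {x y : Vec d}
    (hx : x ∈ gridCube h z) (hy : y ∈ gridCube h z) : ‖y - x‖ ≤ d * h := by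
  rw [gridCube_eq hh] at hx hy
  simp only [mem_iInter, mem_ofPred_eq, mem_Ico] at hx hy
  refine (norm_le_sum_abs _).trans ?_
  refine (Finset.sum_le_sum (g := fun _ => h) fun i _ => ?_).trans (by simp)
  rw [PiLp.sub_apply, abs_le]
  constructor <;> linarith [(hx i).1, (hx i).2, (hy i).1, (hy i).2]

theorem exists_finset_gridCube {h : ℝ} (hh : 0 < h) {K : Set (Vec d)} (hK : Bornology.IsBounded K) :
    ∃ Z : Finset (Fin d → ℤ), ∀ x ∈ K, ∃ z ∈ Z, x ∈ gridCube h z := by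
  obtain ⟨R, hR⟩ := hK.exists_norm_le
  refine ⟨Fintype.piFinset fun _ => Finset.Icc ⌊-R / h⌋ ⌊R / h⌋, fun x hx =>
    ⟨fun i => ⌊x i / h⌋, ?_, fun i => rfl⟩⟩
  rw [Fintype.mem_piFinset]
  intro i
  have h1 := abs_le.1 ((PiLp.norm_apply_le x i).trans (hR x hx))
  rw [Finset.mem_Icc]
  exact ⟨Int.floor_mono (div_le_div_of_nonneg_right h1.1 hh.le),
    Int.floor_mono (div_le_div_of_nonneg_right h1.2 hh.le)⟩

theorem norm_sq_Lp {α E : Type*} [MeasurableSpace α] {ν : Measure α} [NormedAddCommGroup E]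
    (v : Lp E 2 ν) : ‖v‖ ^ 2 = ∫ x, ‖v x‖ ^ 2 ∂ν := by
  have hi : Integrable (fun x => ‖v x‖ ^ 2) ν := (Lp.memLp v).integrable_norm_pow (by norm_num)
  rw [integral_eq_lintegral_of_nonneg_ae (ae_of_all _ fun x => by positivity) hi.1]
  simp only [← enorm_sq_eq_ofReal]
  rw [← enorm_sq_Lp, ENNReal.toReal_pow, toReal_enorm]

/-- **Rellich's theorem** on a bounded convex region: up to finitely many functionals, the `L²` norm
is arbitrarily small against the `L²` norm of the gradient. -/
theorem exists_rellich {D K : Set (Vec d)} (hK : Convex ℝ K) (hKm : MeasurableSet K)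
    (hKb : Bornology.IsBounded K) {ε : ℝ} (hε : 0 < ε) :
    ∃ (n : ℕ) (g : Fin n → Lp (Vec d) 2 (volume.restrict K)), ∀ v ∈ localSpace D K,
      ‖v.1‖ ^ 2 ≤ ε * ‖v.2‖ ^ 2 + ∑ k, inner ℝ (g k) v.1 ^ 2 := by
  classical
  suffices H : ∃ (ι : Type) (_ : Fintype ι) (g : ι → Lp (Vec d) 2 (volume.restrict K)),
      ∀ v ∈ localSpace D K, ‖v.1‖ ^ 2 ≤ ε * ‖v.2‖ ^ 2 + ∑ k, inner ℝ (g k) v.1 ^ 2 by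
    obtain ⟨ι, _, g, hg⟩ := H
    refine ⟨Fintype.card ι, fun k => g ((Fintype.equivFin ι).symm k), fun v hv => ?_⟩
    rw [(Fintype.equivFin ι).symm.sum_comp fun k => inner ℝ (g k) v.1 ^ 2]
    exact hg v hv
  -- The mesh is so fine that the Poincaré constant of every cell is at most ε.
  obtain ⟨h, hh, hhε⟩ : ∃ h : ℝ, 0 < h ∧ (d * h) ^ 2 * 2 ^ d ≤ ε := by
    have ht : Tendsto (fun h : ℝ => (d * h) ^ 2 * 2 ^ d) (𝓝[>] 0) (𝓝 0) := by
      have : Continuous fun h : ℝ => ((d : ℝ) * h) ^ 2 * 2 ^ d := by fun_prop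
      have h2 := this.tendsto 0
      simp only [mul_zero, ne_eq, OfNat.ofNat_ne_zero, not_false_eq_true, zero_pow, zero_mul] at h2
      exact h2.mono_left nhdsWithin_le_nhds
    obtain ⟨h, h1, h2⟩ := ((ht.eventually (ge_mem_nhds hε)).and self_mem_nhdsWithin).exists
    exact ⟨h, h2, h1⟩
  obtain ⟨Z, hZ⟩ := exists_finset_gridCube hh hKb
  set Q : (Fin d → ℤ) → Set (Vec d) := fun z => K ∩ gridCube h z with hQ
  have hQm : ∀ z, MeasurableSet (Q z) := fun z => hKm.inter (measurableSet_gridCube hh z)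
  have hQc : ∀ z, Convex ℝ (Q z) := fun z => hK.inter (convex_gridCube hh z)
  have hQf : ∀ z, volume (Q z) ≠ ⊤ := fun z => (hKb.subset inter_subset_left).measure_lt_top.ne
  have hQr : ∀ z, (volume.restrict K).restrict (Q z) = volume.restrict (Q z) := fun z => by
    rw [Measure.restrict_restrict (hQm z), inter_eq_left.2 inter_subset_left]
  have hQf' : ∀ z, volume.restrict K (Q z) ≠ ⊤ := fun z =>
    ((Measure.restrict_apply_le _ _).trans_lt (hQf z).lt_top).ne
  have hdec : ∀ F : Vec d → ℝ, Integrable F (volume.restrict K) →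
      ∫ x in K, F x = ∑ z : Z, ∫ x in Q z, F x := by
    intro F hF
    have hU : K = ⋃ z : Z, Q z := by
      ext x
      refine ⟨fun hx => ?_, fun hx => ?_⟩
      · obtain ⟨z, hz, hxz⟩ := hZ x hx
        exact mem_iUnion.2 ⟨⟨z, hz⟩, hx, hxz⟩
      · obtain ⟨z, hz⟩ := mem_iUnion.1 hx
        exact hz.1
    conv_lhs => rw [hU]
    refine integral_iUnion_fintype (fun z => hQm z) ?_ fun z => ?_
    · intro z z' hzz
      refine Set.disjoint_left.2 fun x hx hx' => hzz ?_
      exact Subtype.ext (funext fun i => (hx.2 i).symm.trans (hx'.2 i))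
    · exact IntegrableOn.mono_set hF inter_subset_left
  -- The functionals are the components of the cell integrals, normalized by the square root of the
  -- volume, so that their squares sum to |∫w|² over the volume: the term left over in Poincaré's
  -- inequality.
  refine ⟨Z × Fin d, inferInstance, fun p => (Real.sqrt (volume.real (Q p.1)))⁻¹ •
    indicatorConstLp 2 (hQm p.1) (hQf' p.1) (EuclideanSpace.single p.2 (1 : ℝ)), fun v hv => ?_⟩
  refine localSpace_subset (S := {v : Pair (volume.restrict K) | ‖v.1‖ ^ 2 ≤ ε * ‖v.2‖ ^ 2 +
    ∑ p : Z × Fin d, inner ℝ ((Real.sqrt (volume.real (Q p.1)))⁻¹ •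
    indicatorConstLp 2 (hQm p.1) (hQf' p.1) (EuclideanSpace.single p.2 (1 : ℝ))) v.1 ^ 2}) ?_ ?_ hv
  · refine isClosed_le (by fun_prop) (Continuous.add (by fun_prop) ?_)
    exact continuous_finsetSum _ fun p _ => (continuous_const.inner continuous_fst).pow 2
  intro w hw hwc p h1 h2
  have hwi : Integrable w volume := hw.continuous.integrable_of_hasCompactSupport hwc
  have e1 : ‖p.1‖ ^ 2 = ∫ x in K, ‖w x‖ ^ 2 := by
    rw [norm_sq_Lp]
    exact integral_congr_ae (h1.mono fun x hx => by simp only [hx])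
  have e2 : ‖p.2‖ ^ 2 = ∫ x in K, ‖fderiv ℝ w x‖ ^ 2 := by
    rw [norm_sq_Lp]
    exact integral_congr_ae (h2.mono fun x hx => by simp only [hx])
  have hi1 : Integrable (fun x => ‖w x‖ ^ 2) (volume.restrict K) := by
    refine (Continuous.integrable_of_hasCompactSupport (by fun_prop) ?_).restrict
    exact hwc.comp_left (g := fun y => ‖y‖ ^ 2) (by simp)
  have hi2 : Integrable (fun x => ‖fderiv ℝ w x‖ ^ 2) (volume.restrict K) := by
    refine (Continuous.integrable_of_hasCompactSupport ?_ ?_).restrict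
    · exact (hw.continuous_fderiv (by simp)).norm.pow 2
    · exact (hwc.fderiv ℝ).comp_left (g := fun y => ‖y‖ ^ 2) (by simp)
  have e3 : ∀ z : Z, ∑ i : Fin d, inner ℝ ((Real.sqrt (volume.real (Q z)))⁻¹ •
      indicatorConstLp 2 (hQm z) (hQf' z) (EuclideanSpace.single i (1 : ℝ))) p.1 ^ 2 =
      (volume.real (Q z))⁻¹ * ‖∫ x in Q z, w x‖ ^ 2 := by
    intro z
    have e4 : ∫ x in Q z, p.1 x ∂(volume.restrict K) = ∫ x in Q z, w x := by
      rw [hQr]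
      refine integral_congr_ae ?_
      rw [← hQr]
      exact ae_restrict_of_ae h1
    rw [EuclideanSpace.norm_sq_eq, Finset.mul_sum]
    refine Finset.sum_congr rfl fun i _ => ?_
    rw [real_inner_smul_left, L2.inner_indicatorConstLp_eq_inner_setIntegral, e4,
      EuclideanSpace.inner_single_left, mul_pow, inv_pow, Real.sq_sqrt measureReal_nonneg]
    simp
  rw [mem_ofPred_eq]
  rw [e1, e2, Fintype.sum_prod_type, hdec _ hi1, hdec _ hi2, Finset.mul_sum,
    ← Finset.sum_add_distrib]
  refine Finset.sum_le_sum fun z _ => ?_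
  rw [e3 z]
  have hp := poincare_convex (hQc z) (hQm z) (hQf z) (r := d * h) (by positivity)
    (fun x hx y hy => norm_sub_le_of_mem_gridCube hh hx.2 hy.2) hw hwc
  -- Cells may meet K in a null set; there both sides vanish, the inverse of zero being zero.
  rcases (measureReal_nonneg (μ := volume) (s := Q z)).eq_or_lt with h0 | h0
  · have h00 : volume (Q z) = 0 := (measureReal_eq_zero_iff (hQf z)).1 h0.symm
    rw [Measure.restrict_eq_zero.2 h00]
    simp
  · have hg0 : 0 ≤ ∫ x in Q z, ‖fderiv ℝ w x‖ ^ 2 := integral_nonneg fun x => by positivity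
    rw [← mul_le_mul_iff_right₀ h0, mul_add, ← mul_assoc _ (_⁻¹), mul_inv_cancel₀ h0.ne', one_mul]
    refine hp.trans (add_le_add (mul_le_mul_of_nonneg_left ?_ h0.le) le_rfl)
    rw [finrank_euclideanSpace_fin, ← mul_assoc]
    exact mul_le_mul_of_nonneg_right hhε hg0

end CEM

end

/-! ## Variational eigenvalue problems -/

noncomputable section

namespace CEM

open Filter Topology

theorem exists_tendsto_of_norm_sub_sq_le {X : Type*} [NormedAddCommGroup X]
    [CompleteSpace X] {l : Filter ℕ} [NeBot l] {v : ℕ → X}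
    {F : ℕ × ℕ → ℝ} (hF : Tendsto F (l ×ˢ l) (𝓝 0))
    (h : ∀ j k, ‖v j - v k‖ ^ 2 ≤ F (j, k)) : ∃ w, Tendsto v l (𝓝 w) := by
  have hc : Cauchy (map v l) := by
    rw [cauchy_map_iff]
    refine ⟨inferInstance, tendsto_uniformity_iff_dist_tendsto_zero.2 ?_⟩
    have h1 : Tendsto (fun p : ℕ × ℕ => ‖v p.1 - v p.2‖ ^ 2) (l ×ˢ l) (𝓝 0) :=
      squeeze_zero (fun p => by positivity) (fun p => h p.1 p.2) hF
    have h2 := (Real.continuous_sqrt.tendsto 0).comp h1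
    simp only [Real.sqrt_zero] at h2
    refine h2.congr fun p => ?_
    simp [Real.sqrt_sq, dist_eq_norm]
  exact CompleteSpace.complete hc

section Variational

variable {X : Type*} [NormedAddCommGroup X] [NormedSpace ℝ X]

/-- Along an ultrafilter every bounded sequence in a finite-dimensional space converges; this
replaces the extraction of subsequences. -/
theorem tendsto_sum_sq_sub {n : ℕ} (l : Ultrafilter ℕ) (g : Fin n → X →L[ℝ] ℝ) {v : ℕ → X} {M : ℝ}
    (hv : ∀ j, ‖v j‖ ≤ M) :
    Tendsto (fun p : ℕ × ℕ => ∑ k, g k (v p.1 - v p.2) ^ 2) (l ×ˢ l : Filter (ℕ × ℕ)) (𝓝 0) := by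
  let x : ℕ → Fin n → ℝ := fun j k => g k (v j)
  have hb : ∀ j, x j ∈ Set.pi univ fun k => Metric.closedBall (0 : ℝ) (‖g k‖ * M) := by
    intro j k _
    rw [mem_closedBall_zero_iff]
    exact ((g k).le_opNorm _).trans (mul_le_mul_of_nonneg_left (hv j) (norm_nonneg _))
  obtain ⟨y, -, hy⟩ := (isCompact_univ_pi fun k => isCompact_closedBall (0 : ℝ)
    (‖g k‖ * M)).ultrafilter_le_nhds (l.map x)
        (tendsto_principal.2 (Eventually.of_forall hb))
  have hx : Tendsto x l (𝓝 y) := hy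
  have h1 : Tendsto (fun p : ℕ × ℕ => ∑ k, (x p.1 k - x p.2 k) ^ 2) (l ×ˢ l : Filter (ℕ × ℕ))
      (𝓝 (∑ k, (y k - y k) ^ 2)) := by
    refine tendsto_finsetSum _ fun k _ => Tendsto.pow (Tendsto.sub ?_ ?_) 2
    · exact (tendsto_pi_nhds.1 hx k).comp tendsto_fst
    · exact (tendsto_pi_nhds.1 hx k).comp tendsto_snd
  simpa [x] using h1

variable {a s : LinearMap.BilinForm ℝ X}

theorem form_sub_self_le (B : LinearMap.BilinForm ℝ X) (hp : ∀ v, 0 ≤ B v v) (u v : X) :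
    B (u - v) (u - v) ≤ 2 * B u u + 2 * B v v := by
  have h := hp (u + v)
  simp only [map_add, LinearMap.add_apply, map_sub, LinearMap.sub_apply] at h ⊢
  linarith

/-- A semidefinite form that is coercive up to finitely many functionals becomes coercive when a
form is added that makes it definite. -/
theorem exists_coercive [CompleteSpace X] {U : Submodule ℝ X} (hU : IsClosed (U : Set X))
    (hap : ∀ v, 0 ≤ a v v) (hsp : ∀ v, 0 ≤ s v v)
    (hac : Continuous fun v => a v v) (hsc : Continuous fun v => s v v)
    {C : ℝ} {n : ℕ} {g : Fin n → X →L[ℝ] ℝ}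
    (hG : ∀ v ∈ U, ‖v‖ ^ 2 ≤ C * (a v v + ∑ k, g k v ^ 2))
    (hdef : ∀ v ∈ U, a v v = 0 → s v v = 0 → v = 0) :
    ∃ C' : ℝ, 0 < C' ∧ ∀ v ∈ U, ‖v‖ ^ 2 ≤ C' * (a v v + s v v) := by
  by_contra! hcon
  -- If no constant works, there are unit vectors on which both forms tend to zero.
  have h1 : ∀ j : ℕ, ∃ v ∈ U, ‖v‖ = 1 ∧ a v v + s v v ≤ 1 / ((j : ℝ) + 1) := by
    intro j
    obtain ⟨v, hv, hlt⟩ := hcon (j + 1) (by positivity)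
    have hpos : 0 < ‖v‖ := by
      rcases (norm_nonneg v).eq_or_lt with h0 | h0
      · rw [← h0] at hlt
        have : 0 ≤ ((j : ℝ) + 1) * (a v v + s v v) :=
          mul_nonneg (by positivity) (add_nonneg (hap v) (hsp v))
        norm_num at hlt
        linarith
      · exact h0
    refine ⟨‖v‖⁻¹ • v, U.smul_mem _ hv, ?_, ?_⟩
    · rw [norm_smul, norm_inv, norm_norm, inv_mul_cancel₀ hpos.ne']
    · simp only [map_smul, LinearMap.smul_apply, smul_eq_mul]
      rw [le_div_iff₀ (by positivity)]
      have e : (‖v‖⁻¹ * (‖v‖⁻¹ * a v v) + ‖v‖⁻¹ * (‖v‖⁻¹ * s v v)) * ((j : ℝ) + 1) =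
          (((j : ℝ) + 1) * (a v v + s v v)) / ‖v‖ ^ 2 := by
        field_simp
      rw [e, div_le_one (by positivity)]
      exact hlt.le
  choose v hvU hv1 hvs using h1
  let l : Ultrafilter ℕ := hyperfilter ℕ
  have hl : (l : Filter ℕ) ≤ atTop := Nat.hyperfilter_le_atTop
  have hsum : Tendsto (fun j => a (v j) (v j) + s (v j) (v j)) l (𝓝 0) :=
    (squeeze_zero (fun j => add_nonneg (hap _) (hsp _)) hvs
      tendsto_one_div_add_atTop_nhds_zero_nat).mono_left hl
  have ha0 : Tendsto (fun j => a (v j) (v j)) l (𝓝 0) :=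
    squeeze_zero (fun j => hap _) (fun j => le_add_of_nonneg_right (hsp _)) hsum
  have hF := tendsto_sum_sq_sub l g (v := v) (M := 1) fun j => (hv1 j).le
  have hF2 : Tendsto (fun p : ℕ × ℕ => |C| * ((2 * a (v p.1) (v p.1) + 2 * a (v p.2) (v p.2)) +
      ∑ k, g k (v p.1 - v p.2) ^ 2)) (l ×ˢ l : Filter (ℕ × ℕ)) (𝓝 (|C| * ((2 * 0 + 2 * 0) + 0))) :=
    (((((ha0.comp tendsto_fst).const_mul 2).add ((ha0.comp tendsto_snd).const_mul 2)).add
      hF).const_mul |C|)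
  simp only [mul_zero, add_zero] at hF2
  -- Finitely many functionals are Cauchy along the ultrafilter and the energies vanish, so the
  -- sequence is Cauchy; its limit is a unit vector on which both forms vanish.
  obtain ⟨w, hw⟩ := exists_tendsto_of_norm_sub_sq_le hF2 fun j k => by
    refine (hG _ (U.sub_mem (hvU j) (hvU k))).trans ?_
    refine mul_le_mul (le_abs_self C) (add_le_add (form_sub_self_le a hap _ _) le_rfl) ?_
      (abs_nonneg C)
    exact add_nonneg (hap _) (Finset.sum_nonneg fun k _ => sq_nonneg _)
  have hwU : w ∈ U := hU.mem_of_tendsto hw (Eventually.of_forall hvU)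
  have hw1 : ‖w‖ = 1 := tendsto_nhds_unique hw.norm (by simp only [hv1]; exact tendsto_const_nhds)
  have hw0 : a w w + s w w = 0 :=
    tendsto_nhds_unique (((hac.tendsto w).comp hw).add ((hsc.tendsto w).comp hw)) hsum
  have := hdef w hwU (by linarith [hap w, hsp w]) (by linarith [hap w, hsp w])
  rw [this, norm_zero] at hw1
  exact zero_ne_one hw1

/-- The Rayleigh quotient of a coercive form against a compact form attains its minimum. -/
theorem exists_rayleigh_min [CompleteSpace X] {U : Submodule ℝ X} (hU : IsClosed (U : Set X))
    (hap : ∀ v, 0 ≤ a v v) (hsp : ∀ v, 0 ≤ s v v)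
    (hac : Continuous fun v => a v v) (hsc : Continuous fun v => s v v)
    {C : ℝ} (hC : ∀ v ∈ U, ‖v‖ ^ 2 ≤ C * (a v v + s v v))
    (hcpt : ∀ ε : ℝ, 0 < ε → ∃ (n : ℕ) (g : Fin n → X →L[ℝ] ℝ),
      ∀ v ∈ U, s v v ≤ ε * ‖v‖ ^ 2 + ∑ k, g k v ^ 2)
    (hne : ∃ v ∈ U, s v v ≠ 0) :
    ∃ w ∈ U, s w w = 1 ∧ ∀ v ∈ U, a w w * s v v ≤ a v v := by
  set R : Set ℝ := {t | ∃ v ∈ U, s v v = 1 ∧ a v v = t} with hR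
  have hnorm : ∀ v ∈ U, s v v ≠ 0 → ∃ v' ∈ U, s v' v' = 1 ∧ a v' v' = a v v / s v v := by
    intro v hv hs
    have hpos : 0 < s v v := lt_of_le_of_ne (hsp v) (Ne.symm hs)
    have hq : Real.sqrt (s v v) * Real.sqrt (s v v) = s v v := Real.mul_self_sqrt hpos.le
    have hq0 : Real.sqrt (s v v) ≠ 0 := (Real.sqrt_pos.2 hpos).ne'
    refine ⟨(Real.sqrt (s v v))⁻¹ • v, U.smul_mem _ hv, ?_, ?_⟩ <;>
    · simp only [map_smul, LinearMap.smul_apply, smul_eq_mul]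
      rw [← mul_assoc, ← mul_inv, hq]
      field_simp
  have hRne : R.Nonempty := by
    obtain ⟨v, hv, hs⟩ := hne
    obtain ⟨v', hv', h1, h2⟩ := hnorm v hv hs
    exact ⟨_, v', hv', h1, rfl⟩
  have hRb : BddBelow R := ⟨0, by rintro _ ⟨v, -, -, rfl⟩; exact hap v⟩
  set θ := sInf R with hθ
  have hθ0 : 0 ≤ θ := le_csInf hRne (by rintro _ ⟨v, -, -, rfl⟩; exact hap v)
  have hray : ∀ v ∈ U, θ * s v v ≤ a v v := by
    intro v hv
    by_cases hs : s v v = 0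
    · rw [hs, mul_zero]
      exact hap v
    · obtain ⟨v', hv', h1, h2⟩ := hnorm v hv hs
      have : θ ≤ a v v / s v v := csInf_le hRb ⟨v', hv', h1, h2⟩
      exact (le_div_iff₀ (lt_of_le_of_ne (hsp v) (Ne.symm hs))).1 this
  have hseq : ∀ j : ℕ, ∃ v ∈ U, s v v = 1 ∧ a v v ≤ θ + 1 / ((j : ℝ) + 1) := by
    intro j
    obtain ⟨_, ⟨v, hv, hs, rfl⟩, hlt⟩ := exists_lt_of_csInf_lt hRne
      (lt_add_of_pos_right θ (by positivity : (0 : ℝ) < 1 / ((j : ℝ) + 1)))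
    exact ⟨v, hv, hs, hlt.le⟩
  choose v hvU hv1 hva using hseq
  let l : Ultrafilter ℕ := hyperfilter ℕ
  have hl : (l : Filter ℕ) ≤ atTop := Nat.hyperfilter_le_atTop
  have hδ : Tendsto (fun j : ℕ => 1 / ((j : ℝ) + 1)) l (𝓝 0) :=
    tendsto_one_div_add_atTop_nhds_zero_nat.mono_left hl
  have haθ : Tendsto (fun j => a (v j) (v j)) l (𝓝 θ) := by
    refine tendsto_of_tendsto_of_tendsto_of_le_of_le tendsto_const_nhds
      (by simpa using hδ.const_add θ) (fun j => ?_) hva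
    have := hray _ (hvU j)
    rwa [hv1, mul_one] at this
  obtain ⟨M, hM0, hM⟩ : ∃ M : ℝ, 0 ≤ M ∧ ∀ j, ‖v j‖ ≤ M := by
    refine ⟨Real.sqrt (|C| * (θ + 1 + 1)), Real.sqrt_nonneg _, fun j => Real.le_sqrt_of_sq_le ?_⟩
    refine (hC _ (hvU j)).trans (mul_le_mul (le_abs_self C) ?_
      (add_nonneg (hap _) (hsp _)) (abs_nonneg C))
    rw [hv1]
    have : 1 / ((j : ℝ) + 1) ≤ 1 := by
      rw [div_le_one (by positivity)]
      linarith [(Nat.cast_nonneg j : (0 : ℝ) ≤ j)]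
    linarith [hva j]
  -- The minimizing sequence is bounded, and s is small against the norm up to finitely many
  -- functionals; hence it is Cauchy for s.
  have hs0 : Tendsto (fun p : ℕ × ℕ => s (v p.1 - v p.2) (v p.1 - v p.2))
      (l ×ˢ l : Filter (ℕ × ℕ)) (𝓝 0) := by
    rw [tendsto_order]
    refine ⟨fun b hb => Eventually.of_forall fun p => hb.trans_le (hsp _), fun b hb => ?_⟩
    have hpos : 0 < b / (2 * ((2 * M) ^ 2 + 1)) := by positivity
    obtain ⟨n, g, hg⟩ := hcpt _ hpos
    have hF := (tendsto_sum_sq_sub l g hM).eventually (gt_mem_nhds (half_pos hb))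
    filter_upwards [hF] with p hp
    have hn : ‖v p.1 - v p.2‖ ^ 2 ≤ (2 * M) ^ 2 := by
      refine pow_le_pow_left₀ (norm_nonneg _) ((norm_sub_le _ _).trans ?_) 2
      linarith [hM p.1, hM p.2]
    have h1 := hg _ (U.sub_mem (hvU p.1) (hvU p.2))
    have h2 : b / (2 * ((2 * M) ^ 2 + 1)) * ‖v p.1 - v p.2‖ ^ 2 ≤ b / 2 := by
      refine (mul_le_mul_of_nonneg_left hn hpos.le).trans ?_
      rw [div_mul_eq_mul_div, div_le_div_iff₀ (by positivity) (by norm_num)]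
      nlinarith
    linarith
  have hF2 : Tendsto (fun p : ℕ × ℕ => |C| * ((2 * (a (v p.1) (v p.1) - θ) +
      2 * (a (v p.2) (v p.2) - θ) + θ * s (v p.1 - v p.2) (v p.1 - v p.2)) +
      s (v p.1 - v p.2) (v p.1 - v p.2))) (l ×ˢ l : Filter (ℕ × ℕ))
      (𝓝 (|C| * ((2 * (θ - θ) + 2 * (θ - θ) + θ * 0) + 0))) :=
    ((((((haθ.comp tendsto_fst).sub_const θ).const_mul 2).add
      (((haθ.comp tendsto_snd).sub_const θ).const_mul 2)).add (hs0.const_mul θ)).add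
      hs0).const_mul |C|
  simp only [sub_self, mul_zero, add_zero] at hF2
  -- The parallelogram identity with a(v_j + v_k) ≥ θ s(v_j + v_k) bounds the energy of v_j - v_k by
  -- the excesses over θ plus θ s(v_j - v_k).
  obtain ⟨w, hw⟩ := exists_tendsto_of_norm_sub_sq_le hF2 fun j k => by
    refine (hC _ (U.sub_mem (hvU j) (hvU k))).trans ?_
    refine mul_le_mul (le_abs_self C) (add_le_add ?_ le_rfl) (add_nonneg (hap _) (hsp _))
      (abs_nonneg C)
    have h1 := hray _ (U.add_mem (hvU j) (hvU k))
    have h2 := hv1 j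
    have h3 := hv1 k
    simp only [map_add, LinearMap.add_apply, map_sub, LinearMap.sub_apply] at h1 ⊢
    nlinarith
  have hwU : w ∈ U := hU.mem_of_tendsto hw (Eventually.of_forall hvU)
  have hws : s w w = 1 := tendsto_nhds_unique ((hsc.tendsto w).comp hw)
    (by simp only [Function.comp_def, hv1]; exact tendsto_const_nhds)
  have hwa : a w w = θ := tendsto_nhds_unique ((hac.tendsto w).comp hw) haθ
  exact ⟨w, hwU, hws, fun v hv => hwa ▸ hray v hv⟩

/-- A minimizer of the Rayleigh quotient is an eigenvector. -/
theorem eigen_of_rayleigh_min (has : ∀ u v, a u v = a v u) (hss : ∀ u v, s u v = s v u)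
    {U : Submodule ℝ X} {w : X} (hw : w ∈ U) (hs1 : s w w = 1)
    (hmin : ∀ v ∈ U, a w w * s v v ≤ a v v) {v : X} (hv : v ∈ U) : a w v = a w w * s w v := by
  -- The form a - θs, with θ the minimum, is nonnegative on U and vanishes at w.
  have h := form_eq_zero_of_min (a - a w w • s)
    (fun u v => by simp [has u v, hss u v]) (u := w) (v := v) fun t => by
      have := hmin _ (U.add_mem hw (U.smul_mem t hv))
      simp only [LinearMap.sub_apply, LinearMap.smul_apply, smul_eq_mul] at this ⊢
      rw [hs1]
      linarith
  simp only [LinearMap.sub_apply, LinearMap.smul_apply, smul_eq_mul] at h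
  linarith

end Variational

end CEM

end

/-! ## The spectral gap of the discarded modes -/

noncomputable section

namespace CEM

open Filter Topology

variable {d : ℕ} {D : Set (Vec d)} {T : CoarseGrid D}

theorem form_sub_projection {X ι : Type*} [AddCommGroup X] [Module ℝ X] [Fintype ι] [DecidableEq ι]
    {s : LinearMap.BilinForm ℝ X} {φ : ι → X} (h : ∀ l k, s (φ l) (φ k) = if l = k then 1 else 0)
    (u : X) (k : ι) : s (u - ∑ l, s u (φ l) • φ l) (φ k) = 0 := by
  simp [map_sub, map_sum, LinearMap.sum_apply, h]

theorem form_sub_sum_of_orthogonal {X ι : Type*} [AddCommGroup X] [Module ℝ X] [Fintype ι]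
    {s : LinearMap.BilinForm ℝ X} {φ : ι → X} {w : X} (h : ∀ k, s w (φ k) = 0)
    (u : X) (c : ι → ℝ) : s w (u - ∑ l, c l • φ l) = s w u := by
  simp [map_sub, map_sum, h]

/-- The elastic form of the block `i` on `H¹(K_i)`. -/
def blockEnergy (c : Lame D) (T : CoarseGrid D) (i : Fin T.N) :
    LinearMap.BilinForm ℝ (Pair (volume.restrict (T.K i))) :=
  ((c.bddForm.mono (T.K_subset i)).form le_rfl).compl₁₂ (LinearMap.snd ℝ _ _) (LinearMap.snd ℝ _ _)

/-- The weighted form of the block `i` on `H¹(K_i)`. -/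
def blockMass (c : Lame D) (P : GridPartition T) (i : Fin T.N) :
    LinearMap.BilinForm ℝ (Pair (volume.restrict (T.K i))) :=
  (((massBddForm c P).mono (T.K_subset i)).form le_rfl).compl₁₂ (LinearMap.fst ℝ _ _)
    (LinearMap.fst ℝ _ _)

theorem blockEnergy_apply (c : Lame D) (i : Fin T.N) (u v : Pair (volume.restrict (T.K i))) :
    blockEnergy c T i u v = c.energy (T.K i) u.2 v.2 := rfl

theorem blockMass_apply (c : Lame D) (P : GridPartition T) (i : Fin T.N)
    (u v : Pair (volume.restrict (T.K i))) :
    blockMass c P i u v = massForm (weight c P) (T.K i) u.1 v.1 := rfl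

theorem blockEnergy_symm (c : Lame D) (i : Fin T.N) (u v : Pair (volume.restrict (T.K i))) :
    blockEnergy c T i u v = blockEnergy c T i v u := BddForm.form_symm _ le_rfl _ _

theorem blockMass_symm (c : Lame D) (P : GridPartition T) (i : Fin T.N)
    (u v : Pair (volume.restrict (T.K i))) :
    blockMass c P i u v = blockMass c P i v u := BddForm.form_symm _ le_rfl _ _

theorem blockEnergy_nonneg (c : Lame D) (i : Fin T.N) (v : Pair (volume.restrict (T.K i))) :
    0 ≤ blockEnergy c T i v v := BddForm.form_nonneg _ le_rfl _

theorem blockMass_nonneg (c : Lame D) (P : GridPartition T) (i : Fin T.N)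
    (v : Pair (volume.restrict (T.K i))) : 0 ≤ blockMass c P i v v := BddForm.form_nonneg _ le_rfl _

theorem continuous_blockEnergy (c : Lame D) (i : Fin T.N) :
    Continuous fun v => blockEnergy c T i v v :=
  (BddForm.continuous_form_self _ le_rfl).comp continuous_snd

theorem continuous_blockMass_left (c : Lame D) (P : GridPartition T) (i : Fin T.N)
    (w : Pair (volume.restrict (T.K i))) : Continuous fun v => blockMass c P i v w :=
  (BddForm.continuous_form _ le_rfl).comp (continuous_fst.prodMk continuous_const)

theorem continuous_blockMass (c : Lame D) (P : GridPartition T) (i : Fin T.N) :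
    Continuous fun v => blockMass c P i v v :=
  (BddForm.continuous_form_self _ le_rfl).comp continuous_fst

theorem fst_eq_zero_of_blockMass_eq_zero (c : Lame D) (P : GridPartition T)
    (hκ : ∀ᵐ x ∂volume.restrict D, 0 < weight c P x) (i : Fin T.N)
    {v : Pair (volume.restrict (T.K i))} (hv : blockMass c P i v v = 0) : v.1 = 0 := by
  have hκ' := ae_mono (Measure.restrict_mono (T.K_subset i) le_rfl) hκ
  have h1 : ∫ x in T.K i, weight c P x * inner ℝ (v.1 x) (v.1 x) = 0 := hv
  rw [integral_eq_zero_iff_of_nonneg_ae] at h1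
  · rw [Lp.eq_zero_iff_ae_eq_zero]
    filter_upwards [h1, hκ'] with x h2 h3
    have h4 : weight c P x * inner ℝ (v.1 x) (v.1 x) = 0 := h2
    simpa using (mul_eq_zero.1 h4).resolve_left h3.ne'
  · filter_upwards [hκ'] with x h3
    exact mul_nonneg h3.le real_inner_self_nonneg
  · exact ((massBddForm c P).mono (T.K_subset i)).integrable (Lp.memLp v.1) (Lp.memLp v.1)

theorem norm_sq_pair_le {α E F : Type*} [MeasurableSpace α] {ν : Measure α} [NormedAddCommGroup E]
    [NormedAddCommGroup F] (v : Lp E 2 ν × Lp F 2 ν) : ‖v‖ ^ 2 ≤ ‖v.1‖ ^ 2 + ‖v.2‖ ^ 2 := by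
  rw [Prod.norm_def]
  rcases max_cases ‖v.1‖ ‖v.2‖ with ⟨h, -⟩ | ⟨h, -⟩ <;> rw [h] <;> nlinarith [sq_nonneg ‖v.1‖, sq_nonneg ‖v.2‖]

theorem exists_rellich_block (T : CoarseGrid D) (i : Fin T.N) {ε : ℝ} (hε : 0 < ε) :
    ∃ (n : ℕ) (g : Fin n → Pair (volume.restrict (T.K i)) →L[ℝ] ℝ), ∀ v ∈ localSpace D (T.K i),
      ‖v.1‖ ^ 2 ≤ ε * ‖v.2‖ ^ 2 + ∑ k, g k v ^ 2 := by
  obtain ⟨n, g, hg⟩ := exists_rellich (D := D) (T.convex_K i) (T.isOpen_K i).measurableSet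
    (T.isBounded_K i) hε
  exact ⟨n, fun k => (innerSL ℝ (g k)).comp (ContinuousLinearMap.fst ℝ _ _), hg⟩

/-- Korn bounds the gradient by the energy and the L² norm; Rellich with ε = 1/(2(C+1)) lets half
the gradient absorb that L² norm. -/
theorem exists_garding (c : Lame D) (T : CoarseGrid D) (i : Fin T.N) :
    ∃ (C : ℝ) (n : ℕ) (g : Fin n → Pair (volume.restrict (T.K i)) →L[ℝ] ℝ),
      ∀ v ∈ localSpace D (T.K i), ‖v‖ ^ 2 ≤ C * (blockEnergy c T i v v + ∑ k, g k v ^ 2) := by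
  obtain ⟨C, hC, hkorn⟩ := exists_korn_localSpace c T i
  obtain ⟨n, g, hg⟩ := exists_rellich_block T i (ε := 1 / (2 * (C + 1))) (by positivity)
  refine ⟨2 * (C + 1), n, g, fun v hv => (norm_sq_pair_le v).trans ?_⟩
  have h1 : ‖v.2‖ ^ 2 ≤ C * (‖v.1‖ ^ 2 + blockEnergy c T i v v) := hkorn v hv
  have h2 := hg v hv
  have h3 : 0 ≤ blockEnergy c T i v v := blockEnergy_nonneg c i v
  have h4 : (C + 1) * (1 / (2 * (C + 1)) * ‖v.2‖ ^ 2) = ‖v.2‖ ^ 2 / 2 := by field_simp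
  have h5 : (C + 1) * ‖v.1‖ ^ 2 ≤ ‖v.2‖ ^ 2 / 2 + (C + 1) * ∑ k, g k v ^ 2 := by
    rw [← h4, ← mul_add]
    exact mul_le_mul_of_nonneg_left h2 (by positivity)
  linarith [sq_nonneg ‖v.1‖]

/-- The energy is blind to rigid motions, but as κ̃ > 0 a field without mass vanishes, and Korn then
removes its gradient. -/
theorem exists_coercive_block {c : Lame D} {P : GridPartition T}
    (hκ : ∀ᵐ x ∂volume.restrict D, 0 < weight c P x) (i : Fin T.N) :
    ∃ C : ℝ, 0 < C ∧ ∀ v ∈ localSpace D (T.K i),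
      ‖v‖ ^ 2 ≤ C * (blockEnergy c T i v v + blockMass c P i v v) := by
  obtain ⟨C, n, g, hG⟩ := exists_garding c T i
  refine exists_coercive (Submodule.isClosed_topologicalClosure _) (blockEnergy_nonneg c i)
    (blockMass_nonneg c P i) (continuous_blockEnergy c i) (continuous_blockMass c P i) hG
    fun v hv h1 h2 => ?_
  have h3 := fst_eq_zero_of_blockMass_eq_zero c P hκ i h2
  obtain ⟨C, hC, hkorn⟩ := exists_korn_localSpace c T i
  have h4 : ‖v.2‖ ^ 2 ≤ C * (‖v.1‖ ^ 2 + blockEnergy c T i v v) := hkorn v hv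
  rw [h1, h3, norm_zero] at h4
  have h5 : ‖v.2‖ = 0 := by nlinarith [norm_nonneg v.2]
  exact Prod.ext h3 (norm_eq_zero.1 h5)

/-- The weight is bounded, so the mass inherits compactness from the L² norm. -/
theorem exists_blockMass_le (c : Lame D) (P : GridPartition T) (i : Fin T.N) {ε : ℝ}
    (hε : 0 < ε) : ∃ (n : ℕ) (g : Fin n → Pair (volume.restrict (T.K i)) →L[ℝ] ℝ),
      ∀ v ∈ localSpace D (T.K i), blockMass c P i v v ≤ ε * ‖v‖ ^ 2 + ∑ k, g k v ^ 2 := by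
  obtain ⟨b, hb0, hb⟩ := ((massBddForm c P).mono (T.K_subset i)).form_self_le
    (ν := volume.restrict (T.K i)) le_rfl
  obtain ⟨n, g, hg⟩ := exists_rellich (D := D) (T.convex_K i) (T.isOpen_K i).measurableSet
    (T.isBounded_K i) (ε := ε / (b + 1)) (by positivity)
  refine ⟨n, fun k => (innerSL ℝ (Real.sqrt (b + 1) • g k)).comp (ContinuousLinearMap.fst ℝ _ _),
    fun v hv => ?_⟩
  have h1 : blockMass c P i v v ≤ b * ‖v.1‖ ^ 2 := hb v.1
  have h2 := mul_le_mul_of_nonneg_left (hg v hv) (by positivity : 0 ≤ b + 1)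
  have h3 : ∑ k, inner ℝ (Real.sqrt (b + 1) • g k) v.1 ^ 2 =
      (b + 1) * ∑ k, inner ℝ (g k) v.1 ^ 2 := by
    rw [Finset.mul_sum]
    refine Finset.sum_congr rfl fun k _ => ?_
    rw [real_inner_smul_left, mul_pow, Real.sq_sqrt (by positivity)]
  have h4 : (b + 1) * (ε / (b + 1) * ‖v.2‖ ^ 2) = ε * ‖v.2‖ ^ 2 := by field_simp
  have h5 : ‖v.2‖ ^ 2 ≤ ‖v‖ ^ 2 := pow_le_pow_left₀ (norm_nonneg _) (norm_snd_le v) 2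
  change _ ≤ ε * ‖v‖ ^ 2 + ∑ k, inner ℝ (Real.sqrt (b + 1) • g k) v.1 ^ 2
  rw [h3]
  rw [mul_add, h4] at h2
  have h6 := mul_le_mul_of_nonneg_left h5 hε.le
  linarith [sq_nonneg ‖v.1‖]

/-- The spectral gap: the energy controls the mass orthogonally to the selected eigenfunctions. -/
theorem AuxBasis.gap {c : Lame D} {P : GridPartition T}
    (hκ : ∀ᵐ x ∂volume.restrict D, 0 < weight c P x) (A : AuxBasis c P) {Λ : ℝ}
    (hΛ : Λ ∈ lowerBounds A.discarded) (i : Fin T.N) {v : Pair (volume.restrict (T.K i))}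
    (hv : v ∈ localSpace D (T.K i)) (hφ : ∀ k, blockMass c P i v (A.φ i k) = 0) :
    Λ * blockMass c P i v v ≤ blockEnergy c T i v v := by
  set a := blockEnergy c T i with ha
  set s := blockMass c P i with hs
  have hUc : IsClosed (localSpace D (T.K i) : Set (Pair (volume.restrict (T.K i)))) :=
    Submodule.isClosed_topologicalClosure _
  -- The closed complement of the selected modes, on which the Rayleigh quotient is minimized.
  let W : Submodule ℝ (Pair (volume.restrict (T.K i))) :=
    localSpace D (T.K i) ⊓ ⨅ k, LinearMap.ker (s.flip (A.φ i k))
  have hWmem : ∀ w, w ∈ W ↔ w ∈ localSpace D (T.K i) ∧ ∀ k, s w (A.φ i k) = 0 := fun w => by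
    simp [W, Submodule.mem_inf, Submodule.mem_iInf, LinearMap.mem_ker]
  have hWc : IsClosed (W : Set (Pair (volume.restrict (T.K i)))) := by
    have : (W : Set (Pair (volume.restrict (T.K i)))) =
        (localSpace D (T.K i) : Set _) ∩ ⋂ k, {w | s w (A.φ i k) = 0} := by
      ext w
      simp only [SetLike.mem_coe, hWmem, mem_inter_iff, mem_iInter, mem_ofPred_eq]
    rw [this]
    exact hUc.inter (isClosed_iInter fun k =>
      isClosed_eq (continuous_blockMass_left c P i _) continuous_const)
  obtain ⟨C, hC, hcoer⟩ := exists_coercive_block hκ i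
  by_cases hne : ∃ v ∈ W, s v v ≠ 0
  swap
  · have : s v v = 0 := by
      by_contra h
      exact hne ⟨v, (hWmem v).2 ⟨hv, hφ⟩, h⟩
    rw [this, mul_zero]
    exact blockEnergy_nonneg c i v
  have hWU : ∀ v ∈ W, v ∈ localSpace D (T.K i) := fun v hv => ((hWmem v).1 hv).1
  obtain ⟨w, hwW, hw1, hmin⟩ := exists_rayleigh_min hWc (blockEnergy_nonneg c i)
    (blockMass_nonneg c P i) (continuous_blockEnergy c i) (continuous_blockMass c P i)
    (fun v hv => hcoer v (hWU v hv)) (fun ε hε => by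
      obtain ⟨n, g, hg⟩ := exists_blockMass_le c P i hε
      exact ⟨n, g, fun v hv => hg v (hWU v hv)⟩) hne
  have hwφ := ((hWmem w).1 hwW).2
  -- Mass orthogonality to an eigenfunction implies energy orthogonality.
  have hortho : ∀ k, a w (A.φ i k) = 0 := fun k => by
    have h1 : a (A.φ i k) w = A.eig i k * s (A.φ i k) w := (A.eigenpair i k).2.2 w (hWU w hwW)
    rw [ha, blockEnergy_symm, ← ha, h1, hs, blockMass_symm, ← hs, hwφ, mul_zero]
  -- The minimizer satisfies the eigenvalue equation against W. Removing the selected modes from a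
  -- general test field changes neither side, so w is an eigenfunction on the whole local space, and
  -- a discarded one.
  have heig : IsEigenpair c P i (a w w) w := by
    refine ⟨hWU w hwW, ?_, fun u hu => ?_⟩
    · rintro rfl
      simp at hw1
    · have hφU : ∀ k, A.φ i k ∈ localSpace D (T.K i) := fun k => (A.eigenpair i k).1
      have hu'W : u - ∑ k, s u (A.φ i k) • A.φ i k ∈ W :=
        (hWmem _).2 ⟨Submodule.sub_mem _ hu (Submodule.sum_mem _ fun k _ =>
          Submodule.smul_mem _ _ (hφU k)), fun k => form_sub_projection (A.orthonormal i) u k⟩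
      have h1 := eigen_of_rayleigh_min (blockEnergy_symm c i) (blockMass_symm c P i) hwW hw1 hmin
        hu'W
      rwa [form_sub_sum_of_orthogonal hortho, form_sub_sum_of_orthogonal hwφ] at h1
  have hΛ' : Λ ≤ a w w := hΛ ⟨i, w, heig, hwφ⟩
  exact (mul_le_mul_of_nonneg_right hΛ' (blockMass_nonneg c P i v)).trans
    (hmin v ((hWmem v).2 ⟨hv, hφ⟩))

end CEM

end

/-! ## The block system of the coarse grid -/

noncomputable section

namespace CEM

open Filter Topology

variable {d : ℕ} {D : Set (Vec d)} {T : CoarseGrid D}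

theorem bessel_form {X ι : Type*} [AddCommGroup X] [Module ℝ X] [Fintype ι] [DecidableEq ι]
    {s : LinearMap.BilinForm ℝ X} (hs : ∀ u v, s u v = s v u) (hp : ∀ v, 0 ≤ s v v) {φ : ι → X}
    (h : ∀ l k, s (φ l) (φ k) = if l = k then 1 else 0) (u : X) :
    ∑ k, s u (φ k) ^ 2 ≤ s u u := by
  have h1 := hp (u - ∑ l, s u (φ l) • φ l)
  have h2 : s (u - ∑ l, s u (φ l) • φ l) (∑ l, s u (φ l) • φ l) = 0 := by
    rw [map_sum]
    refine Finset.sum_eq_zero fun k _ => ?_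
    rw [map_smul, form_sub_projection h, smul_zero]
  rw [map_sub, h2, sub_zero, hs, map_sub, map_sum] at h1
  simp only [map_smul, smul_eq_mul, ← pow_two] at h1
  linarith

theorem restrictPair_eq_of_ae {K : Set (Vec d)} {p q : Pair (volume : Measure (Vec d))}
    (h1 : p.1 =ᵐ[volume.restrict K] q.1) (h2 : p.2 =ᵐ[volume.restrict K] q.2) :
    restrictPair K p = restrictPair K q :=
  Prod.ext (Lp.ext ((restrictPair_fst K p).trans (h1.trans (restrictPair_fst K q).symm)))
    (Lp.ext ((restrictPair_snd K p).trans (h2.trans (restrictPair_snd K q).symm)))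

/-- Fields in `H¹₀(G)` vanish outside `G`. -/
theorem restrictPair_eq_zero {G K : Set (Vec d)} (hGK : Disjoint G K) (hK : MeasurableSet K)
    {v : Pair (volume : Measure (Vec d))} (hv : v ∈ H10 G) : restrictPair K v = 0 := by
  have h : (H10 G : Set (Pair (volume : Measure (Vec d)))) ⊆ restrictPair K ⁻¹' {0} := by
    refine closure_minimal ?_ (isClosed_singleton.preimage (continuous_restrictPair K))
    rintro p ⟨w, hw, hwc, hwG, h1, h2⟩
    have h0 : ∀ x ∈ K, x ∉ tsupport w := fun x hx h => Set.disjoint_left.1 hGK (hwG h) hx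
    rw [mem_preimage, mem_singleton_iff, ← map_zero (restrictPair K)]
    refine restrictPair_eq_of_ae ?_ ?_
    · filter_upwards [ae_restrict_of_ae h1, ae_restrict_mem hK,
        ae_restrict_of_ae (Lp.coeFn_zero (Vec d) 2 (volume : Measure (Vec d)))] with x hx hxK hx0
      rw [hx, image_eq_zero_of_notMem_tsupport (h0 x hxK), Prod.fst_zero, hx0, Pi.zero_apply]
    · filter_upwards [ae_restrict_of_ae h2, ae_restrict_mem hK,
        ae_restrict_of_ae (Lp.coeFn_zero (Grad d) 2 (volume : Measure (Vec d)))] with x hx hxK hx0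
      rw [hx, image_eq_zero_of_notMem_tsupport fun h => h0 x hxK (tsupport_fderiv_subset ℝ h),
        Prod.snd_zero, hx0, Pi.zero_apply]
  exact h hv

namespace CoarseGrid

variable (T)

theorem disjoint_K {i k : Fin T.N} (h : i ≠ k) : Disjoint (T.K i) (T.K k) :=
  T.interior_disjoint i k h

/-- A convex block with nonempty interior lies in the closure of its interior, and K k is open. -/
theorem disjoint_block_K {i k : Fin T.N} (h : i ≠ k) : Disjoint (T.block i) (T.K k) := by
  have h1 : T.block i ⊆ closure (T.K i) := by
    have := (T.convex_block i).closure_interior_eq_closure_of_nonempty_interior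
      (T.interior_nonempty i)
    rw [K, this]
    exact subset_closure
  exact ((T.disjoint_K h).closure_left (T.isOpen_K k)).mono_left h1

/-- Boundaries of convex sets are null, so integrals over D split into block integrals. -/
theorem ae_eq_iUnion_K : D =ᵐ[volume] ⋃ k, T.K k := by
  have h1 : (⋃ k, T.K k) ⊆ D := iUnion_subset fun k => T.K_subset k
  refine Filter.EventuallyLE.antisymm ?_ (LE.le.eventuallyLE h1)
  have h2 : (⋃ k, T.K k) =ᵐ[volume] ⋃ k, T.block k :=
    Filter.EventuallyEq.countable_iUnion fun k => T.K_ae_eq_block k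
  refine EventuallyLE.trans ?_ h2.symm.le
  rw [T.cover]
  exact LE.le.eventuallyLE subset_closure

theorem integral_eq_sum {F : Vec d → ℝ} (hF : IntegrableOn F D) :
    ∫ x in D, F x = ∑ k, ∫ x in T.K k, F x := by
  rw [setIntegral_congr_set T.ae_eq_iUnion_K]
  exact integral_iUnion_fintype (fun k => (T.isOpen_K k).measurableSet)
    (fun i k h => T.disjoint_K h) fun k => hF.mono_set (T.K_subset k)

theorem layer_subset_succ (i : Fin T.N) (m : ℕ) : T.layer i m ⊆ T.layer i (m + 1) := by
  intro k hk
  obtain ⟨x, hx⟩ := (T.interior_nonempty k).mono _root_.interior_subset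
  exact ⟨k, hk, x, hx, hx⟩

theorem layer_mono (i : Fin T.N) : Monotone (T.layer i) :=
  monotone_nat_of_le_succ (T.layer_subset_succ i)

theorem oversampled_mono (i : Fin T.N) : Monotone (T.oversampled i) := fun _ _ h =>
  inter_subset_inter_left _ (interior_mono (biUnion_subset_biUnion_left (T.layer_mono i h)))

theorem oversampled_subset (i : Fin T.N) (m : ℕ) : T.oversampled i m ⊆ D := inter_subset_right

theorem K_subset_oversampled {i k : Fin T.N} {m : ℕ} (hk : k ∈ T.layer i m) :
    T.K k ⊆ T.oversampled i m :=
  subset_inter (interior_mono (subset_biUnion_of_mem (u := fun k => T.block k) hk)) (T.K_subset k)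

theorem disjoint_oversampled_K {i k : Fin T.N} {m : ℕ} (hk : k ∉ T.layer i m) :
    Disjoint (T.oversampled i m) (T.K k) := by
  refine Set.disjoint_left.2 fun x hx hxk => ?_
  obtain ⟨l, hl, hxl⟩ := mem_iUnion₂.1 (_root_.interior_subset hx.1)
  exact Set.disjoint_left.1 (T.disjoint_block_K fun h : l = k => hk (h ▸ hl)) hxl hxk

end CoarseGrid

/-- The forms and constraints of the problem, block by block. -/
def AuxBasis.system {c : Lame D} {P : GridPartition T} (A : AuxBasis c P) :
    BlockSystem (Pair (volume : Measure (Vec d))) (Fin T.N) where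
  a k := (blockEnergy c T k).compl₁₂ (restrictPair (T.K k)) (restrictPair (T.K k))
  symm k _ _ := blockEnergy_symm c k _ _
  pos k _ := blockEnergy_nonneg c k _
  J := A.J
  ℓ k j := ((blockMass c P k).flip (A.φ k j)).comp (restrictPair (T.K k))
  V := H10 D

namespace AuxBasis

variable {c : Lame D} {P : GridPartition T} (A : AuxBasis c P)

theorem system_a (k : Fin T.N) (u v : Pair (volume : Measure (Vec d))) :
    A.system.a k u v = blockEnergy c T k (restrictPair (T.K k) u) (restrictPair (T.K k) v) := rfl

theorem system_ℓ (k : Fin T.N) (j : Fin (A.J k)) (v : Pair (volume : Measure (Vec d))) :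
    A.system.ℓ k j v = blockMass c P k (restrictPair (T.K k) v) (A.φ k j) := rfl

theorem system_a_eq (k : Fin T.N) (u v : Pair (volume : Measure (Vec d))) :
    A.system.a k u v = c.energy (T.K k) u.2 v.2 := by
  rw [system_a, blockEnergy_apply, Lame.energy_eq, Lame.energy_eq]
  refine integral_congr_ae ?_
  filter_upwards [restrictPair_snd (T.K k) u, restrictPair_snd (T.K k) v] with x h1 h2
  rw [h1, h2]

theorem system_ℓ_eq (k : Fin T.N) (j : Fin (A.J k)) (v : Pair (volume : Measure (Vec d))) :
    A.system.ℓ k j v = massForm (weight c P) (T.K k) v.1 (A.φ k j).1 := by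
  rw [system_ℓ, blockMass_apply, massForm, massForm]
  refine integral_congr_ae ?_
  filter_upwards [restrictPair_fst (T.K k) v] with x h1
  rw [h1]

theorem blockMass_restrictPair (k : Fin T.N) (v : Pair (volume : Measure (Vec d))) :
    blockMass c P k (restrictPair (T.K k) v) (restrictPair (T.K k) v) =
      massForm (weight c P) (T.K k) v.1 v.1 := by
  rw [blockMass_apply, massForm, massForm]
  refine integral_congr_ae ?_
  filter_upwards [restrictPair_fst (T.K k) v] with x h1
  rw [h1]

/-- The form and the constraints of a block depend only on the restriction to that block. -/
theorem system_a_congr {k : Fin T.N} {w v : Pair (volume : Measure (Vec d))}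
    (h : restrictPair (T.K k) w = restrictPair (T.K k) v) :
    (∀ u, A.system.a k w u = A.system.a k v u) ∧ ∀ j, A.system.ℓ k j w = A.system.ℓ k j v :=
  ⟨fun u => by rw [system_a, system_a, h], fun j =>
    congrArg (fun z => blockMass c P k z (A.φ k j)) h⟩

theorem system_a_zero {k : Fin T.N} {w : Pair (volume : Measure (Vec d))}
    (h : restrictPair (T.K k) w = 0) :
    (∀ u, A.system.a k w u = 0) ∧ ∀ j, A.system.ℓ k j w = 0 :=
  ⟨fun u => by rw [system_a, h, map_zero, LinearMap.zero_apply],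
    fun j => (congrArg (fun z => blockMass c P k z (A.φ k j)) h).trans (by simp)⟩

theorem total_eq (u v : Pair (volume : Measure (Vec d))) :
    A.system.total u v = c.energy D u.2 v.2 := by
  rw [BlockSystem.total_apply, Lame.energy_eq, T.integral_eq_sum]
  · exact Finset.sum_congr rfl fun k _ => A.system_a_eq k u v
  · exact c.bddForm.integrable ((Lp.memLp u.2).mono_measure Measure.restrict_le_self)
      ((Lp.memLp v.2).mono_measure Measure.restrict_le_self)

theorem massForm_eq_sum (v : Pair (volume : Measure (Vec d))) :
    massForm (weight c P) D v.1 v.1 = ∑ k, massForm (weight c P) (T.K k) v.1 v.1 := by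
  rw [massForm_eq, T.integral_eq_sum]
  · rfl
  · exact (massBddForm c P).integrable ((Lp.memLp v.1).mono_measure Measure.restrict_le_self)
      ((Lp.memLp v.1).mono_measure Measure.restrict_le_self)

theorem system_bessel (k : Fin T.N) (v : Pair (volume : Measure (Vec d))) :
    ∑ j, A.system.ℓ k j v ^ 2 ≤ massForm (weight c P) (T.K k) v.1 v.1 := by
  rw [← blockMass_restrictPair]
  exact bessel_form (blockMass_symm c P k) (blockMass_nonneg c P k) (A.orthonormal k) _

theorem system_gap (hκ : ∀ᵐ x ∂volume.restrict D, 0 < weight c P x) {Λ : ℝ}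
    (hΛ : Λ ∈ lowerBounds A.discarded) {v : Pair (volume : Measure (Vec d))} (hv : v ∈ H10 D)
    (k : Fin T.N) (h : ∀ j, A.system.ℓ k j v = 0) :
    Λ * massForm (weight c P) (T.K k) v.1 v.1 ≤ A.system.a k v v := by
  rw [← blockMass_restrictPair]
  exact A.gap hκ hΛ k (restrictPair_mem_localSpace hv) h

end AuxBasis

end CEM

end

/-! ## Cutoff functions -/

noncomputable section

namespace CEM

open Filter Topology

variable {d : ℕ} {D : Set (Vec d)}

theorem BddForm.form_le_form {E F : Type*} [NormedAddCommGroup E] [NormedSpace ℝ E]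
    [NormedAddCommGroup F] [NormedSpace ℝ F] {G : Set (Vec d)} {ν : Measure (Vec d)}
    (Q : BddForm E G) (M : BddForm F G) (hν : volume.restrict G ≤ ν) {u u' : Lp E 2 ν}
    {v v' : Lp F 2 ν} (h : ∀ᵐ x ∂volume.restrict G, Q.q x (u x) (u' x) ≤ M.q x (v x) (v' x)) :
    Q.form hν u u' ≤ M.form hν v v' := by
  rw [form_apply, form_apply]
  exact integral_mono_ae (Q.integrable ((Lp.memLp u).mono_measure hν)
    ((Lp.memLp u').mono_measure hν)) (M.integrable ((Lp.memLp v).mono_measure hν)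
    ((Lp.memLp v').mono_measure hν)) h

theorem BddForm.q_smul {E : Type*} [NormedAddCommGroup E] [NormedSpace ℝ E] {G : Set (Vec d)}
    (Q : BddForm E G) (x : Vec d) (t : ℝ) (A : E) : Q.q x (t • A) (t • A) = t ^ 2 * Q.q x A A := by
  rw [Q.smul_left, Q.smul_right]
  ring

/-- Energy estimates for a field that is cut off. -/
theorem cutoff_estimates {K : Set (Vec d)} (Q : BddForm (Grad d) K) (M : BddForm (Vec d) K)
    {S : ℝ} (hS : 0 ≤ S) {L : ℝ≥0} {ζ : Vec d → ℝ} (hL : LipschitzWith L ζ)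
    (hζ : ∀ x, ζ x ∈ Icc (0 : ℝ) 1)
    (hgrad : ∀ᵐ x ∂volume.restrict K, ∀ a : Vec d,
      Q.q x ((fderiv ℝ ζ x).smulRight a) ((fderiv ℝ ζ x).smulRight a) ≤ S * M.q x a a)
    {p q : Pair (volume : Measure (Vec d))} (hq : IsMul ζ p q) :
    let a := Q.form (Measure.restrict_le_self (μ := volume))
    let s := M.form (Measure.restrict_le_self (μ := volume))
    Real.sqrt (a q.2 q.2) ≤ Real.sqrt (a p.2 p.2) + Real.sqrt S * Real.sqrt (s p.1 p.1) ∧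
    Real.sqrt (a (p.2 - q.2) (p.2 - q.2)) ≤
      Real.sqrt (a p.2 p.2) + Real.sqrt S * Real.sqrt (s p.1 p.1) ∧
    s q.1 q.1 ≤ s p.1 p.1 ∧
    -(Real.sqrt S * (Real.sqrt (a p.2 p.2) * Real.sqrt (s p.1 p.1))) ≤ a p.2 (p.2 - q.2) := by
  intro a s
  have has : ∀ u v, a u v = a v u := Q.form_symm _
  have hap : ∀ v, 0 ≤ a v v := Q.form_nonneg _
  -- The gradient of ζp splits into e = ζ∇p, which does not increase the energy, and ∇ζ ⊗ p, which
  -- is paid by the mass.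
  have hE : MemLp (fun x => ζ x • p.2 x) 2 (volume : Measure (Vec d)) := by
    refine (Lp.memLp p.2).mono (hL.continuous.aestronglyMeasurable.smul
      (Lp.aestronglyMeasurable _)) (ae_of_all _ fun x => ?_)
    rw [norm_smul]
    exact mul_le_of_le_one_left (norm_nonneg _) (abs_le.2 ⟨by linarith [(hζ x).1], (hζ x).2⟩)
  set e := hE.toLp with he
  have h1 : ∀ᵐ x ∂volume.restrict K, e x = ζ x • p.2 x := ae_restrict_of_ae hE.coeFn_toLp
  have h2 : ∀ᵐ x ∂volume.restrict K, (p.2 - e) x = (1 - ζ x) • p.2 x := by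
    filter_upwards [h1, ae_restrict_of_ae (Lp.coeFn_sub p.2 e)] with x h1 h2
    rw [h2, Pi.sub_apply, h1]
    ext v i
    simp
    ring
  have h3 : ∀ᵐ x ∂volume.restrict K, (q.2 - e) x = (fderiv ℝ ζ x).smulRight (p.1 x) := by
    filter_upwards [h1, ae_restrict_of_ae (Lp.coeFn_sub q.2 e), ae_restrict_of_ae hq.2]
      with x h1 h2 h3
    rw [h2, Pi.sub_apply, h1, h3, add_sub_cancel_left]
  have e1 : a e e ≤ a p.2 p.2 := by
    refine Q.form_le_form Q _ ?_
    filter_upwards [h1, Q.nonneg] with x h1 h0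
    rw [h1, Q.q_smul]
    exact mul_le_of_le_one_left (h0 _) (pow_le_one₀ (hζ x).1 (hζ x).2)
  have e2 : a (p.2 - e) (p.2 - e) ≤ a p.2 p.2 := by
    refine Q.form_le_form Q _ ?_
    filter_upwards [h2, Q.nonneg] with x h1 h0
    rw [h1, Q.q_smul]
    exact mul_le_of_le_one_left (h0 _) (pow_le_one₀ (by linarith [(hζ x).2]) (by linarith [(hζ x).1]))
  -- This sign removes the main term from the lower bound; only the contribution of ∇ζ remains.
  have e3 : 0 ≤ a p.2 (p.2 - e) := by
    refine integral_nonneg_of_ae ?_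
    filter_upwards [h2, Q.nonneg] with x h1 h0
    rw [h1, Q.smul_right]
    exact mul_nonneg (by linarith [(hζ x).2]) (h0 _)
  have hsS : 0 ≤ s p.1 p.1 := M.form_nonneg _ _
  have e4 : a (q.2 - e) (q.2 - e) ≤ S * s p.1 p.1 := by
    have : S * s p.1 p.1 = s (Real.sqrt S • p.1) (Real.sqrt S • p.1) := by
      simp only [map_smul, LinearMap.smul_apply, smul_eq_mul]
      rw [← mul_assoc, Real.mul_self_sqrt hS]
    rw [this]
    refine Q.form_le_form M _ ?_
    filter_upwards [h3, hgrad, ae_restrict_of_ae (Lp.coeFn_smul (Real.sqrt S) p.1)] with x h1 h2 h3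
    rw [h1, h3, Pi.smul_apply, M.q_smul, Real.sq_sqrt hS]
    exact h2 _
  have e5 : Real.sqrt (a (q.2 - e) (q.2 - e)) ≤ Real.sqrt S * Real.sqrt (s p.1 p.1) := by
    rw [← Real.sqrt_mul hS]
    exact Real.sqrt_le_sqrt e4
  refine ⟨?_, ?_, ?_, ?_⟩
  · have := sqrt_form_add_le a has hap e (q.2 - e)
    rw [add_sub_cancel] at this
    linarith [Real.sqrt_le_sqrt e1]
  · have := sqrt_form_sub_le a has hap (p.2 - e) (q.2 - e)
    rw [sub_sub_sub_cancel_right] at this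
    linarith [Real.sqrt_le_sqrt e2]
  · refine M.form_le_form M _ ?_
    filter_upwards [ae_restrict_of_ae hq.1, M.nonneg] with x h1 h0
    rw [h1, M.q_smul]
    exact mul_le_of_le_one_left (h0 _) (pow_le_one₀ (hζ x).1 (hζ x).2)
  · have h5 : p.2 - q.2 = (p.2 - e) - (q.2 - e) := by abel
    rw [h5, map_sub]
    have h6 := (abs_le.1 (form_le_sqrt_mul_sqrt a has hap p.2 (q.2 - e))).2
    have h7 := mul_le_mul_of_nonneg_left e5 (Real.sqrt_nonneg (a p.2 p.2))
    linarith

theorem sum_sq_strain_smulRight (ξ : Vec d →L[ℝ] ℝ) (a : Vec d) :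
    ∑ i, ∑ j, strain (ξ.smulRight a) i j ^ 2 ≤ ‖ξ‖ ^ 2 * ‖a‖ ^ 2 := by
  set g : Fin d → ℝ := fun i => ξ (EuclideanSpace.single i 1) with hg
  have hξ : ∀ v : Vec d, ξ v = ∑ i, v i * g i := by
    intro v
    have e : v = ∑ i, v i • EuclideanSpace.single i (1 : ℝ) := by
      ext j
      simp [Finset.sum_apply, Pi.single_apply]
    conv_lhs => rw [e]
    simp [map_sum, hg]
  have hG : ∑ i, g i ^ 2 ≤ ‖ξ‖ ^ 2 := by
    set γ : Vec d := WithLp.toLp 2 g with hγ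
    have h1 : ξ γ = ∑ i, g i ^ 2 := by
      rw [hξ]
      exact Finset.sum_congr rfl fun i _ => by simp [hγ, pow_two]
    have h2 : ‖γ‖ ^ 2 = ∑ i, g i ^ 2 := by
      rw [EuclideanSpace.norm_sq_eq]
      exact Finset.sum_congr rfl fun i _ => by simp [hγ]
    have h3 := (le_abs_self _).trans (ξ.le_opNorm γ)
    rw [h1, ← h2] at h3
    rw [← h2]
    rcases (norm_nonneg γ).eq_or_lt with h0 | h0
    · rw [← h0]
      nlinarith [sq_nonneg ‖ξ‖]
    · have : ‖γ‖ ≤ ‖ξ‖ := by nlinarith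
      exact pow_le_pow_left₀ h0.le this 2
  have hA : ‖a‖ ^ 2 = ∑ i, a i ^ 2 := by
    rw [EuclideanSpace.norm_sq_eq]
    exact Finset.sum_congr rfl fun i _ => by simp
  have hs : ∀ i j, strain (ξ.smulRight a) i j ^ 2 ≤
      (1 / 2 : ℝ) * (a i ^ 2 * g j ^ 2) + (1 / 2) * (a j ^ 2 * g i ^ 2) := by
    intro i j
    have : strain (ξ.smulRight a) i j = (g j * a i + g i * a j) / 2 := by
      simp [strain, hg]
    rw [this]
    nlinarith [sq_nonneg (g j * a i - g i * a j)]
  refine (Finset.sum_le_sum fun i _ => Finset.sum_le_sum fun j _ => hs i j).trans ?_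
  simp only [Finset.sum_add_distrib, ← Finset.mul_sum, ← Finset.sum_mul]
  rw [← hA]
  nlinarith [sq_nonneg ‖a‖]

theorem dvg_smulRight (ξ : Vec d →L[ℝ] ℝ) (a : Vec d) : dvg (ξ.smulRight a) = ξ a := by
  have e : a = ∑ i, a i • EuclideanSpace.single i (1 : ℝ) := by
    ext j
    simp [Finset.sum_apply, Pi.single_apply]
  conv_rhs => rw [e]
  simp [dvg, map_sum, mul_comm]

/-- On rank-one gradients the strain and the divergence are both bounded by |ξ||a|. This explains
the factor λ + 2μ in the weight. -/
theorem Lame.q_smulRight_le (c : Lame D) : ∀ᵐ x ∂volume.restrict D, ∀ (ξ : Vec d →L[ℝ] ℝ)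
    (a : Vec d), c.bddForm.q x (ξ.smulRight a) (ξ.smulRight a) ≤
      (c.lam x + 2 * c.mu x) * ‖ξ‖ ^ 2 * ‖a‖ ^ 2 := by
  obtain ⟨c₀, hc₀, hmu⟩ := c.mu_lower
  filter_upwards [c.lam_pos, hmu] with x hl hm ξ a
  have h1 := sum_sq_strain_smulRight ξ a
  have h2 : dvg (ξ.smulRight a) * dvg (ξ.smulRight a) ≤ ‖ξ‖ ^ 2 * ‖a‖ ^ 2 := by
    rw [dvg_smulRight, ← pow_two, ← mul_pow, ← sq_abs]
    exact pow_le_pow_left₀ (abs_nonneg _) (ξ.le_opNorm a) 2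
  have h3 : c.bddForm.q x (ξ.smulRight a) (ξ.smulRight a) =
      2 * c.mu x * ∑ i, ∑ j, strain (ξ.smulRight a) i j ^ 2 +
      c.lam x * (dvg (ξ.smulRight a) * dvg (ξ.smulRight a)) := by
    simp only [Lame.bddForm, pow_two]
  rw [h3]
  have h4 := mul_le_mul_of_nonneg_left h1 (by linarith : 0 ≤ 2 * c.mu x)
  have h5 := mul_le_mul_of_nonneg_left h2 hl.le
  linarith

/-! ### Cutoff functions from the partition of unity -/

variable {T : CoarseGrid D}

namespace GridPartition

/-- The cutoff function that belongs to a set of vertices. -/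
def cutoff (P : GridPartition T) (I : Finset (Fin T.Nc)) (x : Vec d) : ℝ :=
  -- The clamp matters outside D, where nothing bounds the sum; inside D it is inactive.
  max 0 (min 1 (∑ j ∈ I, P.χ j x))

theorem cutoff_mem_Icc (P : GridPartition T) (I : Finset (Fin T.Nc)) (x : Vec d) :
    P.cutoff I x ∈ Icc (0 : ℝ) 1 :=
  ⟨le_max_left _ _, max_le zero_le_one (min_le_left _ _)⟩

theorem exists_lipschitzWith_sum (P : GridPartition T) (I : Finset (Fin T.Nc)) :
    ∃ L : ℝ≥0, LipschitzWith L fun x => ∑ j ∈ I, P.χ j x := by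
  classical
  induction I using Finset.induction_on with
  | empty => exact ⟨0, by simp⟩
  | insert j I hj ih =>
    obtain ⟨L, hL⟩ := ih
    obtain ⟨L', hL'⟩ := P.lipschitz j
    refine ⟨L' + L, ?_⟩
    simp only [Finset.sum_insert hj]
    exact hL'.add hL

theorem exists_lipschitzWith_cutoff (P : GridPartition T) (I : Finset (Fin T.Nc)) :
    ∃ L : ℝ≥0, LipschitzWith L (P.cutoff I) := by
  obtain ⟨L, hL⟩ := P.exists_lipschitzWith_sum I
  exact ⟨L, (hL.const_min 1).const_max 0⟩

theorem cutoff_eq_sum (P : GridPartition T) (I : Finset (Fin T.Nc)) {x : Vec d} (hx : x ∈ D) :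
    P.cutoff I x = ∑ j ∈ I, P.χ j x := by
  have h0 : 0 ≤ ∑ j ∈ I, P.χ j x := Finset.sum_nonneg fun j _ => P.nonneg j x hx
  have h1 : ∑ j ∈ I, P.χ j x ≤ 1 := by
    rw [← P.sum_eq_one x hx]
    exact Finset.sum_le_sum_of_subset_of_nonneg (Finset.subset_univ I) fun j _ _ => P.nonneg j x hx
  rw [cutoff, min_eq_right h1, max_eq_right h0]

theorem cutoff_eq_one (P : GridPartition T) {I : Finset (Fin T.Nc)} {k : Fin T.N}
    (hI : ∀ j, T.vertex j ∈ T.block k → j ∈ I) {x : Vec d} (hx : x ∈ D) (hxk : x ∈ T.block k) :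
    P.cutoff I x = 1 := by
  rw [P.cutoff_eq_sum I hx, ← P.sum_eq_one x hx]
  exact Finset.sum_subset (Finset.subset_univ I) fun j _ hj =>
    P.support j k (fun h => hj (hI j h)) x hxk

theorem cutoff_eq_zero (P : GridPartition T) {I : Finset (Fin T.Nc)} {k : Fin T.N}
    (hI : ∀ j ∈ I, T.vertex j ∉ T.block k) {x : Vec d} (hxk : x ∈ T.block k) :
    P.cutoff I x = 0 := by
  have : ∑ j ∈ I, P.χ j x = 0 := Finset.sum_eq_zero fun j hj => P.support j k (hI j hj) x hxk
  rw [cutoff, this]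
  simp

/-- On a block only the functions of its own vertices are active, at most `nv` of them;
Cauchy–Schwarz for the sum of their gradients. -/
theorem sq_norm_fderiv_cutoff_le (P : GridPartition T) {nv : ℕ} (hnv : T.VertexBound nv)
    (I : Finset (Fin T.Nc)) (k : Fin T.N) : ∀ᵐ x ∂volume.restrict (T.K k),
      ‖fderiv ℝ (P.cutoff I) x‖ ^ 2 ≤ nv * ∑ j, ‖fderiv ℝ (P.χ j) x‖ ^ 2 := by
  classical
  have hdiff : ∀ᵐ x : Vec d, ∀ j, DifferentiableAt ℝ (P.χ j) x := by
    refine ae_all_iff.2 fun j => ?_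
    obtain ⟨L, hL⟩ := P.lipschitz j
    exact hL.ae_differentiableAt
  set I' : Finset (Fin T.Nc) := I.filter fun j => T.vertex j ∈ T.block k with hI'
  have hcard : (I'.card : ℝ) ≤ nv := by
    refine le_trans ?_ (Nat.cast_le.2 (hnv k))
    rw [← Set.ncard_coe_finset]
    refine Nat.cast_le.2 (Set.ncard_le_ncard (fun j hj => ?_) (Set.toFinite _))
    exact (Finset.mem_filter.1 hj).2
  filter_upwards [ae_restrict_mem (T.isOpen_K k).measurableSet, ae_restrict_of_ae hdiff]
    with x hx hd
  have hev : P.cutoff I =ᶠ[𝓝 x] fun y => ∑ j ∈ I', P.χ j y := by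
    filter_upwards [(T.isOpen_K k).mem_nhds hx] with y hy
    rw [P.cutoff_eq_sum I (T.K_subset k hy)]
    refine (Finset.sum_subset (Finset.filter_subset _ _) fun j hj hj' => ?_).symm
    refine P.support j k (fun h => hj' (Finset.mem_filter.2 ⟨hj, h⟩)) y (interior_subset hy)
  rw [hev.fderiv_eq, fderiv_fun_sum fun j _ => hd j]
  calc ‖∑ j ∈ I', fderiv ℝ (P.χ j) x‖ ^ 2 ≤ (∑ j ∈ I', ‖fderiv ℝ (P.χ j) x‖) ^ 2 :=
        pow_le_pow_left₀ (norm_nonneg _) (norm_sum_le _ _) 2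
    _ ≤ I'.card * ∑ j ∈ I', ‖fderiv ℝ (P.χ j) x‖ ^ 2 := sq_sum_le_card_mul_sum_sq
    _ ≤ nv * ∑ j, ‖fderiv ℝ (P.χ j) x‖ ^ 2 := by
        refine mul_le_mul hcard ?_ (by positivity) (by positivity)
        exact Finset.sum_le_sum_of_subset_of_nonneg (Finset.subset_univ _) fun j _ _ => by positivity

theorem q_fderiv_cutoff_le (c : Lame D) (P : GridPartition T) {nv : ℕ} (hnv : T.VertexBound nv)
    (I : Finset (Fin T.Nc)) (k : Fin T.N) : ∀ᵐ x ∂volume.restrict (T.K k), ∀ a : Vec d,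
      c.bddForm.q x ((fderiv ℝ (P.cutoff I) x).smulRight a)
        ((fderiv ℝ (P.cutoff I) x).smulRight a) ≤ nv * (massBddForm c P).q x a a := by
  obtain ⟨c₀, hc₀, hmu⟩ := c.mu_lower
  have hm := Measure.restrict_mono (T.K_subset k) (le_refl (volume : Measure (Vec d)))
  filter_upwards [P.sq_norm_fderiv_cutoff_le hnv I k, ae_mono hm c.q_smulRight_le,
    ae_mono hm c.lam_pos, ae_mono hm hmu] with x h1 h2 h3 h4 a
  refine (h2 _ a).trans ?_
  have h5 : (massBddForm c P).q x a a =
      (c.lam x + 2 * c.mu x) * (∑ j, ‖fderiv ℝ (P.χ j) x‖ ^ 2) * ‖a‖ ^ 2 := by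
    simp only [massBddForm, weight, real_inner_self_eq_norm_sq]
  rw [h5]
  have h6 := mul_le_mul_of_nonneg_left h1 (by linarith : 0 ≤ c.lam x + 2 * c.mu x)
  have h7 := mul_le_mul_of_nonneg_right h6 (sq_nonneg ‖a‖)
  linarith

end GridPartition

end CEM

end

/-! ## Stability of the constraints and the cutoff property -/

noncomputable section

namespace CEM

open Filter Topology

variable {d : ℕ} {D : Set (Vec d)} {T : CoarseGrid D}

theorem form_sum_smul_le {X ι : Type*} [AddCommGroup X] [Module ℝ X] [Fintype ι]
    {B : LinearMap.BilinForm ℝ X} (hs : ∀ u v, B u v = B v u) (hp : ∀ v, 0 ≤ B v v)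
    (v : ι → X) (b : ι → ℝ) :
    B (∑ i, b i • v i) (∑ i, b i • v i) ≤ (∑ i, B (v i) (v i)) * ∑ i, b i ^ 2 := by
  calc B (∑ i, b i • v i) (∑ i, b i • v i) = ∑ i, ∑ j, b i * (b j * B (v i) (v j)) := by
        simp only [map_sum, LinearMap.sum_apply, map_smul, LinearMap.smul_apply, smul_eq_mul]
        simp only [Finset.mul_sum]
        refine Finset.sum_congr rfl fun i _ => Finset.sum_congr rfl fun j _ => by
          rw [hs]
    _ ≤ ∑ i, ∑ j, (|b i| * Real.sqrt (B (v i) (v i))) * (|b j| * Real.sqrt (B (v j) (v j))) := by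
        refine Finset.sum_le_sum fun i _ => Finset.sum_le_sum fun j _ => ?_
        have h1 := form_le_sqrt_mul_sqrt B hs hp (v i) (v j)
        calc b i * (b j * B (v i) (v j)) ≤ |b i * (b j * B (v i) (v j))| := le_abs_self _
          _ = |b i| * (|b j| * |B (v i) (v j)|) := by rw [abs_mul, abs_mul]
          _ ≤ |b i| * (|b j| * (Real.sqrt (B (v i) (v i)) * Real.sqrt (B (v j) (v j)))) := by
              gcongr
          _ = _ := by ring
    _ = (∑ i, Real.sqrt (B (v i) (v i)) * |b i|) ^ 2 := by
        rw [pow_two, Finset.sum_mul_sum]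
        refine Finset.sum_congr rfl fun i _ => Finset.sum_congr rfl fun j _ => by ring
    _ ≤ (∑ i, Real.sqrt (B (v i) (v i)) ^ 2) * ∑ i, |b i| ^ 2 :=
        Finset.sum_mul_sq_le_sq_mul_sq _ _ _
    _ = _ := by simp only [Real.sq_sqrt (hp _), sq_abs]

theorem restrictPair_of_isMul_one {K : Set (Vec d)} (hK : IsOpen K) {ζ : Vec d → ℝ}
    (hζ : ∀ x ∈ K, ζ x = 1) {p q : Pair (volume : Measure (Vec d))} (h : IsMul ζ p q) :
    restrictPair K q = restrictPair K p := by
  refine restrictPair_eq_of_ae ?_ ?_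
  · filter_upwards [ae_restrict_of_ae h.1, ae_restrict_mem hK.measurableSet] with x h1 hx
    rw [h1, hζ x hx, one_smul]
  · filter_upwards [ae_restrict_of_ae h.2, ae_restrict_mem hK.measurableSet] with x h1 hx
    have : ζ =ᶠ[𝓝 x] fun _ => (1 : ℝ) := by
      filter_upwards [hK.mem_nhds hx] with y hy using hζ y hy
    rw [h1, hζ x hx, this.fderiv_eq]
    ext v i
    simp

theorem restrictPair_of_isMul_zero {K : Set (Vec d)} (hK : IsOpen K) {ζ : Vec d → ℝ}
    (hζ : ∀ x ∈ K, ζ x = 0) {p q : Pair (volume : Measure (Vec d))} (h : IsMul ζ p q) :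
    restrictPair K q = 0 := by
  rw [← map_zero (restrictPair K)]
  refine restrictPair_eq_of_ae ?_ ?_
  · filter_upwards [ae_restrict_of_ae h.1, ae_restrict_mem hK.measurableSet,
      ae_restrict_of_ae (Lp.coeFn_zero (Vec d) 2 (volume : Measure (Vec d)))] with x h1 hx h0
    rw [h1, hζ x hx, zero_smul, Prod.fst_zero, h0, Pi.zero_apply]
  · filter_upwards [ae_restrict_of_ae h.2, ae_restrict_mem hK.measurableSet,
      ae_restrict_of_ae (Lp.coeFn_zero (Grad d) 2 (volume : Measure (Vec d)))] with x h1 hx h0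
    have : ζ =ᶠ[𝓝 x] fun _ => (0 : ℝ) := by
      filter_upwards [hK.mem_nhds hx] with y hy using hζ y hy
    rw [h1, hζ x hx, this.fderiv_eq, Prod.snd_zero, h0, Pi.zero_apply]
    ext v i
    simp

/-- A field that is orthogonal, in the weighted inner product, to all the test fields on an open
set `K` vanishes there. -/
theorem massForm_self_eq_zero_of_orthogonal {c : Lame D} {P : GridPartition T} (i : Fin T.N)
    {φ : Pair (volume.restrict (T.K i))}
    (h : ∀ v ∈ H10 (T.K i), blockMass c P i (restrictPair (T.K i) v) φ = 0) :
    blockMass c P i φ φ = 0 := by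
  have hK := T.isOpen_K i
  have hm := Measure.restrict_mono (T.K_subset i) (le_refl (volume : Measure (Vec d)))
  obtain ⟨b, hb⟩ := weight_bound c P
  have hfin : IsFiniteMeasure (volume.restrict (T.K i)) :=
    ⟨by simpa using (T.isBounded_K i).measure_lt_top⟩
  have hφi : Integrable (fun x => φ.1 x) (volume.restrict (T.K i)) :=
    (Lp.memLp φ.1).integrable (by norm_num)
  have hint : IntegrableOn (fun x => weight c P x • φ.1 x) (T.K i) := by
    refine (hφi.norm.const_mul b).mono' (((weight_meas c P).aestronglyMeasurable.mono_measure
      hm).smul (Lp.aestronglyMeasurable _)) ?_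
    filter_upwards [ae_mono hm hb] with x hx
    rw [norm_smul, Real.norm_of_nonneg hx.1]
    exact mul_le_mul_of_nonneg_right hx.2 (norm_nonneg _)
  -- The fundamental lemma of the calculus of variations for κ̃φ, with test fields g e for scalar g
  -- and constant vectors e.
  have hzero : ∀ᵐ x, x ∈ T.K i → weight c P x • φ.1 x = 0 := by
    refine hK.ae_eq_zero_of_integral_contDiff_smul_eq_zero hint.locallyIntegrableOn
      fun g hg hgc hgK => ?_
    have hgint : Integrable (fun x => g x • (weight c P x • φ.1 x)) := by
      have hg1 : IntegrableOn (fun x => g x • (weight c P x • φ.1 x)) (T.K i) := by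
        obtain ⟨M, hM⟩ := hgc.exists_bound_of_continuous hg.continuous
        exact Integrable.bdd_smul hint M hg.continuous.aestronglyMeasurable (ae_of_all _ hM)
      refine hg1.integrable_of_forall_notMem_eq_zero fun x hx => ?_
      rw [image_eq_zero_of_notMem_tsupport fun h => hx (hgK h), zero_smul]
    have hinner : ∀ e : Vec d, inner ℝ e (∫ x, g x • (weight c P x • φ.1 x)) = 0 := by
      intro e
      rw [← integral_inner hgint]
      set w : Vec d → Vec d := fun x => g x • e with hw
      have hwc : ContDiff ℝ ∞ w := hg.smul contDiff_const
      have hws : HasCompactSupport w := hgc.smul_right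
      have hwK : tsupport w ⊆ T.K i := by
        refine (closure_mono fun x hx => ?_).trans hgK
        intro h0
        exact hx (by simp [hw, h0])
      have hw1 : MemLp w 2 (volume : Measure (Vec d)) := hwc.continuous.memLp_of_hasCompactSupport hws
      have hw2 : MemLp (fderiv ℝ w) 2 (volume : Measure (Vec d)) :=
        (hwc.continuous_fderiv (by simp)).memLp_of_hasCompactSupport (hws.fderiv ℝ)
      have hv := h (hw1.toLp, hw2.toLp) (testPairs_le_H10 _
        ⟨w, hwc, hws, hwK, hw1.coeFn_toLp, hw2.coeFn_toLp⟩)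
      rw [blockMass_apply, massForm] at hv
      rw [← hv, ← setIntegral_eq_integral_of_forall_compl_eq_zero (s := T.K i)]
      · refine integral_congr_ae ?_
        filter_upwards [restrictPair_fst (T.K i) (hw1.toLp, hw2.toLp),
          ae_restrict_of_ae hw1.coeFn_toLp] with x h1 h2
        rw [h1, h2, hw, real_inner_smul_left, real_inner_smul_right, real_inner_smul_right]
        ring
      · intro x hx
        rw [image_eq_zero_of_notMem_tsupport fun h => hx (hgK h), zero_smul, inner_zero_right]
    exact inner_self_eq_zero.1 (hinner _)
  rw [blockMass_apply, massForm]
  refine integral_eq_zero_of_ae ?_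
  filter_upwards [(ae_restrict_iff' hK.measurableSet).2 hzero] with x hx
  rw [Pi.zero_apply, ← real_inner_smul_left, hx, inner_zero_left]

namespace AuxBasis

variable {c : Lame D} {P : GridPartition T} (A : AuxBasis c P)

/-- If the constraint map on H¹₀(K_i) were not onto, some nontrivial combination of the
eigenfunctions would be orthogonal to all test fields. It would then have zero mass, against
orthonormality. -/
theorem exists_constraints_eq (i : Fin T.N) (b : Fin (A.J i) → ℝ) :
    ∃ v ∈ H10 (T.K i), ∀ j : Fin (A.J i), A.system.ℓ i j v = b j := by
  classical
  let Φ : Pair (volume : Measure (Vec d)) →ₗ[ℝ] (Fin (A.J i) → ℝ) :=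
    LinearMap.pi fun j => A.system.ℓ i j
  have htop : (H10 (T.K i)).map Φ = ⊤ := by
    by_contra hne
    obtain ⟨f, hf0, hf⟩ := Submodule.exists_le_ker_of_lt_top _ (lt_top_iff_ne_top.2 hne)
    set γ : Fin (A.J i) → ℝ := fun j => f (Pi.single j 1) with hγ
    have hfx : ∀ x, f x = ∑ j, x j * γ j := by
      intro x
      conv_lhs => rw [← Finset.univ_sum_single x]
      rw [map_sum]
      refine Finset.sum_congr rfl fun j _ => ?_
      have : Pi.single j (x j) = x j • (Pi.single j 1 : Fin (A.J i) → ℝ) := by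
        rw [← Pi.single_smul, smul_eq_mul, mul_one]
      rw [this, map_smul, smul_eq_mul]
    have h0 : blockMass c P i (∑ j, γ j • A.φ i j) (∑ j, γ j • A.φ i j) = 0 := by
      refine massForm_self_eq_zero_of_orthogonal i fun v hv => ?_
      have h1 : f (Φ v) = 0 := hf (Submodule.mem_map_of_mem hv)
      rw [hfx] at h1
      rw [map_sum, ← h1]
      refine Finset.sum_congr rfl fun j _ => ?_
      rw [map_smul, smul_eq_mul, mul_comm]
      rfl
    have h2 : blockMass c P i (∑ j, γ j • A.φ i j) (∑ j, γ j • A.φ i j) = ∑ j, γ j ^ 2 := by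
      have horth : ∀ l k, blockMass c P i (A.φ i l) (A.φ i k) = if l = k then 1 else 0 :=
        A.orthonormal i
      simp only [map_sum, LinearMap.sum_apply, map_smul, LinearMap.smul_apply, smul_eq_mul, horth]
      simp [pow_two]
    rw [h2] at h0
    refine hf0 (LinearMap.ext fun x => ?_)
    rw [hfx, LinearMap.zero_apply]
    refine Finset.sum_eq_zero fun j _ => ?_
    have := (Finset.sum_eq_zero_iff_of_nonneg fun j _ => sq_nonneg (γ j)).1 h0 j (Finset.mem_univ j)
    rw [pow_eq_zero_iff two_ne_zero] at this
    rw [this, mul_zero]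
  obtain ⟨v, hv, hvb⟩ : b ∈ (H10 (T.K i)).map Φ := htop ▸ Submodule.mem_top
  exact ⟨v, hv, fun j => congrFun hvb j⟩

/-- Lifts of the unit vectors give some finite constant. The set in `stabConst` is therefore
nonempty and its infimum is not the default value of an empty set. -/
theorem exists_stab : ∃ δ : ℝ, 0 ≤ δ ∧ ∀ (i : Fin T.N) (b : Fin (A.J i) → ℝ), ∃ v ∈ H10 (T.K i),
    (∀ j : Fin (A.J i), A.system.ℓ i j v = b j) ∧ A.system.total v v ≤ δ * ∑ j, b j ^ 2 := by
  classical
  choose v hv hvb using fun (i : Fin T.N) (j : Fin (A.J i)) =>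
    A.exists_constraints_eq i (Pi.single j 1)
  have hp := A.system.total_pos
  have hδ : ∀ i, 0 ≤ ∑ j, A.system.total (v i j) (v i j) := fun i =>
    Finset.sum_nonneg fun j _ => hp _
  refine ⟨∑ i, ∑ j, A.system.total (v i j) (v i j), Finset.sum_nonneg fun i _ => hδ i,
    fun i b => ⟨∑ j, b j • v i j, Submodule.sum_mem _ fun j _ => Submodule.smul_mem _ _ (hv i j),
      fun j => ?_, ?_⟩⟩
  · simp only [map_sum, map_smul, smul_eq_mul, hvb, Pi.single_apply]
    simp
  · refine (form_sum_smul_le A.system.total_symm hp _ _).trans ?_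
    refine mul_le_mul_of_nonneg_right ?_ (Finset.sum_nonneg fun j _ => sq_nonneg _)
    exact Finset.single_le_sum (fun i _ => hδ i) (Finset.mem_univ i)

theorem stabConst_nonneg : 0 ≤ A.stabConst := Real.sInf_nonneg fun _ h => h.1

/-- Stable local lifts of the constraints. -/
theorem exists_lift {S : ℝ} (hS : A.stabConst < S) (i : Fin T.N) (b : Fin (A.J i) → ℝ) :
    ∃ v ∈ H10 (T.K i), (∀ j : Fin (A.J i), A.system.ℓ i j v = b j) ∧ A.system.total v v ≤ S * ∑ j, b j ^ 2 := by
  -- The infimum need not be attained, hence the strict inequality for S.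
  obtain ⟨δ, ⟨-, h⟩, hδS⟩ := exists_lt_of_csInf_lt (by
    obtain ⟨δ, hδ, h⟩ := A.exists_stab
    refine ⟨δ, hδ, fun i b => ?_⟩
    obtain ⟨v, hv, h1, h2⟩ := h i b
    refine ⟨v, hv, fun j => ?_, ?_⟩
    · rw [← h1 j, system_ℓ_eq]
    · rwa [total_eq] at h2) hS
  obtain ⟨v, hv, h1, h2⟩ := h i b
  refine ⟨v, hv, fun j => ?_, ?_⟩
  · rw [← h1 j, system_ℓ_eq]
  · rw [total_eq]
    exact h2.trans (mul_le_mul_of_nonneg_right hδS.le (Finset.sum_nonneg fun j _ => sq_nonneg _))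

theorem system_zero_of_mem_H10_K {i k : Fin T.N} (h : i ≠ k) {v : Pair (volume : Measure (Vec d))}
    (hv : v ∈ H10 (T.K i)) : (∀ u, A.system.a k v u = 0) ∧ ∀ j, A.system.ℓ k j v = 0 :=
  A.system_a_zero (restrictPair_eq_zero (T.disjoint_K h) (T.isOpen_K k).measurableSet hv)

theorem system_zero_of_mem_H10_oversampled {i k : Fin T.N} {m : ℕ} (h : k ∉ T.layer i m)
    {v : Pair (volume : Measure (Vec d))} (hv : v ∈ H10 (T.oversampled i m)) :
    (∀ u, A.system.a k v u = 0) ∧ ∀ j, A.system.ℓ k j v = 0 :=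
  A.system_a_zero (restrictPair_eq_zero (T.disjoint_oversampled_K h)
    (T.isOpen_K k).measurableSet hv)

/-- Simultaneous lifts of constraints on a family of blocks. -/
theorem exists_lift_family {S : ℝ} (hS : A.stabConst < S) {i : Fin T.N} {m : ℕ}
    (B : Set (Fin T.N)) (hB : B ⊆ T.layer i m) (b : (k : Fin T.N) → Fin (A.J k) → ℝ) :
    ∃ v ∈ H10 (T.oversampled i m),
      (∀ k ∈ B, (∀ j, A.system.ℓ k j v = b k j) ∧ A.system.a k v v ≤ S * ∑ j, b k j ^ 2) ∧
      ∀ k, k ∉ B → (∀ j, A.system.ℓ k j v = 0) ∧ ∀ u, A.system.a k v u = 0 := by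
  classical
  choose v hv hvb hvS using fun k => A.exists_lift hS k (b k)
  have hr : ∀ {k l}, l ≠ k → restrictPair (T.K k) (v l) = 0 := fun h =>
    restrictPair_eq_zero (T.disjoint_K h) (T.isOpen_K _).measurableSet (hv _)
  refine ⟨∑ l ∈ Finset.univ.filter (· ∈ B), v l, Submodule.sum_mem _ fun l hl => ?_, ?_, ?_⟩
  · exact H10_mono (T.K_subset_oversampled (hB (Finset.mem_filter.1 hl).2)) (hv l)
  · intro k hk
    have h1 : restrictPair (T.K k) (∑ l ∈ Finset.univ.filter (· ∈ B), v l) =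
        restrictPair (T.K k) (v k) := by
      rw [map_sum]
      refine Finset.sum_eq_single k (fun l _ hl => hr hl) fun h => ?_
      exact absurd (Finset.mem_filter.2 ⟨Finset.mem_univ k, hk⟩) h
    obtain ⟨h2, h3⟩ := A.system_a_congr h1
    refine ⟨fun j => (h3 j).trans (hvb k j), ?_⟩
    rw [h2, A.system.symm, h2]
    refine le_trans ?_ (hvS k)
    rw [BlockSystem.total_apply]
    exact Finset.single_le_sum (fun l _ => A.system.pos l (v k)) (Finset.mem_univ k)
  · intro k hk
    have h1 : restrictPair (T.K k) (∑ l ∈ Finset.univ.filter (· ∈ B), v l) = 0 := by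
      rw [map_sum]
      refine Finset.sum_eq_zero fun l hl => hr fun h => ?_
      exact hk (h ▸ (Finset.mem_filter.1 hl).2)
    exact (A.system_a_zero h1).symm

/-- The cutoffs between consecutive layers of blocks. -/
theorem system_hasCutoff (hD : IsOpen D) (hκ : ∀ᵐ x ∂volume.restrict D, 0 < weight c P x) {Λ S : ℝ}
    (hΛ0 : 0 < Λ) (hΛ : Λ ∈ lowerBounds A.discarded) {nv : ℕ} (hnv : T.VertexBound nv)
    (hS : A.stabConst < S) (hnS : (nv : ℝ) ≤ S) (i : Fin T.N) (n : ℕ) :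
    A.system.HasCutoff (2 * Real.sqrt S / Real.sqrt Λ) (T.layer i n) (T.layer i (n + 1))
      (H10 (T.oversampled i (n + 1))) := by
  classical
  have hS0 : 0 ≤ S := A.stabConst_nonneg.trans hS.le
  refine BlockSystem.hasCutoff_of_cutoff_of_lift hΛ0 hS0
    (fun k v => massForm (weight c P) (T.K k) v.1 v.1)
    (fun v hv k h => A.system_gap hκ hΛ hv k h) A.system_bessel
    (fun b => A.exists_lift_family hS _ sdiff_subset b) fun v hv => ?_
  -- With all the vertices of layer n the cutoff equals 1 on that layer. It vanishes beyond layer n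
  -- + 1, because a block that shares a vertex with layer n touches it.
  set I : Finset (Fin T.Nc) := Finset.univ.filter fun j =>
    ∃ l ∈ T.layer i n, T.vertex j ∈ T.block l with hI
  obtain ⟨L, hL⟩ := P.exists_lipschitzWith_cutoff I
  have hIcc := P.cutoff_mem_Icc I
  obtain ⟨w, hw⟩ := exists_isMul hL (fun x => abs_le.2 ⟨by linarith [(hIcc x).1], (hIcc x).2⟩) v
  have hzero : ∀ k, k ∉ T.layer i (n + 1) → ∀ x ∈ T.block k, P.cutoff I x = 0 := by
    intro k hk x hx
    refine P.cutoff_eq_zero (k := k) (fun j hj hjk => ?_) hx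
    obtain ⟨l, hl, hjl⟩ := (Finset.mem_filter.1 hj).2
    exact hk ⟨l, hl, T.vertex j, hjl, hjk⟩
  have hwG : w ∈ H10 (T.oversampled i (n + 1)) := by
    refine isMul_mem_H10 hL hIcc (isOpen_interior.inter hD) (fun x hx hne => ⟨?_, hx⟩) hv hw
    -- The blocks outside the larger layer form a closed set F. Its complement in D is open and
    -- covered by the layer, so points off F are interior to the patch.
    set F : Set (Vec d) := ⋃ k ∈ (T.layer i (n + 1))ᶜ, T.block k with hF
    have hFc : IsClosed F := Set.Finite.isClosed_biUnion (Set.toFinite _) fun k _ =>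
      (T.isCompact_block k).isClosed
    have hxF : x ∉ F := by
      intro h
      obtain ⟨k, hk, hxk⟩ := mem_iUnion₂.1 h
      exact hne (hzero k hk x hxk)
    refine mem_interior.2 ⟨D \ F, fun y hy => ?_, hD.sdiff hFc, hx, hxF⟩
    have hyD : y ∈ ⋃ k, T.block k := T.cover ▸ subset_closure hy.1
    obtain ⟨k, hk⟩ := mem_iUnion.1 hyD
    refine mem_iUnion₂.2 ⟨k, ?_, hk⟩
    by_contra hkl
    exact hy.2 (mem_iUnion₂.2 ⟨k, hkl, hk⟩)
  refine ⟨w, hwG, fun k hk => ?_, fun k hk => ?_, fun k => ?_⟩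
  · refine A.system_a_congr (restrictPair_of_isMul_one (T.isOpen_K k) (fun x hx => ?_) hw)
    refine P.cutoff_eq_one (k := k) (fun j hj => ?_) (T.K_subset k hx) (interior_subset hx)
    exact Finset.mem_filter.2 ⟨Finset.mem_univ _, k, hk, hj⟩
  · exact A.system_a_zero (restrictPair_of_isMul_zero (T.isOpen_K k)
      (fun x hx => hzero k hk x (interior_subset hx)) hw)
  · have hgrad : ∀ᵐ x ∂volume.restrict (T.K k), ∀ a : Vec d,
        (c.bddForm.mono (T.K_subset k)).q x ((fderiv ℝ (P.cutoff I) x).smulRight a)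
          ((fderiv ℝ (P.cutoff I) x).smulRight a) ≤
            S * ((massBddForm c P).mono (T.K_subset k)).q x a a := by
      filter_upwards [P.q_fderiv_cutoff_le c hnv I k, ((massBddForm c P).mono (T.K_subset k)).nonneg]
        with x h1 h2 a
      exact (h1 a).trans (mul_le_mul_of_nonneg_right hnS (h2 a))
    have h := cutoff_estimates (c.bddForm.mono (T.K_subset k))
      ((massBddForm c P).mono (T.K_subset k)) hS0 hL hIcc hgrad hw
    simp only [system_a_eq]
    exact h

end AuxBasis

end CEM

end

/-! ## The size of the oversampled regions -/

noncomputable section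

namespace CEM

open Filter Topology

variable {d : ℕ} {D : Set (Vec d)} (T : CoarseGrid D)

namespace CoarseGrid

/-- A chain of n + 1 touching blocks of diameter at most H joins the two points. -/
theorem dist_le_of_mem_layer {H ρ : ℝ} (hT : T.QuasiUniform H ρ) {i : Fin T.N} {n : ℕ} :
    ∀ {k : Fin T.N}, k ∈ T.layer i n → ∀ x ∈ T.block k, ∀ y ∈ T.block i,
      dist x y ≤ (n + 1) * H := by
  have hdiam : ∀ k, ∀ x ∈ T.block k, ∀ y ∈ T.block k, dist x y ≤ H := fun k x hx y hy =>
    (Metric.dist_le_diam_of_mem (T.isCompact_block k).isBounded hx hy).trans (hT k).1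
  induction n with
  | zero =>
    rintro k rfl x hx y hy
    simpa using hdiam _ x hx y hy
  | succ n ih =>
    rintro k ⟨l, hl, z, hzl, hzk⟩ x hx y hy
    have h1 := hdiam k x hx z hzk
    have h2 := ih hl z hzl y hy
    have h3 := dist_triangle x z y
    push_cast
    linarith

open Classical in
/-- The number of oversampled regions that contain a given block. -/
theorem card_layer_le {H ρ : ℝ} (hH : 0 < H) (hρ : 0 < ρ) (hT : T.QuasiUniform H ρ) (k : Fin T.N)
    (n : ℕ) :
    ((Finset.univ.filter fun i => k ∈ T.layer i n).card : ℝ) ≤ ((n + 1) / ρ) ^ d := by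
  set I := Finset.univ.filter fun i => k ∈ T.layer i n with hI
  choose y hy using fun i => (hT i).2
  obtain ⟨x, hx⟩ := (T.interior_nonempty k).mono _root_.interior_subset
  have hsub : ∀ i, Metric.ball (y i) (ρ * H) ⊆ T.K i := fun i =>
    interior_maximal (Metric.ball_subset_closedBall.trans (hy i)) Metric.isOpen_ball
  -- Blocks whose patch contains block k lie within (n+1)H of it, and each owns a disjoint ball of
  -- radius ρH; the volumes bound their number.
  have hle : volume (⋃ i ∈ I, Metric.ball (y i) (ρ * H)) ≤
      volume (Metric.closedBall x ((n + 1) * H)) := by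
    refine measure_mono (iUnion₂_subset fun i hi z hz => ?_)
    rw [Metric.mem_closedBall, dist_comm]
    exact T.dist_le_of_mem_layer hT (Finset.mem_filter.1 hi).2 x hx z
      (_root_.interior_subset (hsub i hz))
  rw [measure_biUnion_finset (fun i _ l _ h => (T.disjoint_K h).mono (hsub i) (hsub l))
    fun i _ => Metric.isOpen_ball.measurableSet] at hle
  simp only [Measure.addHaar_ball_of_pos volume _ (mul_pos hρ hH), finrank_euclideanSpace_fin,
    Finset.sum_const, nsmul_eq_mul] at hle
  rw [Measure.addHaar_closedBall volume _ (by positivity), finrank_euclideanSpace_fin,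
    ← mul_assoc] at hle
  have hb0 : volume (Metric.ball (0 : Vec d) 1) ≠ 0 := (Metric.measure_ball_pos _ _ one_pos).ne'
  have hbt : volume (Metric.ball (0 : Vec d) 1) ≠ ⊤ := measure_ball_lt_top.ne
  rw [ENNReal.mul_le_mul_iff_left hb0 hbt, ← ENNReal.ofReal_natCast,
    ← ENNReal.ofReal_mul (by positivity), ENNReal.ofReal_le_ofReal_iff (by positivity)] at hle
  rw [div_pow, le_div_iff₀ (by positivity)]
  rw [mul_pow, mul_pow, ← mul_assoc] at hle
  exact le_of_mul_le_mul_right hle (by positivity)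

/-- A compact nonempty block has an extreme point, which is a grid vertex. This yields S ≥ 1. -/
theorem one_le_of_vertexBound {nv : ℕ} (h : T.VertexBound nv) (k : Fin T.N) : 1 ≤ nv := by
  refine le_trans ?_ (h k)
  obtain ⟨x, hx⟩ := (T.isCompact_block k).extremePoints_nonempty
    ((T.interior_nonempty k).mono _root_.interior_subset)
  have hx' : x ∈ range T.vertex := by
    rw [T.vertex_range]
    exact mem_iUnion.2 ⟨k, hx⟩
  obtain ⟨j, rfl⟩ := hx'
  exact (Set.ncard_pos (Set.toFinite _)).2 ⟨j, hx.1⟩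

end CoarseGrid

end CEM

end

/-! ## The error of the multiscale method -/

noncomputable section

namespace CEM

open Filter Topology

section Forms

variable {X : Type*} [AddCommGroup X] [Module ℝ X] (B : X →ₗ[ℝ] X →ₗ[ℝ] ℝ)

theorem form_sub_left (x y z : X) : B (x - y) z = B x z - B y z := by
  rw [map_sub B, LinearMap.sub_apply]

theorem form_self_le_add (hpos : ∀ x, 0 ≤ B x x) (hsymm : ∀ x y, B x y = B y x) {x y : X}
    (h : B x y = 0) : B x x ≤ B (x + y) (x + y) := by
  have e : B (x + y) (x + y) = B x x + B y y := by
    rw [map_add B, LinearMap.add_apply, map_add, map_add, h, hsymm y x, h]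
    ring
  rw [e]
  exact le_add_of_nonneg_right (hpos y)

/-- Used with x the Galerkin error and y its component in the global multiscale space, so that the
free field x - y can replace x. -/
theorem form_sub_eq {x y : X} (h1 : B x y = 0) (h2 : B y (x - y) = 0) :
    B x (x - y) = B x x ∧ B (x - y) (x - y) = B x x := by
  have h3 : B x (x - y) = B x x := by rw [map_sub, h1, sub_zero]
  exact ⟨h3, by rw [form_sub_left, h2, sub_zero, h3]⟩

theorem form_sum_smul_eq_zero {ι : Type*} [Fintype ι] (b : ι → ℝ) {x : ι → X} {v : X}
    (h : ∀ j, B (x j) v = 0) : B (∑ j, b j • x j) v = 0 := by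
  rw [map_sum, LinearMap.sum_apply]
  refine Finset.sum_eq_zero fun j _ => ?_
  rw [map_smul, LinearMap.smul_apply, h j, smul_zero]

end Forms

/-- With t the energy, s the mass and F the load, the gap bounds the mass and one factor √t cancels.
-/
theorem sqrt_le_of_le_mul {t s F Λ : ℝ} (hΛ : 0 < Λ) (ht : 0 ≤ t) (hF : 0 ≤ F) (h8 : Λ * s ≤ t)
    (h7 : t ≤ F * Real.sqrt s) : Real.sqrt t ≤ Λ ^ (-(1 / 2) : ℝ) * F := by
  have h9 : Real.sqrt s ≤ Λ ^ (-(1 / 2) : ℝ) * Real.sqrt t := by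
    rw [Real.rpow_neg hΛ.le, ← Real.sqrt_eq_rpow, ← Real.sqrt_inv, ← Real.sqrt_mul (by positivity)]
    refine Real.sqrt_le_sqrt ?_
    rwa [inv_mul_eq_div, le_div_iff₀ hΛ, mul_comm]
  have h10 : Real.sqrt t * Real.sqrt t ≤ (Λ ^ (-(1 / 2) : ℝ) * F) * Real.sqrt t := by
    rw [Real.mul_self_sqrt ht]
    refine h7.trans ((mul_le_mul_of_nonneg_left h9 hF).trans (le_of_eq ?_))
    ring
  rcases (Real.sqrt_nonneg t).eq_or_lt with h0 | h0
  · rw [← h0]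
    positivity
  · exact le_of_mul_le_mul_right h10 h0

variable {d : ℕ} {D : Set (Vec d)} {T : CoarseGrid D}

theorem normA_eq {c : Lame D} {P : GridPartition T} (A : AuxBasis c P)
    (v : Pair (volume : Measure (Vec d))) : normA c v = Real.sqrt (A.system.total v v) := by
  rw [normA, A.total_eq]

/-- The load against a field, in the dual weighted norms. -/
theorem integral_inner_le {c : Lame D} {P : GridPartition T}
    (hκ : ∀ᵐ x ∂volume.restrict D, 0 < weight c P x) {f : Vec d → Vec d}
    (hf : MemLp (fun x => weight c P x ^ (-(1 / 2) : ℝ) • f x) 2 (volume.restrict D))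
    (v : Pair (volume : Measure (Vec d))) :
    ∫ x in D, inner ℝ (f x) (v.1 x) ≤
      Real.sqrt (∫ x in D, ‖weight c P x ^ (-(1 / 2) : ℝ) • f x‖ ^ 2) *
        Real.sqrt (massForm (weight c P) D v.1 v.1) := by
  obtain ⟨b, hb⟩ := weight_bound c P
  have hv : MemLp v.1 2 (volume.restrict D) := (Lp.memLp v.1).mono_measure Measure.restrict_le_self
  have hg : MemLp (fun x => Real.sqrt (weight c P x) • v.1 x) 2 (volume.restrict D) := by
    refine (hv.const_smul (Real.sqrt b)).mono
      ((Real.continuous_sqrt.comp_aestronglyMeasurable (weight_meas c P).aestronglyMeasurable).smul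
        hv.1) ?_
    filter_upwards [hb] with x hx
    rw [Pi.smul_apply, norm_smul, norm_smul, Real.norm_of_nonneg (Real.sqrt_nonneg _),
      Real.norm_of_nonneg (Real.sqrt_nonneg _)]
    exact mul_le_mul_of_nonneg_right (Real.sqrt_le_sqrt hx.2) (norm_nonneg _)
  have e1 : ∫ x in D, inner ℝ (f x) (v.1 x) = inner ℝ hf.toLp hg.toLp := by
    rw [L2.inner_def]
    refine integral_congr_ae ?_
    filter_upwards [hκ, hf.coeFn_toLp, hg.coeFn_toLp] with x h1 h2 h3
    rw [h2, h3, real_inner_smul_left, real_inner_smul_right, Real.sqrt_eq_rpow, ← mul_assoc,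
      ← Real.rpow_add h1]
    norm_num
  have e2 : ‖hf.toLp‖ = Real.sqrt (∫ x in D, ‖weight c P x ^ (-(1 / 2) : ℝ) • f x‖ ^ 2) := by
    rw [← Real.sqrt_sq (norm_nonneg _), norm_sq_Lp]
    congr 1
    exact integral_congr_ae (hf.coeFn_toLp.mono fun x hx => by simp only [hx])
  have e3 : ‖hg.toLp‖ = Real.sqrt (massForm (weight c P) D v.1 v.1) := by
    rw [← Real.sqrt_sq (norm_nonneg _), norm_sq_Lp, massForm]
    congr 1
    refine integral_congr_ae ?_
    filter_upwards [hκ, hg.coeFn_toLp] with x h1 h2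
    rw [h2, norm_smul, mul_pow, Real.norm_of_nonneg (Real.sqrt_nonneg _), Real.sq_sqrt h1.le,
      real_inner_self_eq_norm_sq]
  rw [e1, ← e2, ← e3]
  exact real_inner_le_norm _ _

namespace AuxBasis

variable {c : Lame D} {P : GridPartition T} (A : AuxBasis c P)

theorem PhiOrthogonal.constraints {i : Fin T.N} {j : Fin (A.J i)}
    {ψ : Pair (volume : Measure (Vec d))} (h : A.PhiOrthogonal i j ψ) (k : Fin T.N)
    (l : Fin (A.J k)) :
    A.system.ℓ k l ψ = if (⟨k, l⟩ : Σ k, Fin (A.J k)) = ⟨i, j⟩ then 1 else 0 := by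
  rw [A.system_ℓ_eq k l]
  split_ifs with hkl
  · cases hkl
    exact h.1
  · exact h.2 k l hkl

theorem PhiOrthogonal.of_constraints {i : Fin T.N} {j : Fin (A.J i)}
    {ψ : Pair (volume : Measure (Vec d))} (h : ∀ (k : Fin T.N) (l : Fin (A.J k)),
      A.system.ℓ k l ψ = if (⟨k, l⟩ : Σ k, Fin (A.J k)) = ⟨i, j⟩ then 1 else 0) :
    A.PhiOrthogonal i j ψ := by
  refine ⟨?_, fun k l hkl => ?_⟩
  · rw [← A.system_ℓ_eq i j, h, if_pos rfl]
  · rw [← A.system_ℓ_eq k l, h, if_neg hkl]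

/-- The constrained minimizers are energy orthogonal to the unconstrained fields. -/
theorem IsConstrainedMin.total_eq_zero {W : Submodule ℝ (Pair (volume : Measure (Vec d)))}
    {i : Fin T.N} {j : Fin (A.J i)} {ψ : Pair (volume : Measure (Vec d))}
    (h : A.IsConstrainedMin W i j ψ) {v : Pair (volume : Measure (Vec d))} (hv : v ∈ W)
    (hfree : A.system.Free v) : A.system.total ψ v = 0 := by
  refine form_eq_zero_of_min _ A.system.total_symm fun t => ?_
  rw [total_eq, total_eq]
  refine h.2.2 _ (W.add_mem h.1 (W.smul_mem t hv)) (PhiOrthogonal.of_constraints A fun k l => ?_)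
  rw [map_add, map_smul, hfree k l, smul_zero, add_zero]
  exact PhiOrthogonal.constraints A h.2.1 k l

variable {W : Submodule ℝ (Pair (volume : Measure (Vec d)))}
  {ψ : (i : Fin T.N) → Fin (A.J i) → Pair (volume : Measure (Vec d))}

theorem constrainedAt_sum {i : Fin T.N} (h : ∀ j, A.PhiOrthogonal i j (ψ i j))
    (b : Fin (A.J i) → ℝ) : A.system.ConstrainedAt i b (∑ j, b j • ψ i j) := by
  classical
  refine ⟨fun (j : Fin (A.J i)) => ?_, fun k hk j => ?_⟩
  · rw [map_sum]
    have h1 : ∀ l, A.system.ℓ i j (b l • ψ i l) = if j = l then b l else 0 := fun l => by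
      rw [map_smul, PhiOrthogonal.constraints A (h l) i j, smul_eq_mul]
      by_cases hjl : j = l
      · subst hjl
        rw [if_pos rfl, if_pos rfl, mul_one]
      · have hne : (⟨i, j⟩ : Σ k, Fin (A.J k)) ≠ ⟨i, l⟩ := fun e => hjl (by cases e; rfl)
        rw [if_neg hjl, if_neg hne, mul_zero]
    exact (Finset.sum_congr rfl fun l _ => h1 l).trans
      ((Finset.sum_ite_eq Finset.univ j b).trans (if_pos (Finset.mem_univ j)))
  · rw [map_sum]
    refine Finset.sum_eq_zero fun l _ => ?_
    have h1 : A.system.ℓ k j (ψ i l) = 0 := by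
      rw [PhiOrthogonal.constraints A (h l) k j, if_neg]
      intro h2
      exact hk (congrArg Sigma.fst h2)
    rw [map_smul, h1, smul_zero]

/-- The combination of the basis fields with prescribed constraints. -/
theorem ℓ_sum_sum (h : ∀ i j, A.PhiOrthogonal i j (ψ i j)) (b : (i : Fin T.N) → Fin (A.J i) → ℝ)
    (k : Fin T.N) (l : Fin (A.J k)) : A.system.ℓ k l (∑ i, ∑ j, b i j • ψ i j) = b k l := by
  rw [map_sum, Finset.sum_eq_single k]
  · exact (A.constrainedAt_sum (h k) (b k)).1 l
  · intro i _ hi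
    exact (A.constrainedAt_sum (h i) (b i)).2 k (Ne.symm hi) l
  · exact fun h => absurd (Finset.mem_univ k) h

/-- The constraints are the dual functionals of the basis, so they return the coefficients. -/
theorem eq_sum_of_mem_span (h : ∀ i j, A.PhiOrthogonal i j (ψ i j))
    {v : Pair (volume : Measure (Vec d))}
    (hv : v ∈ Submodule.span ℝ (range fun p : Σ i, Fin (A.J i) => ψ p.1 p.2)) :
    v = ∑ i, ∑ j, A.system.ℓ i j v • ψ i j := by
  obtain ⟨b, rfl⟩ := (Submodule.mem_span_range_iff_exists_fun ℝ).1 hv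
  have e : ∑ p : Σ i, Fin (A.J i), b p • ψ p.1 p.2 = ∑ i, ∑ j, b ⟨i, j⟩ • ψ i j :=
    Fintype.sum_sigma _
  rw [e]
  refine Finset.sum_congr rfl fun i _ => Finset.sum_congr rfl fun j _ => ?_
  exact congrArg (· • ψ i j) (A.ℓ_sum_sum h (fun i j => b ⟨i, j⟩) i j).symm

theorem sum_mem_span (b : (i : Fin T.N) → Fin (A.J i) → ℝ) :
    ∑ i, ∑ j, b i j • ψ i j ∈
      Submodule.span ℝ (range fun p : Σ i, Fin (A.J i) => ψ p.1 p.2) :=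
  Submodule.sum_mem _ fun i _ => Submodule.sum_mem _ fun j _ =>
    Submodule.smul_mem _ _ (Submodule.subset_span ⟨⟨i, j⟩, rfl⟩)

theorem mass_le_of_free (hκ : ∀ᵐ x ∂volume.restrict D, 0 < weight c P x) {Λ : ℝ}
    (hΛ : Λ ∈ lowerBounds A.discarded) {v : Pair (volume : Measure (Vec d))} (hv : v ∈ H10 D)
    (hfree : A.system.Free v) : Λ * massForm (weight c P) D v.1 v.1 ≤ A.system.total v v := by
  rw [massForm_eq_sum, BlockSystem.total_apply, Finset.mul_sum]
  exact Finset.sum_le_sum fun k _ => A.system_gap hκ hΛ hv k (hfree k)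

/-- The error of the global multiscale method. -/
theorem normA_sub_glo_le (hκ : ∀ᵐ x ∂volume.restrict D, 0 < weight c P x) {Λ : ℝ} (hΛ0 : 0 < Λ)
    (hΛ : Λ ∈ lowerBounds A.discarded) (hψ : ∀ i j, A.IsConstrainedMin (H10 D) i j (ψ i j))
    {f : Vec d → Vec d}
    (hf : MemLp (fun x => weight c P x ^ (-(1 / 2) : ℝ) • f x) 2 (volume.restrict D))
    {u uglo : Pair (volume : Measure (Vec d))} (hu : IsGalerkin c f (H10 D) u)
    (hglo : IsGalerkin c f (Submodule.span ℝ (range fun p : Σ i, Fin (A.J i) => ψ p.1 p.2)) uglo) :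
    normA c (u - uglo) ≤ Λ ^ (-(1 / 2) : ℝ) *
      Real.sqrt (∫ x in D, ‖weight c P x ^ (-(1 / 2) : ℝ) • f x‖ ^ 2) := by
  set Vg := Submodule.span ℝ (range fun p : Σ i, Fin (A.J i) => ψ p.1 p.2) with hVg
  have hφ : ∀ i j, A.PhiOrthogonal i j (ψ i j) := fun i j => (hψ i j).2.1
  have hVgV : Vg ≤ H10 D := by
    refine Submodule.span_le.2 ?_
    rintro _ ⟨p, rfl⟩
    exact (hψ p.1 p.2).1
  have horth : ∀ w ∈ Vg, ∀ v ∈ H10 D, A.system.Free v → A.system.total w v = 0 := by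
    intro w hw v hv hfree
    rw [A.eq_sum_of_mem_span hφ hw, map_sum, LinearMap.sum_apply]
    exact Finset.sum_eq_zero fun i _ => form_sum_smul_eq_zero _ _ fun j =>
      IsConstrainedMin.total_eq_zero A (hψ i j) hv hfree
  set e := u - uglo with he
  -- The element of the global space with the constraint values of the error: e - e' is free, while
  -- e is orthogonal to e'.
  set e' := ∑ i, ∑ j, A.system.ℓ i j e • ψ i j with he'
  have heV : e ∈ H10 D := Submodule.sub_mem _ hu.1 (hVgV hglo.1)
  have he'g : e' ∈ Vg := A.sum_mem_span _
  have hfree : A.system.Free (e - e') := fun k l => by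
    rw [map_sub, sub_eq_zero]
    exact (A.ℓ_sum_sum hφ (fun i j => A.system.ℓ i j e) k l).symm
  have hdV : e - e' ∈ H10 D := Submodule.sub_mem _ heV (hVgV he'g)
  have h1 : A.system.total e e' = 0 := by
    rw [he, form_sub_left, A.total_eq, A.total_eq, hu.2 _ (hVgV he'g), hglo.2 _ he'g, sub_self]
  obtain ⟨h4, h6⟩ := form_sub_eq A.system.total h1 (horth _ he'g _ hdV hfree)
  -- Free fields do not see `uglo`, so the error tested with one equals the load.
  have h5 : A.system.total e (e - e') = ∫ x in D, inner ℝ (f x) ((e - e').1 x) := by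
    conv_lhs => rw [he, form_sub_left, ← he]
    rw [horth _ hglo.1 _ hdV hfree, sub_zero, A.total_eq, hu.2 _ hdV]
  have h7 := integral_inner_le hκ hf (e - e')
  have h8 := A.mass_le_of_free hκ hΛ hdV hfree
  rw [h6] at h8
  rw [← h5, h4] at h7
  rw [normA_eq A]
  exact sqrt_le_of_le_mul hΛ0 (A.system.total_pos e) (Real.sqrt_nonneg _) h8 h7

/-- The localization error of a combination of basis fields, for a given stability constant. -/
theorem total_sub_localized_le (hD : IsOpen D)
    (hκ : ∀ᵐ x ∂volume.restrict D, 0 < weight c P x) {Λ S : ℝ} (hΛ0 : 0 < Λ)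
    (hΛ : Λ ∈ lowerBounds A.discarded) {nv : ℕ} (hnv : T.VertexBound nv)
    (hS : A.stabConst < S) (hnS : (nv : ℝ) ≤ S) (hS1 : 1 ≤ S) {H ρ : ℝ} (hH : 0 < H) (hρ : 0 < ρ)
    (hT : T.QuasiUniform H ρ) {m : ℕ}
    {ψms : (i : Fin T.N) → Fin (A.J i) → Pair (volume : Measure (Vec d))}
    (hψ : ∀ i j, A.IsConstrainedMin (H10 D) i j (ψ i j))
    (hψms : ∀ i j, A.IsConstrainedMin (H10 (T.oversampled i m)) i j (ψms i j))
    (b : (i : Fin T.N) → Fin (A.J i) → ℝ) :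
    A.system.total (∑ i, ∑ j, b i j • ψ i j - ∑ i, ∑ j, b i j • ψms i j)
      (∑ i, ∑ j, b i j • ψ i j - ∑ i, ∑ j, b i j • ψms i j) ≤
    256 * (((m + 1 : ℕ) + 1) / ρ) ^ d * decayE Λ S m * ∑ i, ∑ j, b i j ^ 2 := by
  classical
  set γ := 2 * Real.sqrt S / Real.sqrt Λ with hγ
  have hS0 : 0 < S := by linarith
  have hγ0 : 0 < γ := by positivity
  set M : ℝ := (((m + 1 : ℕ) + 1) / ρ) ^ d with hM
  have hM0 : 0 ≤ M := by positivity
  have hcut := A.system_hasCutoff hD hκ hΛ0 hΛ hnv hS hnS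
  have hWV : ∀ i n, H10 (T.oversampled i n) ≤ H10 D := fun i n => H10_mono (T.oversampled_subset i n)
  have hloc : ∀ i, A.system.total (∑ j, b i j • ψ i j - ∑ j, b i j • ψms i j)
      (∑ j, b i j • ψ i j - ∑ j, b i j • ψms i j) ≤
      4 * (1 + γ) ^ 2 * S * (1 + γ⁻¹) ^ (1 - (m : ℝ)) * ∑ j, b i j ^ 2 := by
    intro i
    refine BlockSystem.energy_sub_localized_le (Q := A.system) hγ0 (T.layer_mono i) rfl (hWV i)
      (fun n n' h => H10_mono (T.oversampled_mono i h)) (hcut i) ?_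
      (Submodule.sum_mem _ fun j _ => Submodule.smul_mem _ _ (hψ i j).1)
      (A.constrainedAt_sum (fun j => (hψ i j).2.1) (b i)) ?_
      (Submodule.sum_mem _ fun j _ => Submodule.smul_mem _ _ (hψms i j).1)
      (A.constrainedAt_sum (fun j => (hψms i j).2.1) (b i)) ?_
    · obtain ⟨v, hv, h1, h2⟩ := A.exists_lift hS i (b i)
      exact ⟨v, H10_mono (T.K_subset_oversampled rfl) hv, ⟨h1, fun k hk =>
        (A.system_zero_of_mem_H10_K (Ne.symm hk) hv).2⟩, h2⟩
    · intro v hv hfree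
      exact form_sum_smul_eq_zero _ _ fun j => IsConstrainedMin.total_eq_zero A (hψ i j) hv hfree
    · intro v hv hfree
      exact form_sum_smul_eq_zero _ _ fun j => IsConstrainedMin.total_eq_zero A (hψms i j) hv hfree
  -- The cutoff around a patch of m layers needs one layer more, hence the overlap is counted for m
  -- + 1 layers.
  have hsum := BlockSystem.energy_sum_le (Q := A.system) (M := M) hγ0
    (B := fun i => T.layer i m) (B' := fun i => T.layer i (m + 1))
    (W := fun i => H10 (T.oversampled i m)) (W' := fun i => H10 (T.oversampled i (m + 1)))
    (fun i => hWV i m) (fun i => hWV i (m + 1)) (fun i => hcut i m)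
    (fun i v hv k hk => (A.system_zero_of_mem_H10_oversampled hk hv).1)
    (fun k => by
      have := T.card_layer_le hH hρ hT k (m + 1)
      convert this using 3)
    (ψ := fun i => ∑ j, b i j • ψ i j) (ψms := fun i => ∑ j, b i j • ψms i j)
    (fun i => Submodule.sum_mem _ fun j _ => Submodule.smul_mem _ _ (hψ i j).1)
    (fun i => Submodule.sum_mem _ fun j _ => Submodule.smul_mem _ _ (hψms i j).1)
    (fun i => (A.constrainedAt_sum (fun j => (hψ i j).2.1) (b i)).sub_free
      (A.constrainedAt_sum (fun j => (hψms i j).2.1) (b i)))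
    (fun i v hv hfree => by
      exact form_sum_smul_eq_zero _ _ fun j => IsConstrainedMin.total_eq_zero A (hψ i j) hv hfree)
  rw [← Finset.sum_sub_distrib]
  refine hsum.trans ?_
  set B := ∑ i, ∑ j, b i j ^ 2 with hB
  have hB0 : 0 ≤ B := Finset.sum_nonneg fun i _ => Finset.sum_nonneg fun j _ => sq_nonneg _
  set r := (1 + γ⁻¹) ^ (1 - (m : ℝ)) with hr
  have hr0 : 0 ≤ r := by positivity
  -- (1 + γ)² ≤ 2 + 2γ² with γ² = 4S/Λ, and S ≥ 1 absorbs the 2. Squaring this 8 and multiplying by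
  -- the 4 from the single-block bound gives 256.
  have hγ2 : (1 + γ) ^ 2 ≤ 8 * S * (1 + Λ⁻¹) := by
    have h1 : γ ^ 2 = 4 * S * Λ⁻¹ := by
      rw [hγ, div_pow, mul_pow, Real.sq_sqrt hS0.le, Real.sq_sqrt hΛ0.le]
      ring
    nlinarith [sq_nonneg (1 - γ)]
  have hγ4 : (1 + γ) ^ 2 * (1 + γ) ^ 2 ≤ (8 * S * (1 + Λ⁻¹)) * (8 * S * (1 + Λ⁻¹)) :=
    mul_le_mul hγ2 hγ2 (by positivity) (by positivity)
  have hr2 : decayE Λ S m = S ^ 3 * (1 + Λ⁻¹) ^ 2 * r := by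
    rw [decayE, hr, hγ, inv_div]
  calc (1 + γ) ^ 2 * M * ∑ i, A.system.total (∑ j, b i j • ψ i j - ∑ j, b i j • ψms i j)
        (∑ j, b i j • ψ i j - ∑ j, b i j • ψms i j)
      ≤ (1 + γ) ^ 2 * M * ∑ i, 4 * (1 + γ) ^ 2 * S * r * ∑ j, b i j ^ 2 :=
        mul_le_mul_of_nonneg_left (Finset.sum_le_sum fun i _ => hloc i) (by positivity)
    _ = ((1 + γ) ^ 2 * (1 + γ) ^ 2) * (4 * M * S * r * B) := by
        rw [← Finset.mul_sum]
        ring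
    _ ≤ ((8 * S * (1 + Λ⁻¹)) * (8 * S * (1 + Λ⁻¹))) * (4 * M * S * r * B) :=
        mul_le_mul_of_nonneg_right hγ4 (by positivity)
    _ = 256 * M * decayE Λ S m * B := by
        rw [hr2]
        ring

/-- Lifts exist only for constants above D_*; continuity permits the limit down to S itself. -/
theorem continuousAt_decayE {Λ S : ℝ} (hS : 0 < S) (m : ℕ) :
    ContinuousAt (fun S => decayE Λ S m) S := by
  unfold decayE
  have hs : ContinuousAt (fun S => Real.sqrt S) S := Real.continuous_sqrt.continuousAt
  have hne : 2 * Real.sqrt S ≠ 0 := by positivity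
  refine ((continuousAt_id.pow 3).mul continuousAt_const).mul (ContinuousAt.rpow_const ?_ (Or.inl ?_))
  · exact continuousAt_const.add (continuousAt_const.div (continuousAt_const.mul hs) hne)
  · positivity

end AuxBasis

end CEM

end

/-! ### The main theorem -/

open CEM in
theorem theorem1 (d : ℕ) (hd : d = 2 ∨ d = 3) (ρ : ℝ) (hρ : 0 < ρ) (nv : ℕ) :
    ∃ C : ℝ, 0 < C ∧
      ∀ (D : Set (CEM.Vec d)), IsOpen D → IsConnected D → Bornology.IsBounded D →
      ∀ (T : CEM.CoarseGrid D) (H : ℝ), 0 < H → T.QuasiUniform H ρ → T.VertexBound nv →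
      ∀ (c : CEM.Lame D) (P : CEM.GridPartition T),
        (∀ᵐ x ∂volume.restrict D, 0 < CEM.weight c P x) →
      ∀ (A : CEM.AuxBasis c P) (Λ : ℝ), 0 < Λ → IsLeast A.discarded Λ →
      ∀ (m : ℕ) (ψ ψms : (i : Fin T.N) → Fin (A.J i) → CEM.Pair (volume : Measure (CEM.Vec d))),
        (∀ i j, A.IsConstrainedMin (CEM.H10 D) i j (ψ i j)) →
        (∀ i j, A.IsConstrainedMin (CEM.H10 (T.oversampled i m)) i j (ψms i j)) →
      ∀ (f : CEM.Vec d → CEM.Vec d), MemLp f 2 (volume.restrict D) →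
        MemLp (fun x => (CEM.weight c P x) ^ (-(1 / 2) : ℝ) • f x) 2 (volume.restrict D) →
      ∀ (u uglo uoff : CEM.Pair (volume : Measure (CEM.Vec d))),
        CEM.IsGalerkin c f (CEM.H10 D) u →
        CEM.IsGalerkin c f
          (Submodule.span ℝ (range fun p : Σ i, Fin (A.J i) => ψ p.1 p.2)) uglo →
        CEM.IsGalerkin c f
          (Submodule.span ℝ (range fun p : Σ i, Fin (A.J i) => ψms p.1 p.2)) uoff →
        CEM.normA c (u - uoff) ≤
          C * Λ ^ (-(1 / 2) : ℝ) *
              Real.sqrt (∫ x in D, ‖(CEM.weight c P x) ^ (-(1 / 2) : ℝ) • f x‖ ^ 2)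
            + C * ((m : ℝ) + 1) ^ ((d : ℝ) / 2)
              * CEM.decayE Λ (max (nv : ℝ) A.stabConst) m ^ ((1 / 2) : ℝ)
              * CEM.normS c P uglo := by
  -- The 1 serves the global error. In the localization error 16 is the root of 256, and 2/ρ comes
  -- from (m + 2)/ρ ≤ (m + 1)(2/ρ).
  refine ⟨max 1 (16 * (2 / ρ) ^ ((d : ℝ) / 2)), lt_max_of_lt_left one_pos, ?_⟩
  intro D hD _ _ T H hH hT hnv c P hκ A Λ hΛ0 hΛ m ψ ψms hψ hψms f _ hf u uglo uoff hu hglo hoff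
  set C := max 1 (16 * (2 / ρ) ^ ((d : ℝ) / 2)) with hC
  -- A discarded eigenvalue belongs to some block, so the grid has a block and `nv` is at least 1.
  obtain ⟨k, -⟩ := hΛ.1
  have hnv1 : (1 : ℝ) ≤ nv := by exact_mod_cast T.one_le_of_vertexBound hnv k
  set S := max (nv : ℝ) A.stabConst with hS
  have hS1 : 1 ≤ S := hnv1.trans (le_max_left _ _)
  -- The comparison field: the coefficients of `uglo`, carried over to the localized basis.
  set w := ∑ i, ∑ j, A.system.ℓ i j uglo • ψms i j with hw
  have hwms : w ∈ Submodule.span ℝ (range fun p : Σ i, Fin (A.J i) => ψms p.1 p.2) :=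
    A.sum_mem_span _
  have hmsV : Submodule.span ℝ (range fun p : Σ i, Fin (A.J i) => ψms p.1 p.2) ≤ H10 D := by
    refine Submodule.span_le.2 ?_
    rintro _ ⟨p, rfl⟩
    exact H10_mono (T.oversampled_subset _ _) (hψms p.1 p.2).1
  have hquasi : normA c (u - uoff) ≤ normA c (u - w) := by
    rw [normA_eq A, normA_eq A]
    refine Real.sqrt_le_sqrt ?_
    have hz : uoff - w ∈ Submodule.span ℝ (range fun p : Σ i, Fin (A.J i) => ψms p.1 p.2) :=
      Submodule.sub_mem _ hoff.1 hwms
    have h1 : A.system.total (u - uoff) (uoff - w) = 0 := by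
      rw [form_sub_left, A.total_eq, A.total_eq, hu.2 _ (hmsV hz), hoff.2 _ hz, sub_self]
    rw [← sub_add_sub_cancel u uoff w]
    exact form_self_le_add _ A.system.total_pos A.system.total_symm h1
  have htri : normA c (u - w) ≤ normA c (u - uglo) + normA c (uglo - w) := by
    rw [normA_eq A, normA_eq A, normA_eq A, ← sub_add_sub_cancel u uglo w]
    exact sqrt_form_add_le _ A.system.total_symm A.system.total_pos _ _
  have hglob := A.normA_sub_glo_le hκ hΛ0 hΛ.2 hψ hf hu hglo
  set b2 := ∑ i, ∑ j, A.system.ℓ i j uglo ^ 2 with hb2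
  have hb20 : 0 ≤ b2 := Finset.sum_nonneg fun i _ => Finset.sum_nonneg fun j _ => sq_nonneg _
  -- Bessel's inequality on each block turns the coefficients into the norm ‖u_glo‖_s.
  have hb2le : b2 ≤ massForm (weight c P) D uglo.1 uglo.1 := by
    rw [AuxBasis.massForm_eq_sum]
    exact Finset.sum_le_sum fun k _ => A.system_bessel k uglo
  have hM : ((m + 1 : ℕ) + 1 : ℝ) / ρ ≤ ((m : ℝ) + 1) * (2 / ρ) := by
    rw [← mul_div_assoc]
    refine div_le_div_of_nonneg_right ?_ hρ.le
    push_cast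
    linarith [(Nat.cast_nonneg m : (0 : ℝ) ≤ m)]
  have hE0 : 0 ≤ decayE Λ S m := by
    rw [decayE]
    positivity
  have hlocal : A.system.total (uglo - w) (uglo - w) ≤
      256 * (((m + 1 : ℕ) + 1 : ℝ) / ρ) ^ d * decayE Λ S m * b2 := by
    -- The estimate holds for every S' > S and passes to the limit from the right.
    have htend : Filter.Tendsto (fun S' => 256 * (((m + 1 : ℕ) + 1 : ℝ) / ρ) ^ d * decayE Λ S' m * b2)
        (nhdsWithin S (Ioi S)) (nhds (256 * (((m + 1 : ℕ) + 1 : ℝ) / ρ) ^ d * decayE Λ S m * b2)) :=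
      (((AuxBasis.continuousAt_decayE (lt_of_lt_of_le one_pos hS1) m).tendsto.mono_left
        nhdsWithin_le_nhds).const_mul _).mul_const _
    refine ge_of_tendsto htend ?_
    filter_upwards [self_mem_nhdsWithin] with S' hS'
    have hS'' : S < S' := hS'
    have h1 := A.total_sub_localized_le hD hκ hΛ0 hΛ.2 hnv ((le_max_right _ _).trans_lt hS'')
      ((le_max_left _ _).trans hS''.le) (hS1.trans hS''.le) hH hρ hT hψ hψms
      (fun i j => A.system.ℓ i j uglo)
    have h2 := A.eq_sum_of_mem_span (fun i j => (hψ i j).2.1) hglo.1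
    exact (congrArg (fun z => A.system.total (z - w) (z - w)) h2).le.trans h1
  have hloc : normA c (uglo - w) ≤ C * ((m : ℝ) + 1) ^ ((d : ℝ) / 2) *
      decayE Λ S m ^ ((1 / 2) : ℝ) * normS c P uglo := by
    rw [normA_eq A, normS]
    have h1 : A.system.total (uglo - w) (uglo - w) ≤ 16 ^ 2 * (((m : ℝ) + 1) * (2 / ρ)) ^ d *
        decayE Λ S m * massForm (weight c P) D uglo.1 uglo.1 := by
      refine hlocal.trans ?_
      norm_num
      gcongr
      · simpa using hM
    refine (Real.sqrt_le_sqrt h1).trans ?_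
    have hr : ∀ {x : ℝ}, 0 ≤ x → Real.sqrt (x ^ d) = x ^ ((d : ℝ) / 2) := fun {x} hx => by
      rw [Real.sqrt_eq_rpow, ← Real.rpow_natCast, ← Real.rpow_mul hx]
      ring_nf
    rw [Real.sqrt_mul (by positivity), Real.sqrt_mul (by positivity), Real.sqrt_mul (by positivity),
      Real.sqrt_sq (by norm_num), hr (by positivity), Real.mul_rpow (by positivity) (by positivity),
      Real.sqrt_eq_rpow (decayE Λ S m)]
    refine mul_le_mul_of_nonneg_right ?_ (Real.sqrt_nonneg _)
    refine mul_le_mul_of_nonneg_right ?_ (by positivity)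
    calc 16 * (((m : ℝ) + 1) ^ ((d : ℝ) / 2) * (2 / ρ) ^ ((d : ℝ) / 2))
        = (16 * (2 / ρ) ^ ((d : ℝ) / 2)) * ((m : ℝ) + 1) ^ ((d : ℝ) / 2) := by ring
      _ ≤ C * ((m : ℝ) + 1) ^ ((d : ℝ) / 2) :=
          mul_le_mul_of_nonneg_right (le_max_right _ _) (by positivity)
  have hfst : Λ ^ (-(1 / 2) : ℝ) *
      Real.sqrt (∫ x in D, ‖weight c P x ^ (-(1 / 2) : ℝ) • f x‖ ^ 2) ≤
      C * Λ ^ (-(1 / 2) : ℝ) *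
        Real.sqrt (∫ x in D, ‖weight c P x ^ (-(1 / 2) : ℝ) • f x‖ ^ 2) := by
    rw [mul_assoc]
    exact le_mul_of_one_le_left (by positivity) (le_max_left _ _)
  linarith
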